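/- **Diagrams.** A *long virtual knot diagram* $D$ is a smooth immersion $f:\mathbb{R}\to\mathbb{R}^2$ with $f(t)=(t,0)$ for all sufficiently large $|t|$, all of whose intersection points are transverse double points, each of them marked either as a classical crossing (with overpass and underpass specified) or as a virtual crossing. Two diagrams are *equivalent* if they are connected by a finite sequence of planar isotopies (orientation-preserving diffeomorphisms of the plane and orientation-preserving changes of the parameter) and generalized Reidemeister moves or their inverses: the classical moves $\Omega_1,\Omega_2,\Omega_3$, the virtual moves $\Omega_1',\Omega_2',\Omega_3'$ (the same moves with all crossings virtual), and the mixed move, in which a strand with two virtual crossings is carried across a classical crossing. **Arcs.** Let $D$ have $n\ge 1$ classical crossings $v_1,\dots,v_n$. The *arcs* of $D$ are the pieces into which the curve is cut at all virtual crossings and at all underpasses of classical crossings; the *long arcs* are the pieces into which it is cut at the underpasses only. Here the initial and the final piece are joined through infinity, so that the final arc, followed by the initial arc, counts as one arc, lying on one long arc. Let $\gamma^j$ be the long arc that emanates from $v_j$, i.e. starts at the underpass of $v_j$. On each long arc the first arc has degree $\deg a=0$; if the arc $b$ follows the arc $a$ on a long arc, then $\deg b=\deg a+1$ if the virtual crossing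 between them is passed from the left to the right with respect to the transversal arc, and $\deg b=\deg a-1$ otherwise. **The polynomial.** Let $T=\mathbb{Z}[p^{\pm1},q^{\pm1}]/((p-1)(p-q),(q-1)(p-q))$. For a classical crossing $v$ with local writhe number $\operatorname{sgn}v=\pm1$ put $t=p$ if the overpass of $v$ precedes its underpass on the oriented line, and $t=q$ otherwise. The incidence coefficient $[v:a]\in T$ of $v$ and an arc $a$ is the sum of the following terms: $1$ if $a$ emanates from $v$; $t^{\operatorname{sgn}v}-1$ if $a$ passes over $v$; $-t^{\operatorname{sgn}v}$ if $a$ comes into $v$ at its underpass. Let $A(D)$ be the $n\times n$ matrix over $T[s,s^{-1}]$ with entries $$A_{ij}=\sum_{a\subset\gamma^j}[v_i:a]\,s^{\deg a},$$ and let $\zeta(D)=\det A(D)$, which does not depend on the numbering of the crossings. **Theorem.** If $D$ and $D'$ are equivalent long virtual knot diagrams, each with at least one classical crossing, then $\zeta(D')=q^{r}\zeta(D)$ for some integer $r$. -/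

import Mathlib

open scoped ContDiff

noncomputable section

/-! ### Long virtual knot diagrams -/

/-- The role of a parameter value `t` of a long curve: `t` is not a parameter of an intersection
point (`regular`), or the curve passes at time `t` over or under a classical crossing, or through
a virtual crossing. -/
inductive Passage where
  | regular
  | over
  | under
  | virt

/-- The oriented area of the pair `(u, v)`; it is positive iff `v` points to the left of `u`. -/
def orientedArea (u v : ℝ × ℝ) : ℝ := u.1 * v.2 - u.2 * v.1

/-- A long virtual knot diagram: a smooth immersion of the line in the plane, equal to `(t, 0)`
near both ends, all of whose intersection points are transverse double points, each of them
marked as a classical crossing (with overpass and underpass specified) or as a virtual one. -/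
structure LongDiagram where
  /-- the immersed curve -/
  curve : ℝ → ℝ × ℝ
  smooth : ContDiff ℝ ∞ curve
  immersion : ∀ t, deriv curve t ≠ 0
  straight : ∃ R : ℝ, ∀ t, R < |t| → curve t = (t, 0)
  double : ∀ r s t, curve r = curve s → curve s = curve t → r = s ∨ s = t ∨ r = t
  transverse : ∀ s t, s ≠ t → curve s = curve t →
    orientedArea (deriv curve s) (deriv curve t) ≠ 0
  /-- the crossing structure -/
  kind : ℝ → Passage
  kind_regular : ∀ t, kind t = .regular ↔ ∀ s, s ≠ t → curve s ≠ curve t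
  kind_pair : ∀ s t, s ≠ t → curve s = curve t →
    (kind s = .over ∧ kind t = .under) ∨ (kind s = .under ∧ kind t = .over) ∨
      (kind s = .virt ∧ kind t = .virt)

namespace LongDiagram

variable (D : LongDiagram)

/-- The ordered pairs of distinct parameters with the same image. -/
def doublePairs : Set (ℝ × ℝ) := {x | x.1 ≠ x.2 ∧ D.curve x.1 = D.curve x.2}

theorem hasStrictDerivAt_curve (t : ℝ) : HasStrictDerivAt D.curve (deriv D.curve t) t :=
  D.smooth.contDiffAt.hasStrictDerivAt (by simp)

theorem eventually_notMem_doublePairs (x : ℝ × ℝ) :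
    ∀ᶠ y in nhdsWithin x {x}ᶜ, y ∉ D.doublePairs := by
  obtain ⟨s, t⟩ := x
  by_cases hst : s = t
  · subst hst
    refine Filter.Eventually.filter_mono nhdsWithin_le_nhds ?_
    have h := (D.hasStrictDerivAt_curve s).hasStrictFDerivAt.isLittleO
    have hpos : 0 < ‖deriv D.curve s‖ / 2 := by
      have := norm_pos_iff.2 (D.immersion s)
      positivity
    filter_upwards [h.def hpos] with y hy hmem
    obtain ⟨hne, heq⟩ := hmem
    have h1 : 0 < ‖y.1 - y.2‖ := norm_pos_iff.2 (sub_ne_zero.2 hne)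
    have h2 : 0 < ‖deriv D.curve s‖ := norm_pos_iff.2 (D.immersion s)
    simp only [heq, sub_self, zero_sub, norm_neg, ContinuousLinearMap.toSpanSingleton_apply,
      norm_smul] at hy
    nlinarith
  · by_cases hf : D.curve s = D.curve t
    · have ha := D.transverse s t hst hf
      set a := deriv D.curve s with ha_def
      set b := deriv D.curve t with hb_def
      have hs : HasFDerivAt (fun y : ℝ × ℝ => D.curve y.1)
          ((ContinuousLinearMap.toSpanSingleton ℝ a).comp (ContinuousLinearMap.fst ℝ ℝ ℝ))
          (s, t) :=
        HasFDerivAt.comp (s, t)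
          ((D.hasStrictDerivAt_curve s).hasStrictFDerivAt.hasFDerivAt) hasFDerivAt_fst
      have ht : HasFDerivAt (fun y : ℝ × ℝ => D.curve y.2)
          ((ContinuousLinearMap.toSpanSingleton ℝ b).comp (ContinuousLinearMap.snd ℝ ℝ ℝ))
          (s, t) :=
        HasFDerivAt.comp (s, t)
          ((D.hasStrictDerivAt_curve t).hasStrictFDerivAt.hasFDerivAt) hasFDerivAt_snd
      have hG := hs.sub ht
      set L := (ContinuousLinearMap.toSpanSingleton ℝ a).comp (ContinuousLinearMap.fst ℝ ℝ ℝ) -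
        (ContinuousLinearMap.toSpanSingleton ℝ b).comp (ContinuousLinearMap.snd ℝ ℝ ℝ) with hL
      have hker : LinearMap.ker (L : ℝ × ℝ →ₗ[ℝ] ℝ × ℝ) = ⊥ := by
        rw [LinearMap.ker_eq_bot']
        rintro ⟨u, v⟩ huv
        have h1 : u * a.1 - v * b.1 = 0 := by
          have := congrArg Prod.fst huv
          simpa [hL] using this
        have h2 : u * a.2 - v * b.2 = 0 := by
          have := congrArg Prod.snd huv
          simpa [hL] using this
        unfold orientedArea at ha
        have hu : u * (a.1 * b.2 - a.2 * b.1) = 0 := by linear_combination b.2 * h1 - b.1 * h2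
        have hv : v * (a.1 * b.2 - a.2 * b.1) = 0 := by linear_combination a.2 * h1 - a.1 * h2
        have hu0 := (mul_eq_zero.1 hu).resolve_right ha
        have hv0 := (mul_eq_zero.1 hv).resolve_right ha
        simp [hu0, hv0]
      obtain ⟨K, -, hK⟩ := (L : ℝ × ℝ →ₗ[ℝ] ℝ × ℝ).exists_antilipschitzWith hker
      have hne := hG.eventually_ne (c := 0) ⟨K, hK⟩
      filter_upwards [hne] with y hy hmem
      exact hy (sub_eq_zero.2 hmem.2)
    · refine Filter.Eventually.filter_mono nhdsWithin_le_nhds ?_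
      have hc := D.smooth.continuous
      have ho : IsOpen {y : ℝ × ℝ | D.curve y.1 ≠ D.curve y.2} :=
        isOpen_ne_fun (hc.comp continuous_fst) (hc.comp continuous_snd)
      filter_upwards [ho.mem_nhds hf] with y hy hmem
      exact hy hmem.2

theorem finite_doublePairs : D.doublePairs.Finite := by
  by_contra hinf
  obtain ⟨R, hR⟩ := D.straight
  obtain ⟨M, hM⟩ := (isCompact_Icc (a := -R) (b := R)).exists_bound_of_continuousOn
    D.smooth.continuous.continuousOn
  have key : ∀ s t, s ≠ t → D.curve s = D.curve t → |s| ≤ max R M := by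
    intro s t hne heq
    by_contra hlt
    rw [not_le, max_lt_iff] at hlt
    have hs := hR s hlt.1
    by_cases ht : R < |t|
    · rw [hs, hR t ht] at heq
      exact hne (congrArg Prod.fst heq)
    · have h1 := hM t (Set.mem_Icc.2 (abs_le.1 (not_lt.1 ht)))
      rw [← heq, hs] at h1
      have h2 : |s| ≤ ‖((s, 0) : ℝ × ℝ)‖ := by simp
      linarith [hlt.2]
  have hsub : D.doublePairs ⊆
      Set.Icc (-(max R M)) (max R M) ×ˢ Set.Icc (-(max R M)) (max R M) := by
    rintro ⟨s, t⟩ ⟨hne, heq⟩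
    exact ⟨Set.mem_Icc.2 (abs_le.1 (key s t hne heq)),
      Set.mem_Icc.2 (abs_le.1 (key t s (Ne.symm hne) heq.symm))⟩
  obtain ⟨x, -, hx⟩ := Set.Infinite.exists_accPt_of_subset_isCompact hinf
    (isCompact_Icc.prod isCompact_Icc) hsub
  exact (accPt_iff_frequently_nhdsNE.1 hx) (D.eventually_notMem_doublePairs x)

/-! ### Crossings, arcs and long arcs -/

/-- The classical crossings: pairs `(o, u)` of the parameters of the overpass and the underpass
through the same point. -/
def Crossing : Type :=
  {x : ℝ × ℝ // D.kind x.1 = .over ∧ D.kind x.2 = .under ∧ D.curve x.1 = D.curve x.2}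

/-- The passages of the curve through virtual crossings: pairs `(w, w')` of distinct parameters
of the same virtual crossing, where `w` is the time of the passage considered and `w'` the time
of the passage of the transversal arc. -/
def VirtualPassage : Type :=
  {x : ℝ × ℝ // x.1 ≠ x.2 ∧ D.curve x.1 = D.curve x.2 ∧ D.kind x.1 = .virt}

instance : Finite D.Crossing := by
  refine Set.Finite.to_subtype (D.finite_doublePairs.subset ?_)
  rintro ⟨o, u⟩ ⟨h1, h2, h3⟩
  refine ⟨fun h => ?_, h3⟩
  simp only at h h1 h2
  rw [h, h2] at h1
  cases h1

instance : Finite D.VirtualPassage :=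
  Set.Finite.to_subtype (D.finite_doublePairs.subset fun _ hx => ⟨hx.1, hx.2.1⟩)

instance : Fintype D.Crossing := Fintype.ofFinite _

instance : Fintype D.VirtualPassage := Fintype.ofFinite _

/-- The set of arcs. The initial and the final arc are united (through infinity), so each arc is
determined by the passage at which it starts: the underpass of a classical crossing from which
it emanates, or a passage through a virtual crossing. -/
abbrev Arc : Type := D.Crossing ⊕ D.VirtualPassage

variable {D}

/-- The parameter at which an arc starts. -/
def Arc.start : D.Arc → ℝ
  | .inl v => v.1.2
  | .inr w => w.1.1

/-- `CyclicBetween b x t`: going from the time `b` in the positive direction of the line, closed up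
by a point at infinity, one meets `x` strictly after leaving `b` and strictly before first
arriving at `t` (for `b = t`, one goes around once). -/
def CyclicBetween (b x t : ℝ) : Prop := (b < x ∧ x < t) ∨ (t ≤ b ∧ b < x) ∨ (x < t ∧ t ≤ b)

/-- The arc `a`, followed from its start, reaches the time `t` before any other arc starts: `t` is
an interior time or the final time of the arc `a`. -/
def Arc.Reaches (a : D.Arc) (t : ℝ) : Prop :=
  ∀ b : D.Arc, ¬ CyclicBetween a.start b.start t

/-- The arc `a` lies on the long arc that emanates from the classical crossing `v`: it is the arc
emanating from `v`, or it starts at a virtual crossing and no underpass lies between `v` and it. -/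
def Arc.OnLongArc (a : D.Arc) (v : D.Crossing) : Prop :=
  match a with
  | .inl v' => v' = v
  | .inr w => ∀ v' : D.Crossing, ¬ CyclicBetween v.1.2 v'.1.2 w.1.1

/-- The change of degree at a passage through a virtual crossing: `1` if the curve passes from
the left to the right with respect to the transversal arc, and `-1` otherwise. -/
def VirtualPassage.step (w : D.VirtualPassage) : ℤ :=
  if 0 < orientedArea (deriv D.curve w.1.1) (deriv D.curve w.1.2) then 1 else -1

open Classical in
/-- The degree of an arc `a` on the long arc that emanates from `v`: it is `0` for the first arc, and
the sum of the changes at the virtual crossings passed from `v` to the start of `a` for others. -/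
def Arc.deg (v : D.Crossing) (a : D.Arc) : ℤ :=
  match a with
  | .inl _ => 0
  | .inr w => ∑ w' : D.VirtualPassage,
      if w' = w ∨ CyclicBetween v.1.2 w'.1.1 w.1.1 then w'.step else 0

end LongDiagram

/-! ### The coefficient ring -/

/-- The ideal `((p-1)(p-q), (q-1)(p-q))` of the ring `ℤ[p, p⁻¹, q, q⁻¹]`. The outer variable of
the iterated Laurent polynomial ring is `q`, the inner one is `p`. -/
def relationIdeal : Ideal (LaurentPolynomial (LaurentPolynomial ℤ)) :=
  let p : LaurentPolynomial (LaurentPolynomial ℤ) := LaurentPolynomial.C (LaurentPolynomial.T 1)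
  let q : LaurentPolynomial (LaurentPolynomial ℤ) := LaurentPolynomial.T 1
  Ideal.span {(p - 1) * (p - q), (q - 1) * (p - q)}

/-- The ring `ℤ[p, p⁻¹, q, q⁻¹] / ((p-1)(p-q), (q-1)(p-q))`. -/
def CoeffRing : Type := LaurentPolynomial (LaurentPolynomial ℤ) ⧸ relationIdeal

instance : CommRing CoeffRing :=
  inferInstanceAs (CommRing (LaurentPolynomial (LaurentPolynomial ℤ) ⧸ relationIdeal))

/-- The projection to the coefficient ring. -/
def toCoeffRing : LaurentPolynomial (LaurentPolynomial ℤ) →+* CoeffRing :=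
  Ideal.Quotient.mk relationIdeal

/-- The power `p ^ k` in the coefficient ring. -/
def pPow (k : ℤ) : CoeffRing :=
  toCoeffRing (LaurentPolynomial.C (LaurentPolynomial.T k))

/-- The power `q ^ k` in the coefficient ring. -/
def qPow (k : ℤ) : CoeffRing :=
  toCoeffRing (LaurentPolynomial.T k)

/-! ### The ζ-polynomial -/

namespace LongDiagram

variable {D : LongDiagram}

/-- The local writhe number of a classical crossing. -/
def Crossing.sgn (v : D.Crossing) : ℤ :=
  if 0 < orientedArea (deriv D.curve v.1.1) (deriv D.curve v.1.2) then 1 else -1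

open Classical in
/-- The element `t ^ sgn v`, where `t = p` if `v` is an early overcrossing and `t = q` if `v` is
an early undercrossing. -/
def Crossing.weight (v : D.Crossing) : CoeffRing :=
  if v.1.1 < v.1.2 then pPow v.sgn else qPow v.sgn

open Classical in
/-- The incidence coefficient `[v : a]`: the sum of `1` if `a` emanates from `v`, of
`t ^ sgn v - 1` if `a` passes over `v`, and of `- t ^ sgn v` if `a` comes into `v`. -/
def incidence (v : D.Crossing) (a : D.Arc) : CoeffRing :=
  (if a = .inl v then 1 else 0) + (if a.Reaches v.1.1 then v.weight - 1 else 0) +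
    (if a.Reaches v.1.2 then -v.weight else 0)

variable (D)

open Classical in
/-- The matrix `A(D)`, with entries in `T[s, s⁻¹]`. The columns, indexed by the long arcs, are
labelled by the classical crossings from which the long arcs emanate. -/
def alexanderMatrix : Matrix D.Crossing D.Crossing (LaurentPolynomial CoeffRing) :=
  fun v v' => ∑ a : D.Arc,
    if a.OnLongArc v' then
      LaurentPolynomial.C (incidence v a) * LaurentPolynomial.T (a.deg v')
    else 0

open Classical in
/-- The ζ-polynomial of a long virtual knot diagram. -/
def zeta : LaurentPolynomial CoeffRing := D.alexanderMatrix.det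

/-! ### Generalized Reidemeister moves -/

/-- The square in which moves take place. Up to isotopy of the diagram, it is enough to perform
moves in a fixed square. -/
def square : Set (ℝ × ℝ) := {x | |x.1| ≤ 1 ∧ |x.2| ≤ 1}

/-- The time interval in which a strand with central time `c` runs through the square. -/
def strand (c : ℝ) : Set ℝ := Set.Icc (c - 1) (c + 1)

/-- At the times outside `S` the diagram `D` is outside the square, and `D'` is the same as `D`. -/
def SameOff (D D' : LongDiagram) (S : Set ℝ) : Prop :=
  ∀ t, t ∉ S → D.curve t ∉ square ∧ D'.curve t = D.curve t ∧ D'.kind t = D.kind t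

/-- `D'` is obtained from `D` by an orientation-preserving diffeomorphism of the plane and an
increasing smooth change of the parameter. -/
def Isotopic (D D' : LongDiagram) : Prop :=
  ∃ (Φ : ℝ × ℝ ≃ ℝ × ℝ) (σ : ℝ ≃ ℝ),
    ContDiff ℝ ∞ Φ ∧ ContDiff ℝ ∞ Φ.symm ∧ (∀ x, 0 < (fderiv ℝ Φ x).det) ∧
    ContDiff ℝ ∞ σ ∧ ContDiff ℝ ∞ σ.symm ∧ StrictMono σ ∧
    ∀ t, D'.curve t = Φ (D.curve (σ t)) ∧ D'.kind t = D.kind (σ t)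

/-- The first move, classical or virtual: a straight strand of `D` without crossings is replaced
by a strand that crosses itself exactly once. -/
def MoveOne (D D' : LongDiagram) : Prop :=
  ∃ c : ℝ, SameOff D D' (strand c) ∧
    (∀ x ∈ Set.Icc (-1 : ℝ) 1, D.curve (c + x) = (x, 0)) ∧
    (∀ t ∈ strand c, D'.curve t ∈ square) ∧
    ∃ a b : ℝ, c - 1 < a ∧ a < b ∧ b < c + 1 ∧ D'.curve a = D'.curve b ∧
      ∀ s ∈ strand c, ∀ t ∈ strand c, s < t → D'.curve s = D'.curve t → s = a ∧ t = b

/-- The second move, classical or virtual: of two strands of `D` without crossings, running in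
any directions, one is the segment `y = 0` and the other one is the graph of a positive function;
in `D'` the latter is `y = x ^ 2 - 1 / 4`, and either the same strand is the upper one at both new
crossings, or both of them are virtual. -/
def MoveTwo (D D' : LongDiagram) : Prop :=
  ∃ (c₁ c₂ e₁ e₂ : ℝ) (h : ℝ → ℝ),
    2 < |c₁ - c₂| ∧ (e₁ = 1 ∨ e₁ = -1) ∧ (e₂ = 1 ∨ e₂ = -1) ∧
    SameOff D D' (strand c₁ ∪ strand c₂) ∧
    (∀ x ∈ Set.Icc (-1 : ℝ) 1, 0 < h x ∧ h x ≤ 1 ∧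
      D.curve (c₁ + e₁ * x) = (x, 0) ∧ D.curve (c₂ + e₂ * x) = (x, h x) ∧
      D'.curve (c₁ + e₁ * x) = (x, 0) ∧ D'.curve (c₂ + e₂ * x) = (x, x ^ 2 - 1 / 4)) ∧
    D'.kind (c₁ + 1 / 2) = D'.kind (c₁ - 1 / 2)

/-- The admissible crossing types of a triangle formed by three strands with central times `c`:
either all three crossings are classical and the strands lie at three different heights, or all
crossings on one of the strands are virtual (the third crossing, of the other two strands, may
then be classical or virtual). -/
def TriangleTypes (D : LongDiagram) (c : Fin 3 → ℝ) : Prop :=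
  (∃ height : Equiv.Perm (Fin 3), ∀ i j, height j < height i →
    ∀ s ∈ strand (c i), ∀ t ∈ strand (c j), D.curve s = D.curve t →
      D.kind s = .over ∧ D.kind t = .under) ∨
  (∃ i, ∀ s ∈ strand (c i), D.kind s = .regular ∨ D.kind s = .virt)

/-- The third move, classical, virtual or mixed: three strands, running in any directions, are the
segments `y = x` and `y = - x` and the graph `y = g x` of a function with `|g'| < 1` that passes
above the intersection of the two segments. In `D'` the picture in the square is rotated by the
angle `π` (the strands keep their directions and the crossings keep their types), so that the
third strand passes on the other side of that intersection. -/
def MoveThree (D D' : LongDiagram) : Prop :=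
  ∃ (c e : Fin 3 → ℝ) (g : ℝ → ℝ),
    (∀ i j, i ≠ j → 2 < |c i - c j|) ∧ (∀ i, e i = 1 ∨ e i = -1) ∧
    ContDiff ℝ ∞ g ∧ g (-1) = 0 ∧ g 1 = 0 ∧ 0 < g 0 ∧
    (∀ x ∈ Set.Icc (-1 : ℝ) 1, |deriv g x| < 1) ∧
    SameOff D D' (⋃ i, strand (c i)) ∧
    TriangleTypes D c ∧
    ∀ i, ∀ x ∈ Set.Icc (-1 : ℝ) 1,
      let y : Fin 3 → ℝ → ℝ := ![fun x => x, fun x => -x, g]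
      D.curve (c i + e i * x) = (x, y i x) ∧
      D'.curve (c i + e i * x) = (x, -(y i (-x))) ∧
      D'.kind (c i + e i * x) = D.kind (c i - e i * x)

/-- Two diagrams are equivalent (represent the same long virtual knot) if they are connected by
a finite sequence of isotopies and generalized Reidemeister moves and their inverses. -/
def Equivalent : LongDiagram → LongDiagram → Prop :=
  Relation.EqvGen fun D D' => Isotopic D D' ∨ MoveOne D D' ∨ MoveTwo D D' ∨ MoveThree D D'

end LongDiagram

end

/-! Read the matrix as a system of linear relations. Each cut of the line, closed up at infinity,
carries a generator, and at an underpass with weight `w` the outgoing generator equals `w` times the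
incoming one plus `1 - w` times the overpassing one. The powers of `s` are handled by levels: the
level of a time is the sum of the degree changes before it. The two passages of a virtual crossing
contribute opposite changes, so the total is zero and every degree on a long arc is a difference of
levels, also across infinity. Conjugation by the diagonal matrix of the `s ^ level` leaves a single
power of `s` per relation, namely level at the overpass minus level at the underpass, attached to
the coefficient `1 - w` (`zeta_eq_cutDet`).

A cut at a time that is not an underpass gives the relation "new generator = preceding generator"
and does not change the determinant (`cutDet_sum_unit`), so any finite nonempty set of cuts
containing the underpasses may be used (`cutDet_eq_reducedZeta`). This defines `reducedZeta` for all
diagrams. It must replace `zeta` along a chain of moves, where diagrams without classical crossings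
can occur: there the empty determinant is `1`, while the relation at the single cut `0` is trivial
and gives `0`.

For a move in the square, cut also at the entry and the exit of every strand and eliminate the
generators inside (`reducedZeta_eq_det_outerMatrix`). What remains is the determinant of the inner
block times that of an outer matrix, which depends on the inside only through the exit generators as
combinations of entry generators. Each strand has the same total change of degree before and after
the move, so the rest of the outer matrix is unchanged (`LocalChange.outerMatrix_eq`). It remains to
compare the exits:

In the first move the exit equals the entry. The inner determinant is `1`, except when the underpass
comes first: then the overpassing arc starts at the underpass itself and the determinant is `1 - (1
- w) = w`, a power of `q`. This is the only source of the factor in the theorem. In the second move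
the two weights are inverse and the two underpasses cancel. In the third move with classical
crossings the two expressions for the exit of the lowest strand differ by a multiple of `(1 - w') *
(w - w₃)` or `(1 - w') * (1 - w * w₃)`, which vanishes by the relations of the ring `T`. With a
virtual strand, carrying it across the classical crossing changes the levels of overpass and
underpass by the same amount. -/

open scoped ContDiff

noncomputable section

namespace LongDiagram

/-! ### Cyclic predecessors -/

section CyclicPred

variable {ι : Type*} (τ : ι → ℝ)

/-- `j` is the last of the times `τ` met before arriving at `t`, in the cyclic sense. -/
def IsCyclicPred (t : ℝ) (j : ι) : Prop := ∀ x, ¬ CyclicBetween (τ j) (τ x) t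

/-- If some time precedes `t`, the latest of these is the predecessor; otherwise one goes back
through infinity to the last time of all. -/
theorem exists_isCyclicPred [Finite ι] [Nonempty ι] (t : ℝ) : ∃ j, IsCyclicPred τ t j := by
  by_cases h : ∃ x, τ x < t
  · obtain ⟨x, hx⟩ := h
    obtain ⟨j, hj, hmax⟩ := Set.exists_max_image {x | τ x < t} τ (Set.toFinite _) ⟨x, hx⟩
    refine ⟨j, fun y hy => ?_⟩
    rcases hy with ⟨h1, h2⟩ | ⟨h1, h2⟩ | ⟨h1, h2⟩
    · exact absurd (hmax y h2) (not_le.2 h1)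
    · exact absurd hj (not_lt.2 h1)
    · exact absurd hj (not_lt.2 h2)
  · push Not at h
    obtain ⟨j, hmax⟩ := Finite.exists_max τ
    refine ⟨j, fun y hy => ?_⟩
    rcases hy with ⟨h1, h2⟩ | ⟨h1, h2⟩ | ⟨h1, h2⟩
    · exact absurd (hmax y) (not_le.2 h1)
    · exact absurd (hmax y) (not_le.2 h2)
    · exact absurd h1 (not_lt.2 (h y))

variable {τ}

theorem IsCyclicPred.unique (hτ : Function.Injective τ) {t : ℝ} {i j : ι}
    (hi : IsCyclicPred τ t i) (hj : IsCyclicPred τ t j) : i = j := by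
  have key : ∀ i j : ι, IsCyclicPred τ t i → IsCyclicPred τ t j → ¬ τ i < τ j := by
    intro i j hi hj hlt
    rcases lt_or_ge (τ j) t with h | h
    · exact hi j (Or.inl ⟨hlt, h⟩)
    · rcases lt_or_ge (τ i) t with h' | h'
      · exact hj i (Or.inr (Or.inr ⟨h', h⟩))
      · exact hi j (Or.inr (Or.inl ⟨h', hlt⟩))
  exact hτ (le_antisymm (not_lt.1 (key j i hj hi)) (not_lt.1 (key i j hi hj)))

variable (τ) in
/-- The last of the times `τ` met before arriving at `t`, in the cyclic sense. -/
def cyclicPred [Finite ι] [Nonempty ι] (t : ℝ) : ι := (exists_isCyclicPred τ t).choose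

variable [Finite ι] [Nonempty ι]

theorem isCyclicPred_cyclicPred (t : ℝ) : IsCyclicPred τ t (cyclicPred τ t) :=
  (exists_isCyclicPred τ t).choose_spec

theorem IsCyclicPred.cyclicPred_eq (hτ : Function.Injective τ) {t : ℝ} {j : ι}
    (h : IsCyclicPred τ t j) : cyclicPred τ t = j :=
  (isCyclicPred_cyclicPred t).unique hτ h

/-- The criterion without passage through infinity; it suffices for all predecessors computed inside
the square. -/
theorem cyclicPred_eq_of_lt (hτ : Function.Injective τ) {t : ℝ} {j : ι} (hj : τ j < t)
    (h : ∀ x, τ j < τ x → t ≤ τ x) : cyclicPred τ t = j := by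
  refine IsCyclicPred.cyclicPred_eq hτ fun x hx => ?_
  rcases hx with ⟨h1, h2⟩ | ⟨h1, h2⟩ | ⟨h1, h2⟩
  · exact absurd h2 (not_lt.2 (h x h1))
  · exact absurd hj (not_lt.2 h1)
  · exact absurd hj (not_lt.2 h2)

/-- Cyclic predecessors are transported by bijections which preserve the order relations. -/
theorem cyclicPred_comp {ι' : Type*} [Finite ι'] [Nonempty ι'] {τ' : ι' → ℝ}
    (hτ' : Function.Injective τ') (e : ι ≃ ι') {t t' : ℝ}
    (h₁ : ∀ x y, τ x < τ y ↔ τ' (e x) < τ' (e y)) (h₂ : ∀ x, τ x < t ↔ τ' (e x) < t') :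
    cyclicPred τ' t' = e (cyclicPred τ t) := by
  refine IsCyclicPred.cyclicPred_eq hτ' fun x hx => ?_
  obtain ⟨x, rfl⟩ := e.surjective x
  apply isCyclicPred_cyclicPred (τ := τ) t x
  unfold CyclicBetween at hx ⊢
  rwa [← not_lt, h₁, h₂, h₂, not_lt]

end CyclicPred

/-! ### Determinants of systems of two-term relations -/

section Relations

variable {R : Type*} [CommRing R] {ι κ J : Type*} [Fintype ι] [Fintype κ] [Fintype J]

open Classical in
/-- The matrix of the relations `x i = W i * x (f i) + K i * x (g i)`. -/
def relationMatrix (f g : ι → ι) (W K : ι → R) : Matrix ι ι R :=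
  fun i => Pi.single i 1 - W i • Pi.single (f i) 1 - K i • Pi.single (g i) 1

-- The columns of `val` solve the relations in `J`. Multiplying on the right by the unipotent block
-- matrix with lower left block `V` therefore clears the lower left block, and the upper left block
-- becomes the matrix after substitution.
open Classical in
theorem det_relationMatrix_sum_aux (f g : κ ⊕ J → κ ⊕ J) (W K : κ ⊕ J → R) (val : κ ⊕ J → κ → R)
    (hκ : ∀ k, val (.inl k) = Pi.single k 1)
    (hJ : ∀ j, val (.inr j) = W (.inr j) • val (f (.inr j)) + K (.inr j) • val (g (.inr j))) :
    (relationMatrix f g W K).det = (relationMatrix f g W K).toBlocks₂₂.det *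
      Matrix.det (fun k => Pi.single k 1 - W (.inl k) • val (f (.inl k)) -
        K (.inl k) • val (g (.inl k))) := by
  set M := relationMatrix f g W K with hM
  set N : Matrix κ κ R := fun k => Pi.single k 1 - W (.inl k) • val (f (.inl k)) -
        K (.inl k) • val (g (.inl k)) with hN
  set V : Matrix J κ R := fun j => val (.inr j) with hV
  have hmul : ∀ i k, ∑ j, M i j * val j k =
      val i k - W i * val (f i) k - K i * val (g i) k := by
    intro i k
    simp [hM, relationMatrix, sub_mul, Finset.sum_sub_distrib, Pi.single_apply]
  have hprod : M * Matrix.fromBlocks 1 0 V 1 =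
      Matrix.fromBlocks N M.toBlocks₁₂ 0 M.toBlocks₂₂ := by
    have hV' : ∀ (j : κ ⊕ J) (k : κ), Matrix.fromBlocks 1 0 V (1 : Matrix J J R) j (.inl k) = val j k := by
      intro j k
      rcases j with j | j
      · rw [hκ, Matrix.fromBlocks_apply₁₁, Matrix.one_apply, Pi.single_apply]
        exact if_congr eq_comm rfl rfl
      · rfl
    ext i k
    rcases k with k | k
    · rw [Matrix.mul_apply]
      simp only [hV']
      rw [hmul]
      rcases i with i | i
      · rw [hκ]
        rfl
      · simp [hJ]
    · rcases i with i | i <;>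
      simp [Matrix.mul_apply, Matrix.toBlocks₁₂, Matrix.toBlocks₂₂, Matrix.one_apply]
  have := congrArg Matrix.det hprod
  rw [Matrix.det_mul, Matrix.det_fromBlocks_zero₁₂, Matrix.det_fromBlocks_zero₂₁] at this
  simpa [mul_comm] using this

/-- Elimination of the generators in `J`, expressed by `val` through those in `κ`. -/
theorem det_relationMatrix_sum [DecidableEq κ] [DecidableEq J] [DecidableEq (κ ⊕ J)]
    (f g : κ ⊕ J → κ ⊕ J) (W K : κ ⊕ J → R) (val : κ ⊕ J → κ → R)
    (hκ : ∀ k, val (.inl k) = Pi.single k 1)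
    (hJ : ∀ j, val (.inr j) = W (.inr j) • val (f (.inr j)) + K (.inr j) • val (g (.inr j))) :
    (relationMatrix f g W K).det = (relationMatrix f g W K).toBlocks₂₂.det *
      Matrix.det (fun k => Pi.single k 1 - W (.inl k) • val (f (.inl k)) -
        K (.inl k) • val (g (.inl k))) := by
  obtain rfl : ‹DecidableEq κ› = (fun a b => Classical.propDecidable (a = b)) :=
    Subsingleton.elim _ _
  obtain rfl : ‹DecidableEq J› = (fun a b => Classical.propDecidable (a = b)) :=
    Subsingleton.elim _ _
  rw [← det_relationMatrix_sum_aux f g W K val hκ hJ]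
  congr!

-- Compatibility of `g` is asked only where `K i ≠ 0`: for a cut that is not an underpass the
-- overpassing arc has no meaning.
open Classical in
theorem det_relationMatrix_equiv {ι' : Type*} [Fintype ι'] (e : ι ≃ ι') (f g : ι → ι) (W K : ι → R)
    (f' g' : ι' → ι') (W' K' : ι' → R) (hW : ∀ i, W' (e i) = W i) (hK : ∀ i, K' (e i) = K i)
    (hf : ∀ i, f' (e i) = e (f i)) (hg : ∀ i, K i ≠ 0 → g' (e i) = e (g i)) :
    (relationMatrix f' g' W' K').det = (relationMatrix f g W K).det := by
  rw [← Matrix.det_submatrix_equiv_self e]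
  congr 1
  ext i j
  by_cases h : K i = 0
  · simp [relationMatrix, Pi.single_apply, hW, hK, hf, h]
  · simp [relationMatrix, Pi.single_apply, hW, hK, hf, hg i h]

end Relations

end LongDiagram

namespace LongDiagram

/-! ### The reduced form of the ζ-polynomial -/

section Data

variable (D : LongDiagram)

open Classical in
/-- The other time at which the curve passes through the point `D.curve t`, if there is one. -/
def partner (t : ℝ) : ℝ := if h : ∃ s, s ≠ t ∧ D.curve s = D.curve t then h.choose else t

/-- The sign of the area of a pair of vectors which are not parallel. -/
def areaSign (u v : ℝ × ℝ) : ℤ := if 0 < orientedArea u v then 1 else -1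

open Classical in
/-- The weight `t ^ sgn v` at the underpass of a classical crossing, and `1` at other times. -/
def weightAt (t : ℝ) : CoeffRing :=
  if D.kind t = .under then
    if D.partner t < t then pPow (areaSign (deriv D.curve (D.partner t)) (deriv D.curve t))
    else qPow (areaSign (deriv D.curve (D.partner t)) (deriv D.curve t))
  else 1

open Classical in
/-- The change of degree at time `t`. -/
def stepAt (t : ℝ) : ℤ :=
  if D.kind t = .virt then areaSign (deriv D.curve t) (deriv D.curve (D.partner t)) else 0

open Classical in
/-- The total change of degree before time `t`. -/
def level (t : ℝ) : ℤ := ∑ᶠ x, if x < t then D.stepAt x else 0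

/-- The coefficient of the overpassing arc in the relation at the underpass at time `t`. -/
def overCoeff (t : ℝ) : LaurentPolynomial CoeffRing :=
  LaurentPolynomial.C (1 - D.weightAt t) * LaurentPolynomial.T (D.level (D.partner t) - D.level t)

/-- The matrix of relations of the line cut at the times `τ`. -/
def cutMatrix {ι : Type*} [Fintype ι] [Nonempty ι] (τ : ι → ℝ) :
    Matrix ι ι (LaurentPolynomial CoeffRing) :=
  relationMatrix (fun i => cyclicPred τ (τ i)) (fun i => cyclicPred τ (D.partner (τ i)))
    (fun i => LaurentPolynomial.C (D.weightAt (τ i))) (fun i => D.overCoeff (τ i))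

open Classical in
/-- The determinant of the relations of the line cut at the times `τ`. -/
def cutDet {ι : Type*} [Fintype ι] [Nonempty ι] (τ : ι → ℝ) : LaurentPolynomial CoeffRing :=
  (D.cutMatrix τ).det

variable {D}

/-- All intersection points are double, so the choice in `partner` is forced. -/
theorem partner_eq {s t : ℝ} (h : s ≠ t) (he : D.curve s = D.curve t) : D.partner t = s := by
  have hex : ∃ s, s ≠ t ∧ D.curve s = D.curve t := ⟨s, h, he⟩
  rw [partner, dif_pos hex]
  obtain ⟨h1, h2⟩ := hex.choose_spec
  rcases D.double _ _ _ (h2.trans he.symm) he with h' | h' | h'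
  · exact h'
  · exact absurd h' h
  · exact absurd h' h1

theorem exists_of_kind_ne_regular {t : ℝ} (h : D.kind t ≠ .regular) :
    ∃ s, s ≠ t ∧ D.curve s = D.curve t := by
  by_contra hcon
  push Not at hcon
  exact h ((D.kind_regular t).2 hcon)

theorem partner_spec {t : ℝ} (h : D.kind t ≠ .regular) :
    D.partner t ≠ t ∧ D.curve (D.partner t) = D.curve t := by
  obtain ⟨s, hs, he⟩ := exists_of_kind_ne_regular h
  rw [partner_eq hs he]
  exact ⟨hs, he⟩

theorem partner_partner {t : ℝ} (h : D.kind t ≠ .regular) : D.partner (D.partner t) = t :=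
  partner_eq (partner_spec h).1.symm (partner_spec h).2.symm

theorem kind_partner_of_under {t : ℝ} (h : D.kind t = .under) : D.kind (D.partner t) = .over := by
  have hp := partner_spec (D := D) (t := t) (by simp [h])
  rcases D.kind_pair _ _ hp.1 hp.2 with ⟨h1, h2⟩ | ⟨h1, h2⟩ | ⟨h1, h2⟩ <;> simp_all

theorem kind_partner_of_virt {t : ℝ} (h : D.kind t = .virt) : D.kind (D.partner t) = .virt := by
  have hp := partner_spec (D := D) (t := t) (by simp [h])
  rcases D.kind_pair _ _ hp.1 hp.2 with ⟨h1, h2⟩ | ⟨h1, h2⟩ | ⟨h1, h2⟩ <;> simp_all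

theorem weightAt_of_ne {t : ℝ} (h : D.kind t ≠ .under) : D.weightAt t = 1 := if_neg h

theorem overCoeff_of_ne {t : ℝ} (h : D.kind t ≠ .under) : D.overCoeff t = 0 := by
  simp [overCoeff, weightAt_of_ne h]

theorem stepAt_of_ne {t : ℝ} (h : D.kind t ≠ .virt) : D.stepAt t = 0 := if_neg h

/-- The value of `areaSign` at zero area is `-1`, so antisymmetry requires transversality. -/
theorem areaSign_swap {u v : ℝ × ℝ} (h : orientedArea u v ≠ 0) : areaSign v u = -areaSign u v := by
  have : orientedArea v u = -orientedArea u v := by unfold orientedArea; ring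
  rcases lt_or_gt_of_ne h with h' | h'
  · rw [areaSign, areaSign, if_pos (by linarith), if_neg (by linarith)]; rfl
  · rw [areaSign, areaSign, if_neg (by linarith), if_pos (by linarith)]

theorem stepAt_partner {t : ℝ} (h : D.kind t = .virt) : D.stepAt (D.partner t) = -D.stepAt t := by
  have hp := partner_spec (D := D) (t := t) (by simp [h])
  rw [stepAt, stepAt, if_pos h, if_pos (kind_partner_of_virt h), partner_partner (by simp [h])]
  exact areaSign_swap (D.transverse _ _ hp.1.symm hp.2.symm)

variable (D)

theorem finite_kind_ne_regular : {t | D.kind t ≠ .regular}.Finite := by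
  refine (D.finite_doublePairs.image Prod.fst).subset fun t ht => ?_
  have hp := partner_spec ht
  exact ⟨(t, D.partner t), ⟨hp.1.symm, hp.2.symm⟩, rfl⟩

theorem finite_under : {t | D.kind t = .under}.Finite :=
  D.finite_kind_ne_regular.subset fun t ht => by simp_all

theorem finite_virt : {t | D.kind t = .virt}.Finite :=
  D.finite_kind_ne_regular.subset fun t ht => by simp_all

theorem finite_support_stepAt : (Function.support D.stepAt).Finite :=
  D.finite_virt.subset fun t ht => by
    by_contra h
    exact ht (stepAt_of_ne h)

/-- The times of the passages through virtual crossings. -/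
def virtualTimes : Finset ℝ := D.finite_virt.toFinset

variable {D}

theorem VirtualPassage.partner_eq (w : D.VirtualPassage) : D.partner w.1.1 = w.1.2 :=
  LongDiagram.partner_eq w.2.1.symm w.2.2.1.symm

theorem VirtualPassage.step_eq (w : D.VirtualPassage) : w.step = D.stepAt w.1.1 := by
  rw [stepAt, if_pos w.2.2.2, w.partner_eq]
  rfl

/-- A sum over the virtual passages as a sum over their times. -/
theorem sum_virtualPassage {M : Type*} [AddCommMonoid M] (f : ℝ → M) :
    ∑ w : D.VirtualPassage, f w.1.1 = ∑ t ∈ D.virtualTimes, f t := by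
  refine Finset.sum_bij (fun w _ => w.1.1) ?_ ?_ ?_ ?_
  · intro w _
    simpa [virtualTimes] using w.2.2.2
  · intro w _ w' _ h
    refine Subtype.ext (Prod.ext h ?_)
    rw [← w.partner_eq, ← w'.partner_eq, h]
  · intro t ht
    have ht' : D.kind t = .virt := by simpa [virtualTimes] using ht
    have hp := partner_spec (D := D) (t := t) (by simp [ht'])
    exact ⟨⟨(t, D.partner t), hp.1.symm, hp.2.symm, ht'⟩, Finset.mem_univ _, rfl⟩
  · intros; rfl

-- The sum over all times is suited to reparametrization and localization, the sum over virtual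
-- passages to comparison with `Arc.deg`.
variable (D) in
theorem level_eq_sum (t : ℝ) :
    D.level t = ∑ w : D.VirtualPassage, if w.1.1 < t then w.step else 0 := by
  have h := sum_virtualPassage (D := D) (fun x => if x < t then D.stepAt x else 0)
  simp only [VirtualPassage.step_eq]
  rw [h, level]
  refine finsum_eq_sum_of_support_subset _ fun x hx => ?_
  by_contra hcon
  refine hx ?_
  have : D.kind x ≠ .virt := by simpa [virtualTimes] using hcon
  simp [stepAt_of_ne this]

-- The two passages of a virtual crossing cancel. Hence differences of levels also measure degrees
-- on long arcs that pass through infinity.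
variable (D) in
theorem sum_step : ∑ w : D.VirtualPassage, w.step = 0 := by
  simp only [VirtualPassage.step_eq]
  rw [sum_virtualPassage D.stepAt]
  refine Finset.sum_involution (fun t _ => D.partner t) ?_ ?_ ?_ ?_
  · intro t ht
    rw [stepAt_partner (by simpa [virtualTimes] using ht)]
    ring
  · intro t ht _
    exact (partner_spec (by simp_all [virtualTimes])).1
  · intro t ht
    have : D.kind t = .virt := by simpa [virtualTimes] using ht
    simpa [virtualTimes] using kind_partner_of_virt this
  · intro t ht
    exact partner_partner (by simp_all [virtualTimes])

/-- The change of degree from a time `b`, which is not the time of a virtual passage, to `t`. -/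
theorem sum_cyclicBetween {b : ℝ} (hb : D.kind b ≠ .virt) (t : ℝ) [∀ x, Decidable (CyclicBetween b x t)] :
    (∑ w : D.VirtualPassage, if CyclicBetween b w.1.1 t then w.step else 0) =
      D.level t - D.level b := by
  have hne : ∀ w : D.VirtualPassage, w.1.1 ≠ b := fun w h => hb (h ▸ w.2.2.2)
  rw [level_eq_sum, level_eq_sum, ← Finset.sum_sub_distrib]
  rcases lt_or_ge b t with h | h
  · refine Finset.sum_congr rfl fun w _ => ?_
    have hw := hne w
    by_cases hc : CyclicBetween b w.1.1 t
    · rw [if_pos hc]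
      unfold CyclicBetween at hc
      split_ifs <;> first | (exfalso; grind) | ring
    · rw [if_neg hc]
      unfold CyclicBetween at hc
      split_ifs <;> first | (exfalso; grind) | ring
  -- The way from `b` to `t` passes through infinity; the two sides then differ by the sum of all
  -- steps, which is zero.
  · rw [← sub_eq_zero, ← Finset.sum_sub_distrib]
    refine Eq.trans (Finset.sum_congr rfl fun w _ => ?_) D.sum_step
    have hw := hne w
    by_cases hc : CyclicBetween b w.1.1 t
    · rw [if_pos hc]
      unfold CyclicBetween at hc
      split_ifs <;> first | (exfalso; grind) | ring
    · rw [if_neg hc]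
      unfold CyclicBetween at hc
      split_ifs <;> first | (exfalso; grind) | ring

end Data

/-! ### The Alexander matrix as a conjugate of the cut matrix -/

section Zeta

variable {D : LongDiagram}

theorem Crossing.partner_eq (v : D.Crossing) : D.partner v.1.2 = v.1.1 := by
  refine LongDiagram.partner_eq (fun h => ?_) v.2.2.2
  have := v.2.1
  rw [h, v.2.2.1] at this
  cases this

theorem Crossing.weight_eq (v : D.Crossing) : v.weight = D.weightAt v.1.2 := by
  rw [weightAt, if_pos v.2.2.1, v.partner_eq]
  rfl

theorem Crossing.under_injective :
    Function.Injective (fun v : D.Crossing => v.1.2) := by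
  intro v v' h
  refine Subtype.ext (Prod.ext ?_ h)
  rw [← v.partner_eq, ← v'.partner_eq]
  exact congrArg D.partner h

theorem Arc.start_injective : Function.Injective (Arc.start (D := D)) := by
  rintro (v | w) (v' | w') h
  · exact congrArg _ (Crossing.under_injective h)
  · have h1 := v.2.2.1
    have h2 := w'.2.2.2
    simp only [Arc.start] at h
    rw [h, h2] at h1
    cases h1
  · have h1 := v'.2.2.1
    have h2 := w.2.2.2
    simp only [Arc.start] at h
    rw [← h, h2] at h1
    cases h1
  · simp only [Arc.start] at h
    refine congrArg _ (Subtype.ext (Prod.ext h ?_))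
    rw [← w.partner_eq, ← w'.partner_eq, h]

theorem cyclicBetween_of_not {b x t : ℝ} (h : x ≠ b) (hx : ¬ CyclicBetween x b t) :
    CyclicBetween b x t := by
  unfold CyclicBetween at hx ⊢
  grind

/-- The way from `b` to `t` is divided at `x`; by hypothesis `y` is not on the second piece. -/
theorem cyclicBetween_iff_of_not {b x y t : ℝ} (h : CyclicBetween b x t)
    (hx : ¬ CyclicBetween x y t) : CyclicBetween b y t ↔ CyclicBetween b y x ∨ y = x := by
  unfold CyclicBetween at h hx ⊢
  grind

/-- The arc that reaches the time `t` lies on the long arc that reaches `t`, and its degree is the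
change of level from the start of that long arc. -/
theorem Arc.Reaches.onLongArc_iff [Nonempty D.Crossing] {a : D.Arc} {t : ℝ} (ha : a.Reaches t)
    (v : D.Crossing) :
    (a.OnLongArc v ↔ v = cyclicPred (fun v : D.Crossing => v.1.2) t) ∧
      (a.OnLongArc v → a.deg v = D.level t - D.level v.1.2) := by
  classical
  have hv : ∀ v : D.Crossing, D.kind v.1.2 ≠ .virt := fun v h => by
    have := v.2.2.1
    rw [h] at this
    cases this
  rcases a with v' | w
  · have hpred : cyclicPred (fun v : D.Crossing => v.1.2) t = v' :=
      IsCyclicPred.cyclicPred_eq Crossing.under_injective fun x hx => ha (.inl x) hx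
    constructor
    · rw [hpred]
      exact ⟨Eq.symm, Eq.symm⟩
    · rintro rfl
      rw [← sum_cyclicBetween (hv _), Finset.sum_eq_zero]
      · rfl
      · intro w _
        exact if_neg (ha (.inr w))
  · have hwv : w.1.1 ≠ v.1.2 := fun h => hv v (h ▸ w.2.2.2)
    -- Since the arc starting at `w` reaches `t`, the time of `v` is not met after `w`; so `w` is
    -- met on the way from `v` to `t`, and beyond `w` no other arc starts.
    have hbet : CyclicBetween v.1.2 w.1.1 t := by
      exact cyclicBetween_of_not hwv (ha (.inl v))
    have hiff : ∀ b : D.Arc, CyclicBetween v.1.2 b.start t ↔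
        CyclicBetween v.1.2 b.start w.1.1 ∨ b.start = w.1.1 := by
      exact fun b => cyclicBetween_iff_of_not hbet (ha b)
    constructor
    · constructor
      · intro h
        refine (IsCyclicPred.cyclicPred_eq Crossing.under_injective fun x hx => ?_).symm
        rcases (hiff (.inl x)).1 hx with h' | h'
        · exact h x h'
        · exact hv x ((show x.1.2 = w.1.1 from h') ▸ w.2.2.2)
      · rintro h v' hv'
        rw [h] at hv' hiff
        exact isCyclicPred_cyclicPred (τ := fun v : D.Crossing => v.1.2) t v'
          ((hiff (.inl v')).2 (Or.inl hv'))
    · intro _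
      rw [← sum_cyclicBetween (hv _)]
      refine Finset.sum_congr rfl fun w' _ => ?_
      refine if_congr ?_ rfl rfl
      rw [show CyclicBetween v.1.2 w'.1.1 t ↔ _ from hiff (.inr w'), or_comm]
      refine or_congr Iff.rfl ⟨fun h => h ▸ rfl, fun h => ?_⟩
      exact Sum.inr_injective (Arc.start_injective (D := D) (a₁ := .inr w') (a₂ := .inr w) h)

-- Exactly one arc reaches `t`, so one summand survives; its long arc and its degree are given by
-- `Arc.Reaches.onLongArc_iff`.
open Classical in
theorem sum_reaches [Nonempty D.Crossing] (t : ℝ) (c : CoeffRing) (v' : D.Crossing) :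
    (∑ a : D.Arc, if a.OnLongArc v' then
      LaurentPolynomial.C (if a.Reaches t then c else 0) * LaurentPolynomial.T (a.deg v') else 0) =
    if v' = cyclicPred (fun v : D.Crossing => v.1.2) t then
      LaurentPolynomial.C c * LaurentPolynomial.T (D.level t - D.level v'.1.2) else 0 := by
  obtain ⟨a, ha⟩ := exists_isCyclicPred (Arc.start (D := D)) t
  have ha' : a.Reaches t := ha
  rw [Finset.sum_eq_single a]
  · obtain ⟨h1, h2⟩ := ha'.onLongArc_iff v'
    rw [if_pos ha']
    by_cases h : a.OnLongArc v'
    · rw [if_pos h, if_pos (h1.1 h), h2 h]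
    · rw [if_neg h, if_neg (fun h' => h (h1.2 h'))]
  · intro b _ hb
    rw [if_neg (c := b.Reaches t) fun hb' => hb (IsCyclicPred.unique Arc.start_injective hb' ha)]
    simp
  · intro h
    exact absurd (Finset.mem_univ _) h

-- The three terms of the incidence coefficient select the emanating arc, the arc reaching the
-- overpass and the arc reaching the underpass. The degree of each is a level difference, so the
-- powers of `s` split into a row factor, a column factor and the exponent in `overCoeff`.
open Classical in
theorem alexanderMatrix_apply [Nonempty D.Crossing] (v v' : D.Crossing) :
    D.alexanderMatrix v v' = LaurentPolynomial.T (D.level v.1.2) *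
      D.cutMatrix (fun v : D.Crossing => v.1.2) v v' * LaurentPolynomial.T (-D.level v'.1.2) := by
  have h1 : D.alexanderMatrix v v' =
      (if v' = v then 1 else 0) +
      (∑ a : D.Arc, if a.OnLongArc v' then
        LaurentPolynomial.C (if a.Reaches v.1.1 then v.weight - 1 else 0) *
          LaurentPolynomial.T (a.deg v') else 0) +
      (∑ a : D.Arc, if a.OnLongArc v' then
        LaurentPolynomial.C (if a.Reaches v.1.2 then -v.weight else 0) *
          LaurentPolynomial.T (a.deg v') else 0) := by
    -- The emanating arc is the first on its long arc and has degree `0`.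
    have h0 : (if v' = v then (1 : LaurentPolynomial CoeffRing) else 0) =
        ∑ a : D.Arc, if a.OnLongArc v' then
          LaurentPolynomial.C (if a = .inl v then 1 else 0) *
            LaurentPolynomial.T (a.deg v') else 0 := by
      rw [Finset.sum_eq_single (.inl v)]
      · by_cases h : v' = v
        · subst h
          rw [if_pos rfl, if_pos rfl, if_pos (show Arc.OnLongArc (.inl v') v' from rfl)]
          simp [Arc.deg]
        · rw [if_neg h, if_neg (fun h' : Arc.OnLongArc (.inl v) v' => h (Eq.symm h'))]
      · intro b _ hb
        simp [hb]
      · intro h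
        exact absurd (Finset.mem_univ _) h
    rw [h0, ← Finset.sum_add_distrib, ← Finset.sum_add_distrib]
    refine Finset.sum_congr rfl fun a _ => ?_
    by_cases h : a.OnLongArc v'
    · simp only [if_pos h, incidence, map_add, add_mul]
    · simp only [if_neg h, add_zero]
  rw [h1, sum_reaches, sum_reaches]
  simp only [cutMatrix, relationMatrix, Pi.sub_apply, Pi.smul_apply, Pi.single_apply, smul_eq_mul,
    v.partner_eq, overCoeff, ← v.weight_eq]
  have hT : ∀ m n : ℤ, (LaurentPolynomial.T (m + n) : LaurentPolynomial CoeffRing) =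
    LaurentPolynomial.T m * LaurentPolynomial.T n := LaurentPolynomial.T_add
  have hT1 : ∀ m : ℤ, (LaurentPolynomial.T m : LaurentPolynomial CoeffRing) *
      LaurentPolynomial.T (-m) = 1 := fun m => by rw [← hT, add_neg_cancel]; rfl
  simp only [sub_eq_add_neg, hT, map_neg, map_add, map_one]
  have e1 := hT1 (D.level v.1.2)
  have e2 := hT1 (D.level v'.1.2)
  by_cases hvv : v' = v
  · subst hvv
    rw [if_pos rfl]
    split_ifs
    · linear_combination (-1 - (LaurentPolynomial.C v'.weight - 1) *
        LaurentPolynomial.T (D.level v'.1.1) * LaurentPolynomial.T (-D.level v'.1.2)) * e1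
    · linear_combination (-1 - (LaurentPolynomial.C v'.weight - 1) *
        LaurentPolynomial.T (D.level v'.1.1) * LaurentPolynomial.T (-D.level v'.1.2)) * e1
    · linear_combination -e1
    · linear_combination -e1
  · rw [if_neg hvv]
    split_ifs
    · linear_combination (-(LaurentPolynomial.C v.weight - 1) *
        LaurentPolynomial.T (D.level v.1.1) * LaurentPolynomial.T (-D.level v'.1.2)) * e1
    · linear_combination (-(LaurentPolynomial.C v.weight - 1) *
        LaurentPolynomial.T (D.level v.1.1) * LaurentPolynomial.T (-D.level v'.1.2)) * e1
    · ring
    · ring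

/-- The two diagonal matrices of powers of `s` are inverse to each other, so their determinants
cancel. -/
theorem zeta_eq_cutDet [Nonempty D.Crossing] :
    D.zeta = D.cutDet (fun v : D.Crossing => v.1.2) := by
  classical
  have h : D.alexanderMatrix =
      Matrix.diagonal (fun v : D.Crossing => LaurentPolynomial.T (D.level v.1.2)) *
        D.cutMatrix (fun v : D.Crossing => v.1.2) *
      Matrix.diagonal (fun v : D.Crossing => LaurentPolynomial.T (-D.level v.1.2)) := by
    ext1 v v'
    rw [Matrix.mul_diagonal, Matrix.diagonal_mul, alexanderMatrix_apply]
  rw [zeta, h, cutDet]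
  rw [Matrix.det_mul, Matrix.det_mul, Matrix.det_diagonal, Matrix.det_diagonal]
  rw [mul_right_comm, ← Finset.prod_mul_distrib, Finset.prod_eq_one, one_mul]
  · intro v _
    rw [← LaurentPolynomial.T_add, add_neg_cancel]
    rfl

end Zeta

end LongDiagram

namespace LongDiagram

/-! ### Independence of the choice of cuts -/

section Cuts

variable {D D' : LongDiagram}

/-- The determinant depends only on the order of the cuts, the position of the overpasses among
them, and the coefficients. Away from underpasses `overCoeff` is zero, so partners matter only at
underpasses. -/
theorem cutDet_congr {ι ι' : Type*} [Fintype ι] [Nonempty ι] [Fintype ι'] [Nonempty ι']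
    {τ : ι → ℝ} {τ' : ι' → ℝ} (hτ' : Function.Injective τ') (e : ι ≃ ι')
    (hlt : ∀ i j, τ i < τ j ↔ τ' (e i) < τ' (e j))
    (hpartner : ∀ i j, D.kind (τ j) = .under →
      (τ i < D.partner (τ j) ↔ τ' (e i) < D'.partner (τ' (e j))))
    (hW : ∀ i, D'.weightAt (τ' (e i)) = D.weightAt (τ i))
    (hK : ∀ i, D'.overCoeff (τ' (e i)) = D.overCoeff (τ i)) :
    D'.cutDet τ' = D.cutDet τ := by
  refine det_relationMatrix_equiv e _ _ _ _ _ _ _ _ (fun i => by rw [hW]) hK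
    (fun i => cyclicPred_comp hτ' e hlt fun x => hlt x i) fun i hi => ?_
  refine cyclicPred_comp hτ' e hlt fun x => hpartner x i ?_
  by_contra h
  exact hi (overCoeff_of_ne h)

theorem cutDet_comp_equiv {ι ι' : Type*} [Fintype ι] [Nonempty ι] [Fintype ι'] [Nonempty ι']
    {τ : ι → ℝ} {τ' : ι' → ℝ} (hτ' : Function.Injective τ') (e : ι ≃ ι')
    (h : ∀ i, τ' (e i) = τ i) : D.cutDet τ' = D.cutDet τ :=
  cutDet_congr hτ' e (by simp [h]) (by simp [h]) (by simp [h]) (by simp [h])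

/-- A cut at a time which is not that of an underpass may be added. -/
theorem cutDet_sum_unit {ι : Type*} [Fintype ι] [Nonempty ι] {τ : ι → ℝ}
    (hτ : Function.Injective τ) {t₀ : ℝ} (ht : ∀ i, τ i ≠ t₀) (hk : D.kind t₀ ≠ .under) :
    D.cutDet (Sum.elim τ fun _ : Unit => t₀) = D.cutDet τ := by
  classical
  set τ' : ι ⊕ Unit → ℝ := Sum.elim τ fun _ : Unit => t₀ with hτ'
  have hinj : Function.Injective τ' := by
    rintro (i | i) (j | j) h
    · exact congrArg _ (hτ h)
    · exact absurd h (ht i)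
    · exact absurd h.symm (ht j)
    · rfl
  -- In the cyclic sense `t₀` could precede itself only if there were no other cut.
  obtain ⟨p, hp⟩ : ∃ p, cyclicPred τ' t₀ = .inl p := by
    rcases h : cyclicPred τ' t₀ with p | u
    · exact ⟨p, rfl⟩
    · exfalso
      obtain ⟨i⟩ := ‹Nonempty ι›
      have := isCyclicPred_cyclicPred (τ := τ') t₀
      rw [h] at this
      refine this (.inl i) ?_
      have hi := ht i
      simp only [hτ', Sum.elim_inl, Sum.elim_inr, CyclicBetween]
      grind
  -- Removing the cut `t₀` replaces it as a predecessor by its own predecessor `p`.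
  have hpred : ∀ t, cyclicPred τ t = Sum.elim id (fun _ => p) (cyclicPred τ' t) := by
    intro t
    have h1 := isCyclicPred_cyclicPred (τ := τ') t
    rcases h : cyclicPred τ' t with j | u
    · rw [h] at h1
      exact IsCyclicPred.cyclicPred_eq hτ fun x => h1 (.inl x)
    · rw [h] at h1
      refine IsCyclicPred.cyclicPred_eq hτ fun x hx => ?_
      have h2 := isCyclicPred_cyclicPred (τ := τ') t₀
      rw [hp] at h2
      have h3 := h1 (.inl p)
      replace h1 := h1 (.inl x)
      replace h2 := h2 (.inl x)
      have hx' := ht x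
      have hp' := ht p
      simp only [hτ', Sum.elim_inl, Sum.elim_inr, CyclicBetween] at h1 h2 h3 hx
      grind
  -- The relation at `t₀` identifies its generator with that of `p`.
  let val : ι ⊕ Unit → ι → LaurentPolynomial CoeffRing :=
    fun i => Pi.single (Sum.elim id (fun _ => p) i) 1
  have hW : D.weightAt t₀ = 1 := weightAt_of_ne hk
  have hK : D.overCoeff t₀ = 0 := overCoeff_of_ne hk
  have hr : ∀ u, τ' (.inr u) = t₀ := fun _ => rfl
  have key := det_relationMatrix_sum (fun i => cyclicPred τ' (τ' i))
    (fun i => cyclicPred τ' (D.partner (τ' i))) (fun i => LaurentPolynomial.C (D.weightAt (τ' i)))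
    (fun i => D.overCoeff (τ' i)) val (fun k => rfl) (by
      intro j
      simp [val, hr, hW, hK, hp])
  have hd : (relationMatrix (fun i => cyclicPred τ' (τ' i))
      (fun i => cyclicPred τ' (D.partner (τ' i)))
      (fun i => LaurentPolynomial.C (D.weightAt (τ' i)))
      (fun i => D.overCoeff (τ' i))).toBlocks₂₂.det = 1 := by
    simp [Matrix.det_unique, relationMatrix, Matrix.toBlocks₂₂, hr, hW, hK, hp]
  have e2 : D.cutDet τ = Matrix.det (fun k => Pi.single k 1 -
      LaurentPolynomial.C (D.weightAt (τ' (.inl k))) • val (cyclicPred τ' (τ' (.inl k))) -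
        D.overCoeff (τ' (.inl k)) • val (cyclicPred τ' (D.partner (τ' (.inl k))))) := by
    unfold cutDet cutMatrix relationMatrix
    simp only [hpred]
    congr!
  rw [e2]
  refine Eq.trans ?_ (key.trans ((congrArg₂ (· * ·) ?_ rfl).trans (one_mul _)))
  · unfold cutDet cutMatrix
    congr!
  · convert hd

variable (D) in
/-- A finite nonempty set of times containing all underpasses. -/
def cuts : Set ℝ := insert 0 {t | D.kind t = .under}

instance : Fintype D.cuts := (D.finite_under.insert 0).fintype

instance : Nonempty D.cuts := ⟨⟨0, Set.mem_insert _ _⟩⟩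

variable (D) in
/-- The ζ-polynomial as the determinant of the relations of the line cut at the underpasses and at
the time `0`, which also makes sense for diagrams without classical crossings. -/
def reducedZeta : LaurentPolynomial CoeffRing := D.cutDet (Subtype.val : D.cuts → ℝ)

/-- Cuts are added one at a time; a time missing from `P` is not an underpass. Nonemptiness is
quantified so that it can vary with `Q` in the induction. -/
theorem cutDet_union {P : Finset ℝ} [Nonempty P] (hP : ∀ t, D.kind t = .under → t ∈ P)
    (Q : Finset ℝ) : ∀ _ : Nonempty ↥(P ∪ Q),
      D.cutDet (Subtype.val : ↥(P ∪ Q) → ℝ) = D.cutDet (Subtype.val : P → ℝ) := by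
  classical
  induction Q using Finset.induction_on with
  | empty =>
    intro _
    exact cutDet_comp_equiv (τ := (Subtype.val : P → ℝ)) Subtype.val_injective
      (Equiv.subtypeEquivRight (by simp)) (fun _ => rfl)
  | insert a Q _ ih =>
    intro _
    have hne : Nonempty ↥(P ∪ Q) := by
      obtain ⟨x⟩ := ‹Nonempty P›
      exact ⟨⟨x.1, Finset.mem_union_left _ x.2⟩⟩
    by_cases ha : a ∈ P ∪ Q
    · have h : P ∪ insert a Q = P ∪ Q := by
        ext x
        simp only [Finset.mem_union, Finset.mem_insert] at ha ⊢
        constructor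
        · rintro (h | rfl | h) <;> tauto
        · tauto
      rw [← ih hne]
      exact cutDet_comp_equiv (τ := (Subtype.val : ↥(P ∪ Q) → ℝ)) Subtype.val_injective
        (Equiv.subtypeEquivRight (by simp [h])) (fun _ => rfl)
    · rw [← ih hne, ← cutDet_sum_unit Subtype.val_injective (t₀ := a)
        (fun i h => ha (h ▸ i.2)) (fun h => ha (Finset.mem_union_left _ (hP a h)))]
      refine cutDet_comp_equiv Subtype.val_injective (Equiv.ofBijective
        (Sum.elim (fun x : ↥(P ∪ Q) => ⟨x.1, by
          have := x.2
          simp only [Finset.mem_union, Finset.mem_insert] at this ⊢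
          tauto⟩) fun _ => ⟨a, by simp⟩) ⟨?_, ?_⟩) ?_
      · rintro (⟨i, hi⟩ | i) (⟨j, hj⟩ | j) h
        · simpa using h
        · simp only [Sum.elim_inl, Sum.elim_inr, Subtype.mk.injEq] at h
          exact absurd (h ▸ hi) ha
        · simp only [Sum.elim_inl, Sum.elim_inr, Subtype.mk.injEq] at h
          exact absurd (h ▸ hj) ha
        · rfl
      · rintro ⟨x, hx⟩
        by_cases hxa : x = a
        · exact ⟨.inr (), by simp [hxa]⟩
        · refine ⟨.inl ⟨x, ?_⟩, rfl⟩
          simp only [Finset.mem_union, Finset.mem_insert] at hx ⊢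
          tauto
      · rintro (i | i) <;> rfl

/-- Two sets of cuts containing all underpasses are each compared with their union. -/
theorem cutDet_eq_reducedZeta {ι : Type*} [Fintype ι] [Nonempty ι] {τ : ι → ℝ}
    (hτ : Function.Injective τ) (h : ∀ t, D.kind t = .under → ∃ i, τ i = t) :
    D.cutDet τ = D.reducedZeta := by
  classical
  set P : Finset ℝ := Finset.univ.image τ with hP
  set Q : Finset ℝ := (D.finite_under.insert 0).toFinset with hQ
  have : Nonempty P := by
    obtain ⟨i⟩ := ‹Nonempty ι›
    exact ⟨⟨τ i, by simp [hP]⟩⟩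
  have : Nonempty Q := ⟨⟨0, by simp [hQ]⟩⟩
  have : Nonempty ↥(P ∪ Q) := ⟨⟨0, by simp [hQ]⟩⟩
  have : Nonempty ↥(Q ∪ P) := ⟨⟨0, by simp [hQ]⟩⟩
  have e1 : D.cutDet (Subtype.val : P → ℝ) = D.cutDet τ := by
    refine cutDet_comp_equiv Subtype.val_injective
      (Equiv.ofBijective (fun i => ⟨τ i, by simp [hP]⟩) ⟨?_, ?_⟩) (fun _ => rfl)
    · intro i j hij
      exact hτ (by simpa using hij)
    · rintro ⟨x, hx⟩
      obtain ⟨i, -, rfl⟩ := Finset.mem_image.1 hx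
      exact ⟨i, rfl⟩
  have e2 : D.cutDet (Subtype.val : Q → ℝ) = D.reducedZeta :=
    cutDet_comp_equiv Subtype.val_injective
      (Equiv.subtypeEquivRight (by simp [hQ, cuts])) (fun _ => rfl)
  have e3 : D.cutDet (Subtype.val : ↥(P ∪ Q) → ℝ) = D.cutDet (Subtype.val : ↥(Q ∪ P) → ℝ) :=
    cutDet_comp_equiv Subtype.val_injective
      (Equiv.subtypeEquivRight (by simp [or_comm])) (fun _ => rfl)
  have hP' : ∀ t, D.kind t = .under → t ∈ P := fun t ht => by simpa [hP] using h t ht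
  have hQ' : ∀ t, D.kind t = .under → t ∈ Q := fun t ht => by simp [hQ, ht]
  rw [← e1, ← e2, ← cutDet_union hP' Q ‹_›, e3, cutDet_union hQ' P ‹_›]

theorem zeta_eq_reducedZeta (h : 1 ≤ Fintype.card D.Crossing) : D.zeta = D.reducedZeta := by
  have : Nonempty D.Crossing := Fintype.card_pos_iff.1 h
  rw [zeta_eq_cutDet]
  refine cutDet_eq_reducedZeta Crossing.under_injective fun t ht => ?_
  exact ⟨⟨(D.partner t, t), kind_partner_of_under ht, ht,
    (partner_spec (by simp [ht])).2⟩, rfl⟩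

end Cuts

/-! ### Invariance under isotopy -/

section Isotopy

variable {D D' : LongDiagram}

/-- The oriented area is multiplied by `a * b * L.det`, which is positive. -/
theorem areaSign_map (L : ℝ × ℝ →L[ℝ] ℝ × ℝ) (hL : 0 < L.det) {a b : ℝ} (ha : 0 < a) (hb : 0 < b)
    (u v : ℝ × ℝ) : areaSign (a • L u) (b • L v) = areaSign u v := by
  have hdet : L.det = (L (1, 0)).1 * (L (0, 1)).2 - (L (0, 1)).1 * (L (1, 0)).2 := by
    rw [ContinuousLinearMap.det, ← LinearMap.det_toMatrix (Module.Basis.finTwoProd ℝ),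
      Matrix.det_fin_two]
    simp [LinearMap.toMatrix_apply]
  have hlin : ∀ w : ℝ × ℝ, L w = w.1 • L (1, 0) + w.2 • L (0, 1) := by
    intro w
    rw [← map_smul, ← map_smul, ← map_add]
    simp
  have harea : orientedArea (a • L u) (b • L v) = a * b * L.det * orientedArea u v := by
    rw [hdet, hlin u, hlin v]
    simp [orientedArea]
    ring
  unfold areaSign
  rw [harea]
  have : 0 < a * b * L.det := by positivity
  simp [this]

/-- Order of times, partners and signs of crossings are transported by `σ`; hence so are weights,
steps and levels. -/
theorem reducedZeta_isotopic (h : Isotopic D D') : D'.reducedZeta = D.reducedZeta := by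
  obtain ⟨Φ, σ, hΦ, -, hdet, hσ, hσ', hmono, hD⟩ := h
  have hkind : ∀ t, D'.kind t = D.kind (σ t) := fun t => (hD t).2
  have hcurve : ∀ t, D'.curve t = Φ (D.curve (σ t)) := fun t => (hD t).1
  have hpartner : ∀ t, D'.kind t ≠ .regular → σ (D'.partner t) = D.partner (σ t) := by
    intro t ht
    obtain ⟨h1, h2⟩ := partner_spec ht
    rw [hcurve, hcurve] at h2
    exact (partner_eq (fun h => h1 (σ.injective h)) (Φ.injective h2)).symm
  -- Monotonicity gives a nonnegative derivative; it cannot vanish because the inverse is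
  -- differentiable.
  have hσd : ∀ t, 0 < deriv σ t := by
    intro t
    have h1 : HasDerivAt σ (deriv σ t) t := (hσ.differentiable (by simp) t).hasDerivAt
    have h2 : HasDerivAt σ.symm (deriv σ.symm (σ t)) (σ t) :=
      (hσ'.differentiable (by simp) _).hasDerivAt
    have h3 : HasDerivAt (fun x => σ.symm (σ x)) (deriv σ.symm (σ t) * deriv σ t) t :=
      h2.comp t h1
    simp only [Equiv.symm_apply_apply] at h3
    have h4 := h3.unique (hasDerivAt_id t)
    have h5 : 0 ≤ deriv σ t := hmono.monotone.deriv_nonneg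
    refine lt_of_le_of_ne h5 fun h6 => ?_
    rw [← h6] at h4
    simp at h4
  have hderiv : ∀ t, deriv D'.curve t =
      deriv σ t • fderiv ℝ Φ (D.curve (σ t)) (deriv D.curve (σ t)) := by
    intro t
    have h1 : HasDerivAt σ (deriv σ t) t := (hσ.differentiable (by simp) t).hasDerivAt
    have h2 : HasDerivAt D.curve (deriv D.curve (σ t)) (σ t) :=
      (D.smooth.differentiable (by simp) _).hasDerivAt
    have h3 : HasFDerivAt Φ (fderiv ℝ Φ (D.curve (σ t))) (D.curve (σ t)) :=
      (hΦ.differentiable (by simp) _).hasFDerivAt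
    have h4 := (h3.comp_hasDerivAt (σ t) h2).scomp t h1
    have h5 : D'.curve = (Φ ∘ D.curve) ∘ σ := funext hcurve
    rw [h5]
    exact h4.deriv
  have hsign : ∀ s t, D'.curve s = D'.curve t →
      areaSign (deriv D'.curve s) (deriv D'.curve t) =
        areaSign (deriv D.curve (σ s)) (deriv D.curve (σ t)) := by
    intro s t hst
    rw [hcurve, hcurve] at hst
    rw [hderiv, hderiv, Φ.injective hst]
    exact areaSign_map _ (hdet _) (hσd s) (hσd t) _ _
  have hweight : ∀ t, D'.weightAt t = D.weightAt (σ t) := by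
    intro t
    unfold weightAt
    rw [hkind]
    split_ifs with h1 h2 h3 h3
    · rw [hsign _ _ (partner_spec (by simp [hkind, h1])).2, hpartner t (by simp [hkind, h1])]
    · rw [← hpartner t (by simp [hkind, h1])] at h3
      exact absurd (hmono h2) h3
    · rw [← hpartner t (by simp [hkind, h1])] at h3
      exact absurd (hmono.lt_iff_lt.1 h3) h2
    · rw [hsign _ _ (partner_spec (by simp [hkind, h1])).2, hpartner t (by simp [hkind, h1])]
    · rfl
  have hstep : ∀ t, D'.stepAt t = D.stepAt (σ t) := by
    intro t
    unfold stepAt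
    rw [hkind]
    split_ifs with h1
    · rw [hsign _ _ (partner_spec (by simp [hkind, h1])).2.symm, hpartner t (by simp [hkind, h1])]
    · rfl
  have hlevel : ∀ t, D'.level t = D.level (σ t) := by
    intro t
    unfold level
    rw [← finsum_comp_equiv σ (f := fun x => if x < σ t then D.stepAt x else 0)]
    simp only [hmono.lt_iff_lt, hstep]
  -- The image under `σ` of the cuts of `D'` contains all underpasses of `D`; the extra cut `σ 0`
  -- need not be `0`, which does no harm.
  refine (cutDet_congr (D := D) (τ := fun t : D'.cuts => σ t.1) Subtype.val_injective
    (Equiv.refl _) (fun i j => hmono.lt_iff_lt) (fun i j hj => ?_) (fun i => hweight _)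
    (fun i => ?_)).trans (cutDet_eq_reducedZeta (fun i j hij => Subtype.ext (σ.injective hij))
      fun t ht => ?_)
  · rw [← hkind] at hj
    rw [← hpartner _ (by simp [hj])]
    exact hmono.lt_iff_lt
  · by_cases hu : D'.kind i.1 = .under
    · simp only [overCoeff, Equiv.refl_apply, hweight, hlevel]
      rw [hpartner _ (by simp [hu])]
    · rw [Equiv.refl_apply, overCoeff_of_ne hu, overCoeff_of_ne (by rwa [← hkind])]
  · exact ⟨⟨σ.symm t, Set.mem_insert_of_mem _ (by simp [hkind, ht])⟩, by simp⟩

end Isotopy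

end LongDiagram

namespace LongDiagram

/-! ### Local changes of a diagram -/

section Local

variable {D D' : LongDiagram} {m : ℕ} {c : Fin m → ℝ}

/-- The parts of `D` in the square are the strands with central times `c i`. -/
structure StrandsInSquare (D : LongDiagram) (c : Fin m → ℝ) : Prop where
  disjoint : ∀ i j, i ≠ j → 2 < |c i - c j|
  inside : ∀ i, ∀ t ∈ strand (c i), D.curve t ∈ square
  outside : ∀ t, (∀ i, t ∉ strand (c i)) → D.curve t ∉ square
  left_regular : ∀ i, D.kind (c i - 1) = .regular
  right_regular : ∀ i, D.kind (c i + 1) = .regular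

theorem mem_strand {c t : ℝ} : t ∈ strand c ↔ c - 1 ≤ t ∧ t ≤ c + 1 := Iff.rfl

theorem StrandsInSquare.eq_of_mem (hD : StrandsInSquare D c) {i j : Fin m} {t : ℝ}
    (hi : t ∈ strand (c i)) (hj : t ∈ strand (c j)) : i = j := by
  by_contra h
  have h1 := hD.disjoint i j h
  rw [mem_strand] at hi hj
  rcases lt_abs.1 h1 with h2 | h2 <;> linarith [hi.1, hi.2, hj.1, hj.2]

/-- The partner passes through the same point, which is outside the square. -/
theorem StrandsInSquare.partner_notMem (hD : StrandsInSquare D c) {t : ℝ}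
    (ht : ∀ i, t ∉ strand (c i)) (hk : D.kind t ≠ .regular) (i : Fin m) :
    D.partner t ∉ strand (c i) := by
  intro h
  refine hD.outside _ ht ?_
  rw [← (partner_spec hk).2]
  exact hD.inside i _ h

/-- The times at which the line is cut outside the interiors of the strands. -/
def IsOuterCut (D : LongDiagram) (c : Fin m → ℝ) (t : ℝ) : Prop :=
  (D.kind t = .under ∧ ∀ i, t ∉ strand (c i)) ∨ (∃ i, t = c i - 1) ∨ ∃ i, t = c i + 1

theorem finite_isOuterCut : {t | IsOuterCut D c t}.Finite := by
  refine ((D.finite_under).union ((Set.finite_range fun i => c i - 1).union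
    (Set.finite_range fun i => c i + 1))).subset fun t ht => ?_
  rcases ht with ⟨h, -⟩ | ⟨i, rfl⟩ | ⟨i, rfl⟩ <;> simp_all

theorem StrandsInSquare.isOuterCut_le_or_le (hD : StrandsInSquare D c) {t : ℝ}
    (ht : IsOuterCut D c t) (i : Fin m) : t ≤ c i - 1 ∨ c i + 1 ≤ t := by
  by_contra! h
  have hi : t ∈ strand (c i) := mem_strand.2 ⟨h.1.le, h.2.le⟩
  rcases ht with ⟨-, h'⟩ | ⟨j, rfl⟩ | ⟨j, rfl⟩
  · exact h' i hi
  · have := hD.eq_of_mem hi (mem_strand.2 ⟨le_rfl, by linarith⟩)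
    subst this
    linarith [h.1]
  · have := hD.eq_of_mem hi (mem_strand.2 ⟨by linarith, le_rfl⟩)
    subst this
    linarith [h.2]

variable {O : Set ℝ}

/-- The cut at the beginning of a strand. -/
def entry (hO : ∀ t, t ∈ O ↔ IsOuterCut D c t) (i : Fin m) : O :=
  ⟨c i - 1, (hO _).2 (Or.inr (Or.inl ⟨i, rfl⟩))⟩

variable {J : Type*} {u : J → ℝ}

theorem sumElim_injective (hD : StrandsInSquare D c) (hO : ∀ t, t ∈ O ↔ IsOuterCut D c t)
    (hu : Function.Injective u) (hin : ∀ j, ∃ i, c i - 1 < u j ∧ u j < c i + 1) :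
    Function.Injective (Sum.elim (Subtype.val : O → ℝ) u) := by
  have key : ∀ (k : O) (j : J), k.1 ≠ u j := by
    intro k j h
    obtain ⟨i, h1, h2⟩ := hin j
    rcases hD.isOuterCut_le_or_le ((hO _).1 k.2) i with h' | h' <;> linarith
  rintro (k | j) (k' | j') h
  · exact congrArg _ (Subtype.ext h)
  · exact absurd h (key k j')
  · exact absurd h.symm (key k' j)
  · exact congrArg _ (hu h)

variable [Fintype O] [Nonempty O] [Fintype J]

/-- The entry and exit cuts shield the inner cuts from times outside. The exit `t = c i + 1` itself
is excluded: its predecessor lies in the strand. -/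
theorem cyclicPred_outer (hD : StrandsInSquare D c) (hO : ∀ t, t ∈ O ↔ IsOuterCut D c t)
    (hu : Function.Injective u) (hin : ∀ j, ∃ i, c i - 1 < u j ∧ u j < c i + 1) {t : ℝ}
    (ht : ∀ i, t ≤ c i - 1 ∨ c i + 1 < t) :
    cyclicPred (Sum.elim (Subtype.val : O → ℝ) u) t = .inl (cyclicPred Subtype.val t) := by
  refine IsCyclicPred.cyclicPred_eq (sumElim_injective hD hO hu hin) fun x hx => ?_
  have hp := isCyclicPred_cyclicPred (τ := (Subtype.val : O → ℝ)) t
  rcases x with k | j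
  · exact hp k hx
  · obtain ⟨i, h1, h2⟩ := hin j
    have h3 := hp ⟨c i - 1, (hO _).2 (Or.inr (Or.inl ⟨i, rfl⟩))⟩
    have h4 := hp ⟨c i + 1, (hO _).2 (Or.inr (Or.inr ⟨i, rfl⟩))⟩
    have h5 := hD.isOuterCut_le_or_le ((hO _).1 (cyclicPred (Subtype.val : O → ℝ) t).2) i
    have h6 := ht i
    generalize hk : (cyclicPred (Subtype.val : O → ℝ) t).1 = k at h3 h4 h5
    simp only [Sum.elim_inl, Sum.elim_inr, hk] at hx
    unfold CyclicBetween at hx h3 h4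
    grind

theorem cyclicPred_entry (hD : StrandsInSquare D c) (hO : ∀ t, t ∈ O ↔ IsOuterCut D c t)
    (hu : Function.Injective u) (hin : ∀ j, ∃ i, c i - 1 < u j ∧ u j < c i + 1) {t : ℝ}
    {i : Fin m} (h1 : c i - 1 < t) (h2 : t ≤ c i + 1) (h : ∀ j, c i - 1 < u j → t ≤ u j) :
    cyclicPred (Sum.elim (Subtype.val : O → ℝ) u) t = .inl (entry hO i) := by
  refine cyclicPred_eq_of_lt (sumElim_injective hD hO hu hin) h1 ?_
  rintro (k | j) hx
  · rcases hD.isOuterCut_le_or_le ((hO _).1 k.2) i with h' | h'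
    · exact absurd hx (not_lt.2 h')
    · exact h2.trans h'
  · exact h j hx

theorem cyclicPred_inner (hD : StrandsInSquare D c) (hO : ∀ t, t ∈ O ↔ IsOuterCut D c t)
    (hu : Function.Injective u) (hin : ∀ j, ∃ i, c i - 1 < u j ∧ u j < c i + 1) {t : ℝ}
    {i : Fin m} {j : J} (h1 : c i - 1 < u j) (h2 : u j < t) (h3 : t ≤ c i + 1)
    (h : ∀ j', u j < u j' → t ≤ u j') :
    cyclicPred (Sum.elim (Subtype.val : O → ℝ) u) t = .inr j := by
  refine cyclicPred_eq_of_lt (sumElim_injective hD hO hu hin) h2 ?_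
  rintro (k | j) hx
  · rcases hD.isOuterCut_le_or_le ((hO _).1 k.2) i with h' | h'
    · exact absurd (h1.trans hx) (not_lt.2 h')
    · exact h3.trans h'
  · exact h j hx

open Classical in
/-- The relations at the outer cuts, where the generator at the end of the strand `i` is expressed
through the generators at the outer cuts by `E i`. -/
def outerMatrix (D : LongDiagram) (c : Fin m → ℝ) (E : Fin m → O → LaurentPolynomial CoeffRing) :
    Matrix O O (LaurentPolynomial CoeffRing) := fun k =>
  if h : ∃ i, k.1 = c i + 1 then Pi.single k 1 - E h.choose
  else Pi.single k 1 - LaurentPolynomial.C (D.weightAt k) • Pi.single (cyclicPred Subtype.val k.1) 1 -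
    D.overCoeff k • Pi.single (cyclicPred Subtype.val (D.partner k)) 1

open Classical in
/-- Elimination of the generators at the cuts `u j` inside the square. Here `f j`, `g j` and `l i`
are the cuts preceding the underpass `u j`, its overpass, and the end of the strand `i`. -/
theorem reducedZeta_eq_det_outerMatrix [DecidableEq J] (hD : StrandsInSquare D c)
    (hO : ∀ t, t ∈ O ↔ IsOuterCut D c t)
    (hu : Function.Injective u) (hin : ∀ j, ∃ i, c i - 1 < u j ∧ u j < c i + 1)
    (hcover : ∀ i, ∀ t ∈ strand (c i), D.kind t = .under → ∃ j, u j = t)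
    (f g : J → O ⊕ J) (l : Fin m → O ⊕ J)
    (hf : ∀ j, cyclicPred (Sum.elim (Subtype.val : O → ℝ) u) (u j) = f j)
    (hg : ∀ j, cyclicPred (Sum.elim (Subtype.val : O → ℝ) u) (D.partner (u j)) = g j)
    (hl : ∀ i, cyclicPred (Sum.elim (Subtype.val : O → ℝ) u) (c i + 1) = l i)
    (V : J → O → LaurentPolynomial CoeffRing)
    (hV : ∀ j, V j = LaurentPolynomial.C (D.weightAt (u j)) •
        Sum.elim (fun k => Pi.single k 1) V (f j) +
      D.overCoeff (u j) • Sum.elim (fun k => Pi.single k 1) V (g j)) :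
    D.reducedZeta = Matrix.det (Matrix.of fun j j' : J => (if j' = j then 1 else 0) -
        LaurentPolynomial.C (D.weightAt (u j)) * (if f j = .inr j' then 1 else 0) -
        D.overCoeff (u j) * (if g j = .inr j' then 1 else 0)) *
      (outerMatrix D c (O := O) fun i => Sum.elim (fun k => Pi.single k 1) V (l i)).det := by
  set τ : O ⊕ J → ℝ := Sum.elim Subtype.val u with hτ
  have hinj : Function.Injective τ := sumElim_injective hD hO hu hin
  -- Underpasses outside the strands are outer cuts, those inside are among the `u j`.
  have hz : D.cutDet τ = D.reducedZeta := by
    refine cutDet_eq_reducedZeta hinj fun t ht => ?_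
    by_cases h : ∃ i, t ∈ strand (c i)
    · obtain ⟨i, hi⟩ := h
      obtain ⟨j, rfl⟩ := hcover i t hi ht
      exact ⟨.inr j, rfl⟩
    · push Not at h
      exact ⟨.inl ⟨t, (hO t).2 (Or.inl ⟨ht, h⟩)⟩, rfl⟩
  have key := det_relationMatrix_sum (fun i => cyclicPred τ (τ i))
    (fun i => cyclicPred τ (D.partner (τ i))) (fun i => LaurentPolynomial.C (D.weightAt (τ i)))
    (fun i => D.overCoeff (τ i)) (Sum.elim (fun k => Pi.single k 1) V) (fun k => rfl) (by
      intro j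
      have h1 : cyclicPred τ (τ (.inr j)) = f j := hf j
      have h2 : cyclicPred τ (D.partner (τ (.inr j))) = g j := hg j
      rw [h1, h2]
      exact hV j)
  rw [← hz]
  refine Eq.trans ?_ (key.trans (congrArg₂ (· * ·) ?_ ?_))
  · unfold cutDet cutMatrix
    congr!
  · congr 1
    ext j j'
    have h1 : cyclicPred τ (τ (.inr j)) = f j := hf j
    have h2 : cyclicPred τ (D.partner (τ (.inr j))) = g j := hg j
    simp [relationMatrix, Matrix.toBlocks₂₂, h1, h2, Pi.single_apply, eq_comm]
    simp [hτ]
  · congr 1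
    funext k
    have h0 : τ (.inl k) = k.1 := rfl
    simp only [outerMatrix, h0]
    split_ifs with h
    -- An exit is a regular time, so its relation only equates its generator with that of the
    -- preceding cut `l i`.
    · have hs := h.choose_spec
      generalize h.choose = i at hs
      have hr : D.kind k.1 ≠ .under := by
        rw [hs, hD.right_regular]
        simp
      rw [weightAt_of_ne hr, overCoeff_of_ne hr, hs, hl]
      simp
    -- At the other outer cuts no predecessor lies inside; the overpass belonging to an outer
    -- underpass is outside the square as well.
    · have ht : ∀ i, k.1 ≤ c i - 1 ∨ c i + 1 < k.1 := by
        intro i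
        rcases hD.isOuterCut_le_or_le ((hO _).1 k.2) i with h' | h'
        · exact Or.inl h'
        · exact Or.inr (lt_of_le_of_ne h' fun h'' => h ⟨i, h''.symm⟩)
      rw [cyclicPred_outer hD hO hu hin ht]
      by_cases hk : D.kind k.1 = .under
      · have hk' : ∀ i, k.1 ∉ strand (c i) := by
          rcases (hO _).1 k.2 with h' | ⟨i, h'⟩ | h'
          · exact h'.2
          · rw [h', hD.left_regular] at hk
            cases hk
          · exact absurd h' h
        have hp := hD.partner_notMem hk' (by simp [hk])
        rw [cyclicPred_outer hD hO hu hin (t := D.partner k.1)]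
        · rfl
        · intro i
          have := hp i
          rw [mem_strand] at this
          by_contra! h'
          exact this ⟨h'.1.le, h'.2⟩
      · rw [overCoeff_of_ne hk]
        simp

/-- A diagram in which no strand passes under a classical crossing in the square. -/
theorem reducedZeta_eq_of_no_under (hD : StrandsInSquare D c)
    (hO : ∀ t, t ∈ O ↔ IsOuterCut D c t)
    (hno : ∀ i, ∀ t ∈ strand (c i), D.kind t ≠ .under) :
    D.reducedZeta = (outerMatrix D c (O := O) fun i => Pi.single (entry hO i) 1).det := by
  classical
  have h := reducedZeta_eq_det_outerMatrix (O := O) (J := Empty) (u := Empty.elim) hD hO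
    (fun i => i.elim) (fun i => i.elim) (fun i t ht hk => absurd hk (hno i t ht))
    (fun i => i.elim) (fun i => i.elim) (fun i => .inl (entry hO i))
    (fun i => i.elim) (fun i => i.elim)
    (fun i => cyclicPred_entry hD hO (fun i => i.elim) (fun i => i.elim) (by linarith) le_rfl
      fun i => i.elim)
    (fun i => i.elim) (fun i => i.elim)
  rw [h]
  exact Eq.trans (congrArg₂ (· * ·) Matrix.det_isEmpty rfl) (one_mul _)

/-! ### Comparison of two diagrams which agree outside the square -/

/-- The diagrams agree outside the square, and the strands have the same total changes of degree. -/
structure LocalChange (D D' : LongDiagram) (c : Fin m → ℝ) : Prop where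
  left : StrandsInSquare D c
  right : StrandsInSquare D' c
  same : ∀ t, (∀ i, t ∉ strand (c i)) → D'.curve t = D.curve t ∧ D'.kind t = D.kind t
  sum_step : ∀ i, (∑ᶠ x, (strand (c i)).indicator D'.stepAt x) =
    ∑ᶠ x, (strand (c i)).indicator D.stepAt x

namespace LocalChange

theorem isOuterCut_iff (h : LocalChange D D' c) (t : ℝ) :
    IsOuterCut D' c t ↔ IsOuterCut D c t := by
  unfold IsOuterCut
  by_cases ht : ∀ i, t ∉ strand (c i)
  · rw [(h.same t ht).2]
  · simp [ht]

/-- The strands are finitely many closed intervals, so the curves agree in a neighbourhood of `t`.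
-/
theorem deriv_eq (h : LocalChange D D' c) {t : ℝ} (ht : ∀ i, t ∉ strand (c i)) :
    deriv D'.curve t = deriv D.curve t := by
  refine Filter.EventuallyEq.deriv_eq ?_
  have ho : IsOpen (⋃ i, strand (c i))ᶜ := by
    refine (isClosed_iUnion_of_finite fun i => ?_).isOpen_compl
    exact isClosed_Icc
  filter_upwards [ho.mem_nhds (by simpa using ht)] with s hs
  exact (h.same s (by simpa using hs)).1

theorem partner_eq (h : LocalChange D D' c) {t : ℝ} (ht : ∀ i, t ∉ strand (c i))
    (hk : D.kind t ≠ .regular) : D'.partner t = D.partner t := by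
  obtain ⟨h1, h2⟩ := partner_spec hk
  have hp := h.left.partner_notMem ht hk
  refine LongDiagram.partner_eq h1 ?_
  rw [(h.same _ ht).1, (h.same _ hp).1, h2]

theorem weightAt_eq (h : LocalChange D D' c) {t : ℝ} (ht : ∀ i, t ∉ strand (c i)) :
    D'.weightAt t = D.weightAt t := by
  unfold weightAt
  rw [(h.same t ht).2]
  by_cases hk : D.kind t = .under
  · have hk' : D.kind t ≠ .regular := by simp [hk]
    rw [h.partner_eq ht hk', h.deriv_eq ht, h.deriv_eq (h.left.partner_notMem ht hk')]
  · simp [hk]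

theorem stepAt_eq (h : LocalChange D D' c) {t : ℝ} (ht : ∀ i, t ∉ strand (c i)) :
    D'.stepAt t = D.stepAt t := by
  unfold stepAt
  rw [(h.same t ht).2]
  by_cases hk : D.kind t = .virt
  · have hk' : D.kind t ≠ .regular := by simp [hk]
    rw [h.partner_eq ht hk', h.deriv_eq ht, h.deriv_eq (h.left.partner_notMem ht hk')]
  · simp [hk]

end LocalChange

theorem finite_support_of_stepAt {f : ℝ → ℤ} (hf : ∀ x, D.stepAt x = 0 → f x = 0) :
    (Function.support f).Finite :=
  D.finite_support_stepAt.subset fun x hx h => hx (hf x h)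

-- A strand lies entirely before `t` or entirely not before it, so it enters the level only through
-- its total change.
open Classical in
theorem StrandsInSquare.level_eq (hD : StrandsInSquare D c) {t : ℝ}
    (ht : ∀ i, t ≤ c i - 1 ∨ c i + 1 < t) :
    D.level t = (∑ᶠ x, if x < t ∧ ∀ i, x ∉ strand (c i) then D.stepAt x else 0) +
      ∑ i, if c i < t then ∑ᶠ x, (strand (c i)).indicator D.stepAt x else 0 := by
  have h1 : ∀ i, (if c i < t then ∑ᶠ x, (strand (c i)).indicator D.stepAt x else 0) =
      ∑ᶠ x, if c i < t then (strand (c i)).indicator D.stepAt x else 0 := by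
    intro i
    split_ifs <;> simp
  simp only [h1]
  rw [← finsum_sum_comm, ← finsum_add_distrib]
  · unfold level
    congr 1
    funext x
    by_cases hx : ∃ i, x ∈ strand (c i)
    · obtain ⟨i, hi⟩ := hx
      rw [if_neg (c := x < t ∧ ∀ i, x ∉ strand (c i)) (fun h => h.2 i hi), zero_add, Finset.sum_eq_single i]
      · rw [Set.indicator_of_mem hi]
        refine if_congr ?_ rfl rfl
        rw [mem_strand] at hi
        rcases ht i with h | h
        · constructor <;> intro <;> linarith
        · constructor <;> intro <;> linarith
      · intro j _ hj
        rw [Set.indicator_of_notMem (fun hx => hj (hD.eq_of_mem hx hi)), ite_self]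
      · simp
    · push Not at hx
      rw [Finset.sum_eq_zero, add_zero]
      · simp [hx]
      · intro j _
        rw [Set.indicator_of_notMem (hx j), ite_self]
  · exact finite_support_of_stepAt (D := D) fun x hx => by simp [hx]
  · refine finite_support_of_stepAt (D := D) fun x hx => Finset.sum_eq_zero fun i _ => ?_
    simp [Set.indicator_apply, hx]
  · exact fun i _ => finite_support_of_stepAt (D := D) fun x hx => by simp [Set.indicator_apply, hx]

namespace LocalChange

theorem level_eq (h : LocalChange D D' c) {t : ℝ} (ht : ∀ i, t ≤ c i - 1 ∨ c i + 1 < t) :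
    D'.level t = D.level t := by
  classical
  rw [h.left.level_eq ht, h.right.level_eq ht]
  congr 1
  · congr 1
    funext x
    split_ifs with hx
    · exact h.stepAt_eq hx.2
    · rfl
  · simp only [h.sum_step]

theorem level_left_eq (h : LocalChange D D' c) (i : Fin m) :
    D'.level (c i - 1) = D.level (c i - 1) := by
  refine h.level_eq fun j => ?_
  by_cases hij : i = j
  · subst hij
    exact Or.inl le_rfl
  · rcases lt_abs.1 (h.left.disjoint i j hij) with h' | h'
    · right; linarith
    · left; linarith

theorem level_eq_of_notMem (h : LocalChange D D' c) {t : ℝ} (ht : ∀ i, t ∉ strand (c i)) :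
    D'.level t = D.level t := by
  refine h.level_eq fun j => ?_
  by_contra! h'
  exact ht j (mem_strand.2 ⟨h'.1.le, h'.2⟩)

/-- Apart from `E`, the rows involve only weights, partners and levels at times outside the strands,
and entries are regular in both diagrams. -/
theorem outerMatrix_eq (h : LocalChange D D' c) (hO : ∀ t, t ∈ O ↔ IsOuterCut D c t)
    (E : Fin m → O → LaurentPolynomial CoeffRing) :
    outerMatrix D' c E = outerMatrix D c E := by
  funext k
  unfold outerMatrix
  split_ifs with hk
  · rfl
  · rcases (hO _).1 k.2 with ⟨h1, h2⟩ | ⟨i, h1⟩ | h1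
    · have hr : D.kind k ≠ .regular := by simp [h1]
      have hp := h.left.partner_notMem h2 hr
      simp only [overCoeff, h.weightAt_eq h2, h.partner_eq h2 hr, h.level_eq_of_notMem h2,
        h.level_eq_of_notMem hp]
    · have e1 : D.kind k ≠ .under := by rw [h1, h.left.left_regular]; simp
      have e2 : D'.kind k ≠ .under := by rw [h1, h.right.left_regular]; simp
      rw [weightAt_of_ne e1, weightAt_of_ne e2, overCoeff_of_ne e1, overCoeff_of_ne e2]
      simp
    · exact absurd h1 hk

end LocalChange

/-- The level inside a strand. -/
theorem level_eq_add (D : LongDiagram) {s t : ℝ} (h : s ≤ t) :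
    D.level t = D.level s + ∑ᶠ x, (Set.Ico s t).indicator D.stepAt x := by
  unfold level
  rw [← finsum_add_distrib]
  · congr 1
    funext x
    by_cases h1 : x < s
    · simp [h1, h1.trans_le h]
    · by_cases h2 : x < t <;> simp [h1, h2, not_lt.1 h1]
  · exact finite_support_of_stepAt (D := D) fun x hx => by simp [hx]
  · exact finite_support_of_stepAt (D := D) fun x hx => by simp [Set.indicator_apply, hx]

theorem level_eq_of_no_virt {s t : ℝ} (h : s ≤ t) (hno : ∀ x, s ≤ x → x < t → D.kind x ≠ .virt) :
    D.level t = D.level s := by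
  rw [D.level_eq_add h, finsum_eq_zero_of_forall_eq_zero, add_zero]
  intro x
  by_cases hx : x ∈ Set.Ico s t
  · rw [Set.indicator_of_mem hx, stepAt_of_ne (hno x hx.1 hx.2)]
  · exact Set.indicator_of_notMem hx _

end Local

end LongDiagram

namespace LongDiagram

/-! ### Powers of `p` and `q`; strands given as graphs -/

section Preparation

variable {D D' : LongDiagram} {m : ℕ} {c : Fin m → ℝ}

theorem qPow_zero : qPow 0 = 1 := by
  unfold qPow
  rw [LaurentPolynomial.T_zero, map_one]

theorem qPow_add (a b : ℤ) : qPow (a + b) = qPow a * qPow b := by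
  unfold qPow
  rw [LaurentPolynomial.T_add, map_mul]

theorem pPow_zero : pPow 0 = 1 := by
  unfold pPow
  rw [LaurentPolynomial.T_zero, map_one, map_one]

theorem pPow_add (a b : ℤ) : pPow (a + b) = pPow a * pPow b := by
  unfold pPow
  rw [LaurentPolynomial.T_add, map_mul, map_mul]

/-- A time in a strand is regular if the strands do not pass again through the same point. -/
theorem kind_eq_regular {t : ℝ} (ht : D.curve t ∈ square)
    (hout : ∀ s, (∀ i, s ∉ strand (c i)) → D.curve s ∉ square)
    (h : ∀ i, ∀ s ∈ strand (c i), D.curve s = D.curve t → s = t) : D.kind t = .regular := by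
  rw [D.kind_regular]
  intro s hs he
  by_cases hmem : ∃ i, s ∈ strand (c i)
  · obtain ⟨i, hi⟩ := hmem
    exact hs (h i s hi he)
  · push Not at hmem
    exact hout s hmem (he ▸ ht)

theorem finsum_indicator_pair {f : ℝ → ℤ} {S : Set ℝ} {a b : ℝ} (hab : a ≠ b) (ha : a ∈ S)
    (hb : b ∈ S) (h : ∀ x ∈ S, x ≠ a → x ≠ b → f x = 0) :
    ∑ᶠ x, S.indicator f x = f a + f b := by
  rw [finsum_eq_sum_of_support_subset (s := {a, b}), Finset.sum_pair hab,
    Set.indicator_of_mem ha, Set.indicator_of_mem hb]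
  intro x hx
  by_contra hne
  simp only [Finset.coe_insert, Finset.coe_singleton, Set.mem_insert_iff, Set.mem_singleton_iff,
    not_or] at hne
  refine hx ?_
  by_cases hxS : x ∈ S
  · rw [Set.indicator_of_mem hxS, h x hxS hne.1 hne.2]
  · exact Set.indicator_of_notMem hxS _

theorem finsum_indicator_stepAt_eq_zero {S : Set ℝ} (h : ∀ x ∈ S, D.kind x ≠ .virt) :
    ∑ᶠ x, S.indicator D.stepAt x = 0 := by
  refine finsum_eq_zero_of_forall_eq_zero fun x => ?_
  by_cases hx : x ∈ S
  · rw [Set.indicator_of_mem hx, stepAt_of_ne (h x hx)]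
  · exact Set.indicator_of_notMem hx _

/-- The derivative of a strand which is the graph of a function, run in one of two directions. -/
theorem deriv_strand {c e y' : ℝ} {Y : ℝ → ℝ} (he : e = 1 ∨ e = -1)
    (h : ∀ x ∈ Set.Icc (-1 : ℝ) 1, D.curve (c + e * x) = (x, Y x)) {x : ℝ}
    (hx : x ∈ Set.Ioo (-1 : ℝ) 1) (hY : HasDerivAt Y y' x) :
    deriv D.curve (c + e * x) = (e, e * y') := by
  -- Since `e * e = 1`, the abscissa at the time `t` is `e * (t - c)`.
  have hee : e * e = 1 := by rcases he with rfl | rfl <;> norm_num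
  have hxx : x = e * (c + e * x - c) := by linear_combination -x * hee
  have h1 : HasDerivAt (fun t => e * (t - c)) e (c + e * x) := by
    simpa using ((hasDerivAt_id (c + e * x)).sub_const c).const_mul e
  have hY' : HasDerivAt Y y' (e * (c + e * x - c)) := hxx ▸ hY
  have h2 : HasDerivAt (fun t => Y (e * (t - c))) (y' * e) (c + e * x) := 
    HasDerivAt.comp (h₂ := Y) (h := fun t => e * (t - c)) _ hY' h1
  have h3 : HasDerivAt (fun t => (e * (t - c), Y (e * (t - c)))) (e, y' * e) (c + e * x) :=
    h1.prodMk h2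
  rw [mul_comm e y', ← h3.deriv]
  refine Filter.EventuallyEq.deriv_eq ?_
  have ho : IsOpen {t : ℝ | e * (t - c) ∈ Set.Ioo (-1 : ℝ) 1} :=
    isOpen_Ioo.preimage (by fun_prop)
  have hmem : c + e * x ∈ {t : ℝ | e * (t - c) ∈ Set.Ioo (-1 : ℝ) 1} := by
    rw [Set.mem_ofPred_eq, ← hxx]
    exact hx
  filter_upwards [ho.mem_nhds hmem] with t ht
  have := h _ (Set.Ioo_subset_Icc_self ht)
  rw [← this]
  congr 1
  linear_combination (c - t) * hee

theorem mem_strand_iff_exists {c e t : ℝ} (he : e = 1 ∨ e = -1) :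
    t ∈ strand c ↔ ∃ x ∈ Set.Icc (-1 : ℝ) 1, t = c + e * x := by
  rw [mem_strand]
  constructor
  · rintro ⟨h1, h2⟩
    refine ⟨e * (t - c), ?_, ?_⟩
    · rcases he with rfl | rfl <;> constructor <;> linarith
    · rcases he with rfl | rfl <;> ring
  · rintro ⟨x, ⟨h1, h2⟩, rfl⟩
    rcases he with rfl | rfl <;> constructor <;> linarith

theorem mem_strand_interior {c e x : ℝ} (he : e = 1 ∨ e = -1) (hx : x ∈ Set.Ioo (-1 : ℝ) 1) :
    c - 1 < c + e * x ∧ c + e * x < c + 1 := by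
  rcases he with rfl | rfl <;> constructor <;> linarith [hx.1, hx.2]

theorem StrandsInSquare.le_or_le (hD : StrandsInSquare D c) {i j : Fin m} (hij : i ≠ j) {t : ℝ}
    (ht : t ∈ strand (c i)) : t ≤ c j - 1 ∨ c j + 1 ≤ t := by
  rw [mem_strand] at ht
  rcases lt_abs.1 (hD.disjoint i j hij) with h | h
  · right; linarith [ht.1]
  · left; linarith [ht.2]

/-- Whether overpass or underpass comes first at a crossing of two different strands depends only on
the strands. Hence so does the choice between `p` and `q` in the weight, once it is known which
strand is over. -/
theorem StrandsInSquare.lt_iff (hD : StrandsInSquare D c) {i j : Fin m} (hij : i ≠ j) {s t : ℝ}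
    (hs : s ∈ strand (c i)) (ht : t ∈ strand (c j)) : s < t ↔ c i < c j := by
  rw [mem_strand] at hs ht
  rcases lt_abs.1 (hD.disjoint i j hij) with h | h
  · constructor <;> intro <;> linarith [hs.1, hs.2, ht.1, ht.2]
  · constructor <;> intro <;> linarith [hs.1, hs.2, ht.1, ht.2]

instance : Fintype {t | IsOuterCut D c t} := finite_isOuterCut.fintype

end Preparation

/-! ### The first move -/

section MoveOne

variable {D D' : LongDiagram}

/-- The generator leaving the loop equals the one entering it in all cases; the factor is the inner
determinant. -/
theorem exists_reducedZeta_moveOne (h : MoveOne D D') :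
    ∃ r : ℤ, D'.reducedZeta = LaurentPolynomial.C (qPow r) * D.reducedZeta := by
  classical
  obtain ⟨c₀, hsame, hline, hsq, a, b, ha, hab, hb, heq, honly⟩ := h
  set c : Fin 1 → ℝ := fun _ => c₀ with hc
  have hout : ∀ s, (∀ i, s ∉ strand (c i)) → s ∉ strand c₀ := fun s hs => hs 0
  have hline' : ∀ t ∈ strand c₀, D.curve t = (t - c₀, 0) := by
    intro t ht
    rw [mem_strand] at ht
    have := hline (t - c₀) ⟨by linarith [ht.1], by linarith [ht.2]⟩
    rwa [add_sub_cancel] at this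
  have hsqD : ∀ t ∈ strand c₀, D.curve t ∈ square := by
    intro t ht
    rw [hline' t ht]
    rw [mem_strand] at ht
    exact ⟨abs_le.2 ⟨by linarith [ht.1], by linarith [ht.2]⟩, by simp⟩
  have houtD : ∀ s, (∀ i, s ∉ strand (c i)) → D.curve s ∉ square :=
    fun s hs => (hsame s (hs 0)).1
  have houtD' : ∀ s, (∀ i, s ∉ strand (c i)) → D'.curve s ∉ square := fun s hs => by
    rw [(hsame s (hs 0)).2.1]
    exact houtD s hs
  have hregD : ∀ t ∈ strand c₀, D.kind t = .regular := by
    intro t ht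
    refine kind_eq_regular (c := c) (hsqD t ht) houtD fun i s hs he => ?_
    rw [hline' t ht, hline' s hs] at he
    linarith [congrArg Prod.fst he]
  have hregD' : ∀ t ∈ strand c₀, t ≠ a → t ≠ b → D'.kind t = .regular := by
    intro t ht hta htb
    refine kind_eq_regular (c := c) (hsq t ht) houtD' fun i s hs he => ?_
    rcases lt_trichotomy s t with hst | hst | hst
    · exact absurd (honly s hs t ht hst he).2 htb
    · exact hst
    · exact absurd (honly t ht s hs hst he.symm).1 hta
  have hamem : a ∈ strand c₀ := mem_strand.2 ⟨ha.le, by linarith⟩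
  have hbmem : b ∈ strand c₀ := mem_strand.2 ⟨by linarith, hb.le⟩
  have hleft : c₀ - 1 ∈ strand c₀ := mem_strand.2 ⟨le_rfl, by linarith⟩
  have hright : c₀ + 1 ∈ strand c₀ := mem_strand.2 ⟨by linarith, le_rfl⟩
  have hSD : StrandsInSquare D c :=
    { disjoint := fun i j hij => absurd (Subsingleton.elim i j) hij
      inside := fun _ => hsqD
      outside := houtD
      left_regular := fun _ => hregD _ hleft
      right_regular := fun _ => hregD _ hright }
  have hSD' : StrandsInSquare D' c :=
    { disjoint := fun i j hij => absurd (Subsingleton.elim i j) hij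
      inside := fun _ => hsq
      outside := houtD'
      left_regular := fun _ => hregD' _ hleft (by linarith) (by linarith)
      right_regular := fun _ => hregD' _ hright (by linarith) (by linarith) }
  have hpa : D'.partner a = b := LongDiagram.partner_eq hab.ne' heq.symm
  have hpb : D'.partner b = a := LongDiagram.partner_eq hab.ne heq
  have hkinds := D'.kind_pair a b hab.ne heq
  have hva : D'.kind a = .virt → D'.kind b = .virt := fun h => hpa ▸ kind_partner_of_virt h
  have hvb : D'.kind b = .virt → D'.kind a = .virt := fun h => hpb ▸ kind_partner_of_virt h
  have hsumD : ∑ᶠ x, (strand c₀).indicator D.stepAt x = 0 :=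
    finsum_indicator_stepAt_eq_zero fun x hx => by simp [hregD x hx]
  have hL : LocalChange D D' c :=
    { left := hSD
      right := hSD'
      same := fun t ht => (hsame t (ht 0)).2
      sum_step := by
        intro _
        rw [hsumD, finsum_indicator_pair hab.ne hamem hbmem fun x hx hxa hxb =>
          stepAt_of_ne (by simp [hregD' x hx hxa hxb])]
        -- A virtual loop contributes two opposite steps, a classical one none.
        by_cases hv : D'.kind a = .virt
        · rw [← hpa, stepAt_partner hv]
          ring
        · rw [stepAt_of_ne hv, stepAt_of_ne fun h => hv (hvb h), add_zero] }
  set O : Set ℝ := {t | IsOuterCut D c t} with hOdef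
  have hO : ∀ t, t ∈ O ↔ IsOuterCut D c t := fun t => Iff.rfl
  have hO' : ∀ t, t ∈ O ↔ IsOuterCut D' c t := fun t => (hL.isOuterCut_iff t).symm
  have : Nonempty O := ⟨⟨c₀ - 1, Or.inr (Or.inl ⟨0, rfl⟩)⟩⟩
  have hzD := reducedZeta_eq_of_no_under hSD hO fun _ t ht => by simp [hregD t ht]
  rw [hzD, ← hL.outerMatrix_eq hO]
  by_cases hvirt : D'.kind a = .virt
  · refine ⟨0, ?_⟩
    rw [qPow_zero, map_one, one_mul]
    refine reducedZeta_eq_of_no_under hSD' hO' fun _ t ht => ?_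
    by_cases hta : t = a
    · simp [hta, hvirt]
    · by_cases htb : t = b
      · simp [htb, hva hvirt]
      · simp [hregD' t ht hta htb]
  · have hnv : ∀ t ∈ strand c₀, D'.kind t ≠ .virt := by
      intro t ht
      by_cases hta : t = a
      · rwa [hta]
      · by_cases htb : t = b
        · rw [htb]
          exact fun h => hvirt (hvb h)
        · simp [hregD' t ht hta htb]
    have hlevel : D'.level b = D'.level a :=
      level_eq_of_no_virt hab.le fun x h1 h2 =>
        hnv x (mem_strand.2 ⟨by linarith, by linarith⟩)
    rcases hkinds with ⟨hka, hkb⟩ | ⟨hka, hkb⟩ | ⟨hka, hkb⟩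
    -- Overpass first: both incoming and overpassing generators are the entry, with coefficients `w`
    -- and `1 - w` of sum `1`.
    · refine ⟨0, ?_⟩
      rw [qPow_zero, map_one, one_mul]
      have hin : ∀ _ : Unit, ∃ i, c i - 1 < b ∧ b < c i + 1 := fun _ => ⟨0, by linarith, hb⟩
      have huinj : Function.Injective (fun _ : Unit => b) := fun _ _ _ => rfl
      rw [reducedZeta_eq_det_outerMatrix (O := O) (u := fun _ : Unit => b) hSD' hO' huinj hin
        (fun i t ht hk => ⟨(), by
          by_contra htb
          have hta : t ≠ a := fun h => by
            rw [h, hka] at hk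
            cases hk
          simp [hregD' t ht hta fun h => htb h.symm] at hk⟩)
        (fun _ => .inl (entry hO' 0)) (fun _ => .inl (entry hO' 0)) (fun _ => .inr ())
        (fun _ => cyclicPred_entry hSD' hO' huinj hin (i := 0) (by simp only [hc]; linarith) hb.le
          fun _ _ => le_rfl)
        (fun _ => cyclicPred_entry hSD' hO' huinj hin (i := 0) (by rw [hpb]; exact ha)
          (by rw [hpb]; simp only [hc]; linarith) fun _ _ => by rw [hpb]; exact hab.le)
        (fun i => cyclicPred_inner hSD' hO' huinj hin (i := i) (j := ())
          (by simp only [hc]; linarith) hb le_rfl fun _ h => absurd h (lt_irrefl _))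
        (fun _ => Pi.single (entry hO' 0) 1) ?_]
      · refine Eq.trans (congrArg₂ (· * ·) ?_ ?_) (one_mul _)
        · rw [Matrix.det_unique]
          simp
        · congr!
      · intro _
        simp only [Sum.elim_inl, overCoeff, hpb, hlevel, sub_self, LaurentPolynomial.T_zero,
          mul_one, ← add_smul, ← map_add, add_sub_cancel, map_one, one_smul]
    -- Underpass first, so the weight `w` is a power of `q`. The overpassing arc starts at this
    -- underpass: `x = w * entry + (1 - w) * x` has the solution `x = entry`, and the diagonal
    -- coefficient of `x` is `w`.
    · refine ⟨areaSign (deriv D'.curve b) (deriv D'.curve a), ?_⟩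
      have hw : D'.weightAt a = qPow (areaSign (deriv D'.curve b) (deriv D'.curve a)) := by
        rw [weightAt, if_pos hka, hpa, if_neg (not_lt.2 hab.le)]
      have hin : ∀ _ : Unit, ∃ i, c i - 1 < a ∧ a < c i + 1 :=
        fun _ => ⟨0, by linarith, by simp only [hc]; linarith⟩
      have huinj : Function.Injective (fun _ : Unit => a) := fun _ _ _ => rfl
      have hcoef : D'.overCoeff a = 1 - LaurentPolynomial.C (D'.weightAt a) := by
        simp [overCoeff, hpa, hlevel]
      rw [reducedZeta_eq_det_outerMatrix (O := O) (u := fun _ : Unit => a) hSD' hO' huinj hin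
        (fun i t ht hk => ⟨(), by
          by_contra hta
          have htb : t ≠ b := fun h => by
            rw [h, hkb] at hk
            cases hk
          simp [hregD' t ht (fun h => hta h.symm) htb] at hk⟩)
        (fun _ => .inl (entry hO' 0)) (fun _ => .inr ()) (fun _ => .inr ())
        (fun _ => cyclicPred_entry hSD' hO' huinj hin (i := 0) ha (by simp only [hc]; linarith)
          fun _ _ => le_rfl)
        (fun _ => cyclicPred_inner hSD' hO' huinj hin (i := 0) (j := ())
          ha (by rw [hpa]; exact hab) (by rw [hpa]; exact hb.le)
          fun _ h => absurd h (lt_irrefl _))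
        (fun i => cyclicPred_inner hSD' hO' huinj hin (i := i) (j := ())
          ha (by simp only [hc]; linarith) le_rfl fun _ h => absurd h (lt_irrefl _))
        (fun _ => Pi.single (entry hO' 0) 1) ?_]
      · congr 1
        · rw [Matrix.det_unique]
          simp [hcoef, hw]
      · intro _
        simp only [Sum.elim_inl, Sum.elim_inr, hcoef]
        module
    · exact absurd hka hvirt

end MoveOne

end LongDiagram

namespace LongDiagram

/-! ### The second move -/

section MoveTwo

variable {D D' : LongDiagram} {m : ℕ} {c : Fin m → ℝ} {O : Set ℝ} [Fintype O] [Nonempty O]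

/-- Without virtual passages the level is constant on each strand, so the exponent depends only on
the two entries. -/
theorem overCoeff_eq_of_no_virt
    (hno : ∀ i, ∀ t ∈ strand (c i), D.kind t ≠ .virt) {i i' : Fin m} {t : ℝ}
    (ht : t ∈ strand (c i)) (hp : D.partner t ∈ strand (c i')) :
    D.overCoeff t = LaurentPolynomial.C (1 - D.weightAt t) *
      LaurentPolynomial.T (D.level (c i' - 1) - D.level (c i - 1)) := by
  have key : ∀ i, ∀ t ∈ strand (c i), D.level t = D.level (c i - 1) := by
    intro i t ht
    rw [mem_strand] at ht
    exact level_eq_of_no_virt ht.1 fun x h1 h2 => hno i x (mem_strand.2 ⟨h1, by linarith [ht.2]⟩)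
  rw [overCoeff, key i t ht, key i' _ hp]

/-- The weights of two crossings of opposite signs at which the overpasses and the underpasses
follow in the same order. -/
theorem weightAt_mul_weightAt {s t : ℝ} (hs : D.kind s = .under) (ht : D.kind t = .under)
    (hlt : D.partner s < s ↔ D.partner t < t)
    (hsign : areaSign (deriv D.curve (D.partner t)) (deriv D.curve t) =
      -areaSign (deriv D.curve (D.partner s)) (deriv D.curve s)) :
    D.weightAt s * D.weightAt t = 1 := by
  rw [weightAt, weightAt, if_pos hs, if_pos ht, hsign]
  by_cases h : D.partner s < s
  · rw [if_pos h, if_pos (hlt.1 h), ← pPow_add, add_neg_cancel, pPow_zero]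
  · rw [if_neg h, if_neg fun h' => h (hlt.2 h'), ← qPow_add, add_neg_cancel, qPow_zero]

/-- A time inside the strand `i` that follows the entry of another strand also follows its exit; in
this form it feeds `cyclicPred_entry`. -/
theorem not_mem_of_lt (hD : StrandsInSquare D c) {i k : Fin m} (hik : k ≠ i) {v : ℝ}
    (h1 : c i - 1 < v) (h2 : v < c i + 1) : c k - 1 < v → c k + 1 ≤ v := by
  intro h
  rcases hD.le_or_le hik.symm (mem_strand.2 ⟨h1.le, h2.le⟩) with h' | h'
  · linarith
  · exact h'

/-- Two successive underpasses of the strand `i` below the strand `i'`, with inverse weights, have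
the same effect as no underpasses. -/
theorem reducedZeta_eq_of_two_under (hD : StrandsInSquare D c)
    (hO : ∀ t, t ∈ O ↔ IsOuterCut D c t) {i i' : Fin m} (hii : i ≠ i') {v₀ v₁ : ℝ}
    (h0 : c i - 1 < v₀) (h01 : v₀ < v₁) (h1 : v₁ < c i + 1)
    (hp0 : c i' - 1 < D.partner v₀ ∧ D.partner v₀ ≤ c i' + 1)
    (hp1 : c i' - 1 < D.partner v₁ ∧ D.partner v₁ ≤ c i' + 1)
    (hcover : ∀ k, ∀ t ∈ strand (c k), D.kind t = .under → t = v₀ ∨ t = v₁)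
    (hno : ∀ i, ∀ t ∈ strand (c i), D.kind t ≠ .virt) (hw : D.weightAt v₀ * D.weightAt v₁ = 1) :
    D.reducedZeta = (outerMatrix D c (O := O) fun i => Pi.single (entry hO i) 1).det := by
  set v : Fin 2 → ℝ := ![v₀, v₁] with hv
  have hvin : ∀ j, c i - 1 < v j ∧ v j < c i + 1 := by
    intro j
    fin_cases j
    · exact ⟨h0, h01.trans h1⟩
    · exact ⟨h0.trans h01, h1⟩
  have hin : ∀ j, ∃ i, c i - 1 < v j ∧ v j < c i + 1 := fun j => ⟨i, hvin j⟩
  have huinj : Function.Injective v := by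
    intro j j' h
    fin_cases j <;> fin_cases j' <;> simp_all
  have hoff : ∀ k, k ≠ i → ∀ j, c k - 1 < v j → c k + 1 ≤ v j :=
    fun k hk j => not_mem_of_lt hD hk (hvin j).1 (hvin j).2
  have hpv : ∀ j, c i' - 1 < D.partner (v j) ∧ D.partner (v j) ≤ c i' + 1 := by
    intro j
    fin_cases j
    · exact hp0
    · exact hp1
  have hK : ∀ j, D.overCoeff (v j) = LaurentPolynomial.C (1 - D.weightAt (v j)) *
      LaurentPolynomial.T (D.level (c i' - 1) - D.level (c i - 1)) := fun j =>
    overCoeff_eq_of_no_virt hno (mem_strand.2 ⟨(hvin j).1.le, (hvin j).2.le⟩)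
      (mem_strand.2 ⟨(hpv j).1.le, (hpv j).2⟩)
  have hW : LaurentPolynomial.C (D.weightAt v₁) * LaurentPolynomial.C (D.weightAt v₀) =
      (1 : LaurentPolynomial CoeffRing) := by
    rw [← map_mul, mul_comm, hw, map_one]
  rw [reducedZeta_eq_det_outerMatrix (O := O) (u := v) hD hO huinj hin
    (fun k t ht hk => (hcover k t ht hk).elim (fun h => ⟨0, h.symm⟩) fun h => ⟨1, h.symm⟩)
    ![.inl (entry hO i), .inr 0] (fun _ => .inl (entry hO i'))
    (fun k => if k = i then .inr 1 else .inl (entry hO k))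
    (by
      intro j
      fin_cases j
      · refine cyclicPred_entry hD hO huinj hin (i := i) (hvin 0).1 (hvin 0).2.le fun j _ => ?_
        fin_cases j
        · exact le_rfl
        · exact h01.le
      · refine cyclicPred_inner hD hO huinj hin (i := i) (j := 0) h0 h01 h1.le fun j hj => ?_
        fin_cases j
        · exact absurd hj (lt_irrefl _)
        · exact le_rfl)
    -- The upper strand has no inner cuts, so its entry precedes both overpasses.
    (fun j => cyclicPred_entry hD hO huinj hin (i := i') (hpv j).1 (hpv j).2 fun j' h =>
      (hpv j).2.trans (hoff i' hii.symm j' h))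
    (fun k => by
      by_cases hk : k = i
      · subst hk
        rw [if_pos rfl]
        refine cyclicPred_inner hD hO huinj hin (i := k) (j := 1) (hvin 1).1 h1 le_rfl
          fun j hj => ?_
        fin_cases j
        · exact absurd hj (not_lt.2 h01.le)
        · exact absurd hj (lt_irrefl _)
      · rw [if_neg hk]
        exact cyclicPred_entry hD hO huinj hin (by linarith) le_rfl fun j => hoff k hk j)
    ![LaurentPolynomial.C (D.weightAt v₀) • Pi.single (entry hO i) 1 +
      D.overCoeff v₀ • Pi.single (entry hO i') 1, Pi.single (entry hO i) 1]
    (by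
      intro j
      fin_cases j
      · simp [hv]
      · have e0 := hK 0
        have e1 := hK 1
        simp only [hv, Matrix.cons_val_zero, Matrix.cons_val_one] at e0 e1
        -- The coefficient of the upper generator after both underpasses is `w₁ * (1 - w₀) + (1 -
        -- w₁) = 1 - w₁ * w₀ = 0`, up to a common power of `s`.
        have : LaurentPolynomial.C (D.weightAt v₁) * D.overCoeff v₀ + D.overCoeff v₁ = 0 := by
          rw [e0, e1, map_sub, map_sub, map_one]
          linear_combination
            (-LaurentPolynomial.T (D.level (c i' - 1) - D.level (c i - 1))) * hW
        simp only [hv, Fin.mk_one, Fin.isValue, Matrix.cons_val_one, Matrix.cons_val_fin_one,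
          Sum.elim_inr, Matrix.cons_val_zero, Sum.elim_inl, smul_add, smul_smul, hW, one_smul,
          add_assoc, ← add_smul, this, zero_smul, add_zero])]
  refine Eq.trans (congrArg₂ (· * ·) ?_ ?_) (one_mul _)
  · rw [Matrix.det_fin_two]
    simp
  · congr 2
    funext k
    by_cases hk : k = i
    · subst hk
      simp
    · simp [hk]

/-- The parabola meets the axis at `x = ±1/2` with opposite slopes, so the two crossings have
opposite signs, while the time order of the strands is the same at both. Hence the weights are
inverse, or the virtual steps cancel. -/
theorem reducedZeta_moveTwo (h : MoveTwo D D') : D'.reducedZeta = D.reducedZeta := by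
  classical
  obtain ⟨c₁, c₂, e₁, e₂, g, hc12, he1, he2, hsame, hpic, hkind⟩ := h
  set c : Fin 2 → ℝ := ![c₁, c₂] with hc
  have hc0 : c 0 = c₁ := rfl
  have hc1 : c 1 = c₂ := rfl
  have hmem : ∀ t, (∀ i, t ∉ strand (c i)) → t ∉ strand c₁ ∪ strand c₂ := by
    intro t ht h
    rcases h with h | h
    · exact ht 0 h
    · exact ht 1 h
  have hdisj : ∀ i j, i ≠ j → 2 < |c i - c j| := by
    intro i j hij
    fin_cases i <;> fin_cases j
    · exact absurd rfl hij
    · exact hc12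
    · exact abs_sub_comm c₁ c₂ ▸ hc12
    · exact absurd rfl hij
  have houtD : ∀ s, (∀ i, s ∉ strand (c i)) → D.curve s ∉ square :=
    fun s hs => (hsame s (hmem s hs)).1
  have houtD' : ∀ s, (∀ i, s ∉ strand (c i)) → D'.curve s ∉ square := fun s hs => by
    rw [(hsame s (hmem s hs)).2.1]
    exact houtD s hs
  have hcases : ∀ i, ∀ t ∈ strand (c i), ∃ x ∈ Set.Icc (-1 : ℝ) 1,
      (i = 0 ∧ t = c₁ + e₁ * x) ∨ (i = 1 ∧ t = c₂ + e₂ * x) := by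
    intro i t ht
    fin_cases i
    · obtain ⟨x, hx, rfl⟩ := (mem_strand_iff_exists he1).1 ht
      exact ⟨x, hx, Or.inl ⟨rfl, rfl⟩⟩
    · obtain ⟨x, hx, rfl⟩ := (mem_strand_iff_exists he2).1 ht
      exact ⟨x, hx, Or.inr ⟨rfl, rfl⟩⟩
  have hinD : ∀ i, ∀ t ∈ strand (c i), D.curve t ∈ square := by
    intro i t ht
    obtain ⟨x, hx, ⟨-, rfl⟩ | ⟨-, rfl⟩⟩ := hcases i t ht
    · rw [(hpic x hx).2.2.1]
      exact ⟨abs_le.2 hx, by simp⟩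
    · rw [(hpic x hx).2.2.2.1]
      exact ⟨abs_le.2 hx, abs_le.2 ⟨by linarith [(hpic x hx).1], (hpic x hx).2.1⟩⟩
  have hinD' : ∀ i, ∀ t ∈ strand (c i), D'.curve t ∈ square := by
    intro i t ht
    obtain ⟨x, hx, ⟨-, rfl⟩ | ⟨-, rfl⟩⟩ := hcases i t ht
    · rw [(hpic x hx).2.2.2.2.1]
      exact ⟨abs_le.2 hx, by simp⟩
    · rw [(hpic x hx).2.2.2.2.2]
      exact ⟨abs_le.2 hx, abs_le.2 ⟨by nlinarith, by nlinarith [hx.1, hx.2]⟩⟩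
  have hregD : ∀ i, ∀ t ∈ strand (c i), D.kind t = .regular := by
    intro i t ht
    refine kind_eq_regular (c := c) (hinD i t ht) houtD fun j s hs he => ?_
    obtain ⟨x, hx, ⟨-, rfl⟩ | ⟨-, rfl⟩⟩ := hcases i t ht <;>
    obtain ⟨y, hy, ⟨-, rfl⟩ | ⟨-, rfl⟩⟩ := hcases j s hs
    · rw [(hpic x hx).2.2.1, (hpic y hy).2.2.1] at he
      rw [show y = x from (Prod.ext_iff.1 he).1]
    · rw [(hpic x hx).2.2.1, (hpic y hy).2.2.2.1] at he
      exact absurd (Prod.ext_iff.1 he).2 (hpic y hy).1.ne'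
    · rw [(hpic x hx).2.2.2.1, (hpic y hy).2.2.1] at he
      exact absurd (Prod.ext_iff.1 he).2 (hpic x hx).1.ne
    · rw [(hpic x hx).2.2.2.1, (hpic y hy).2.2.2.1] at he
      rw [show y = x from (Prod.ext_iff.1 he).1]
  have hregD' : ∀ x ∈ Set.Icc (-1 : ℝ) 1, x ≠ 1 / 2 → x ≠ -(1 / 2) →
      D'.kind (c₁ + e₁ * x) = .regular ∧ D'.kind (c₂ + e₂ * x) = .regular := by
    intro x hx h1 h2
    have hxx : x ^ 2 - 1 / 4 ≠ 0 := by
      intro h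
      have : (x - 1 / 2) * (x + 1 / 2) = 0 := by linear_combination h
      rcases mul_eq_zero.1 this with h' | h'
      · exact h1 (by linarith)
      · exact h2 (by linarith)
    constructor
    · refine kind_eq_regular (c := c) (hinD' 0 _ ((mem_strand_iff_exists he1).2 ⟨x, hx, rfl⟩))
        houtD' fun j s hs he => ?_
      obtain ⟨y, hy, ⟨-, rfl⟩ | ⟨-, rfl⟩⟩ := hcases j s hs
      · rw [(hpic x hx).2.2.2.2.1, (hpic y hy).2.2.2.2.1] at he
        rw [show y = x from (Prod.ext_iff.1 he).1]
      · rw [(hpic x hx).2.2.2.2.1, (hpic y hy).2.2.2.2.2] at he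
        have e1 := (Prod.ext_iff.1 he).1
        have e2 := (Prod.ext_iff.1 he).2
        simp only at e1 e2
        rw [e1] at e2
        exact absurd e2 hxx
    · refine kind_eq_regular (c := c) (hinD' 1 _ ((mem_strand_iff_exists he2).2 ⟨x, hx, rfl⟩))
        houtD' fun j s hs he => ?_
      obtain ⟨y, hy, ⟨-, rfl⟩ | ⟨-, rfl⟩⟩ := hcases j s hs
      · rw [(hpic x hx).2.2.2.2.2, (hpic y hy).2.2.2.2.1] at he
        exact absurd (Prod.ext_iff.1 he).2.symm hxx
      · rw [(hpic x hx).2.2.2.2.2, (hpic y hy).2.2.2.2.2] at he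
        rw [show y = x from (Prod.ext_iff.1 he).1]
  have hleft : ∀ i, c i - 1 ∈ strand (c i) := fun i => mem_strand.2 ⟨le_rfl, by linarith⟩
  have hright : ∀ i, c i + 1 ∈ strand (c i) := fun i => mem_strand.2 ⟨by linarith, le_rfl⟩
  have hend : ∀ i, ∀ t ∈ strand (c i), t = c i - 1 ∨ t = c i + 1 → D'.kind t = .regular := by
    intro i t ht h
    -- The ends of a strand have abscissa `±1`, hence are not crossings.
    have hx2 : ∀ (c e x : ℝ), (e = 1 ∨ e = -1) → (c + e * x = c - 1 ∨ c + e * x = c + 1) →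
        x ≠ 1 / 2 ∧ x ≠ -(1 / 2) := by
      rintro c e x (rfl | rfl) (h | h) <;> constructor <;> intro h' <;> linarith
    obtain ⟨x, hx, ⟨rfl, rfl⟩ | ⟨rfl, rfl⟩⟩ := hcases i t ht
    · obtain ⟨h1, h2⟩ := hx2 c₁ e₁ x he1 h
      exact (hregD' x hx h1 h2).1
    · obtain ⟨h1, h2⟩ := hx2 c₂ e₂ x he2 h
      exact (hregD' x hx h1 h2).2
  have hSD : StrandsInSquare D c :=
    { disjoint := hdisj
      inside := hinD
      outside := houtD
      left_regular := fun i => hregD i _ (hleft i)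
      right_regular := fun i => hregD i _ (hright i) }
  have hSD' : StrandsInSquare D' c :=
    { disjoint := hdisj
      inside := hinD'
      outside := houtD'
      left_regular := fun i => hend i _ (hleft i) (Or.inl rfl)
      right_regular := fun i => hend i _ (hright i) (Or.inr rfl) }
  have hm1 : ∀ x ∈ Set.Icc (-1 : ℝ) 1, c₁ + e₁ * x ∈ strand (c 0) :=
    fun x hx => (mem_strand_iff_exists he1).2 ⟨x, hx, rfl⟩
  have hm2 : ∀ x ∈ Set.Icc (-1 : ℝ) 1, c₂ + e₂ * x ∈ strand (c 1) :=
    fun x hx => (mem_strand_iff_exists he2).2 ⟨x, hx, rfl⟩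
  have hmeet : ∀ x ∈ Set.Icc (-1 : ℝ) 1, x ^ 2 = 1 / 4 →
      D'.curve (c₁ + e₁ * x) = D'.curve (c₂ + e₂ * x) := by
    intro x hx hxx
    rw [(hpic x hx).2.2.2.2.1, (hpic x hx).2.2.2.2.2, hxx, sub_self]
  have hne12 : ∀ x ∈ Set.Icc (-1 : ℝ) 1, c₁ + e₁ * x ≠ c₂ + e₂ * x := fun x hx h => by
    have h1 := hm1 x hx
    rw [h] at h1
    exact absurd (hSD.eq_of_mem h1 (hm2 x hx)) (by decide)
  have hp1 : ∀ x ∈ Set.Icc (-1 : ℝ) 1, x ^ 2 = 1 / 4 →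
      D'.partner (c₁ + e₁ * x) = c₂ + e₂ * x := fun x hx hxx =>
    LongDiagram.partner_eq (hne12 x hx).symm (hmeet x hx hxx).symm
  have hp2 : ∀ x ∈ Set.Icc (-1 : ℝ) 1, x ^ 2 = 1 / 4 →
      D'.partner (c₂ + e₂ * x) = c₁ + e₁ * x := fun x hx hxx =>
    LongDiagram.partner_eq (hne12 x hx) (hmeet x hx hxx)
  have hd1 : ∀ x ∈ Set.Ioo (-1 : ℝ) 1, deriv D'.curve (c₁ + e₁ * x) = (e₁, 0) := by
    intro x hx
    rw [deriv_strand (Y := fun _ => 0) (y' := 0) he1 (fun x hx => (hpic x hx).2.2.2.2.1) hx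
      (hasDerivAt_const _ _), mul_zero]
  have hd2 : ∀ x ∈ Set.Ioo (-1 : ℝ) 1, deriv D'.curve (c₂ + e₂ * x) = (e₂, e₂ * (2 * x)) := by
    intro x hx
    refine deriv_strand (Y := fun x => x ^ 2 - 1 / 4) he2 (fun x hx => (hpic x hx).2.2.2.2.2) hx ?_
    simpa using (hasDerivAt_pow 2 x).sub_const (1 / 4)
  have hr : (1 / 2 : ℝ) ∈ Set.Ioo (-1 : ℝ) 1 := by constructor <;> norm_num
  have hl : (-(1 / 2) : ℝ) ∈ Set.Ioo (-1 : ℝ) 1 := by constructor <;> norm_num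
  have hr' := Set.Ioo_subset_Icc_self hr
  have hl' := Set.Ioo_subset_Icc_self hl
  have hrr : (1 / 2 : ℝ) ^ 2 = 1 / 4 := by norm_num
  have hll : (-(1 / 2) : ℝ) ^ 2 = 1 / 4 := by norm_num
  have hee : 0 < e₁ * e₂ ∨ e₁ * e₂ < 0 := by
    rcases he1 with rfl | rfl <;> rcases he2 with rfl | rfl <;> norm_num
  have hsign : areaSign (deriv D'.curve (c₁ + e₁ * (1 / 2))) (deriv D'.curve (c₂ + e₂ * (1 / 2))) =
      -areaSign (deriv D'.curve (c₁ + e₁ * -(1 / 2))) (deriv D'.curve (c₂ + e₂ * -(1 / 2))) := by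
    rw [hd1 _ hr, hd2 _ hr, hd1 _ hl, hd2 _ hl]
    unfold areaSign orientedArea
    simp only [zero_mul, sub_zero]
    rcases hee with h | h
    · rw [if_pos (by nlinarith), if_neg (by nlinarith)]; rfl
    · rw [if_neg (by nlinarith), if_pos (by nlinarith)]
  have hsign' : areaSign (deriv D'.curve (c₂ + e₂ * (1 / 2))) (deriv D'.curve (c₁ + e₁ * (1 / 2))) =
      -areaSign (deriv D'.curve (c₂ + e₂ * -(1 / 2))) (deriv D'.curve (c₁ + e₁ * -(1 / 2))) := by
    rw [areaSign_swap (D'.transverse _ _ (hne12 _ hr') (hmeet _ hr' hrr)),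
      areaSign_swap (D'.transverse _ _ (hne12 _ hl') (hmeet _ hl' hll)), hsign]
  have hkind1 : D'.kind (c₁ + e₁ * (1 / 2)) = D'.kind (c₁ + e₁ * -(1 / 2)) := by
    rcases he1 with rfl | rfl
    · rw [one_mul, one_mul, hkind, sub_eq_add_neg]
    · rw [neg_one_mul, neg_one_mul, neg_neg, hkind, sub_eq_add_neg]
  have hne1 : c₁ + e₁ * (1 / 2) ≠ c₁ + e₁ * -(1 / 2) := by
    rcases he1 with rfl | rfl <;> norm_num
  have hne2 : c₂ + e₂ * (1 / 2) ≠ c₂ + e₂ * -(1 / 2) := by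
    rcases he2 with rfl | rfl <;> norm_num
  have hregD1 : ∀ x ∈ strand (c 0), x ≠ c₁ + e₁ * (1 / 2) → x ≠ c₁ + e₁ * -(1 / 2) →
      D'.kind x = .regular := by
    intro t ht h1 h2
    obtain ⟨x, hx, rfl⟩ := (mem_strand_iff_exists he1).1 ht
    exact (hregD' x hx (fun h => h1 (by rw [h]; rfl)) (fun h => h2 (by rw [h]; rfl))).1
  have hregD2 : ∀ x ∈ strand (c 1), x ≠ c₂ + e₂ * (1 / 2) → x ≠ c₂ + e₂ * -(1 / 2) →
      D'.kind x = .regular := by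
    intro t ht h1 h2
    obtain ⟨x, hx, rfl⟩ := (mem_strand_iff_exists he2).1 ht
    exact (hregD' x hx (fun h => h1 (by rw [h]; rfl)) (fun h => h2 (by rw [h]; rfl))).2
  have hkr := D'.kind_pair _ _ (hne12 _ hr') (hmeet _ hr' hrr)
  have hkl := D'.kind_pair _ _ (hne12 _ hl') (hmeet _ hl' hll)
  rw [← hkind1] at hkl
  have hsumD : ∀ i, ∑ᶠ x, (strand (c i)).indicator D.stepAt x = 0 := fun i =>
    finsum_indicator_stepAt_eq_zero fun x hx => by simp [hregD i x hx]
  have hL : LocalChange D D' c :=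
    { left := hSD
      right := hSD'
      same := fun t ht => (hsame t (hmem t ht)).2
      sum_step := by
        intro i
        rw [hsumD]
        fin_cases i
        · change ∑ᶠ x, (strand (c 0)).indicator D'.stepAt x = 0
          rw [finsum_indicator_pair hne1 (hm1 _ hr') (hm1 _ hl') fun x hx h1 h2 =>
            stepAt_of_ne fun h => by
              rw [hregD1 x hx h1 h2] at h
              cases h]
          unfold stepAt
          rw [← hkind1, hp1 _ hr' hrr, hp1 _ hl' hll, hsign]
          split_ifs <;> ring
        · change ∑ᶠ x, (strand (c 1)).indicator D'.stepAt x = 0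
          rw [finsum_indicator_pair hne2 (hm2 _ hr') (hm2 _ hl') fun x hx h1 h2 =>
            stepAt_of_ne fun h => by
              rw [hregD2 x hx h1 h2] at h
              cases h]
          have hkind2 : D'.kind (c₂ + e₂ * (1 / 2)) = D'.kind (c₂ + e₂ * -(1 / 2)) := by
            rcases hkr with h | h | h <;> rcases hkl with h' | h' | h' <;>
              first | exact h.2.trans h'.2.symm | cases h.1.symm.trans h'.1
          unfold stepAt
          rw [← hkind2, hp2 _ hr' hrr, hp2 _ hl' hll, hsign']
          split_ifs <;> ring }
  set O : Set ℝ := {t | IsOuterCut D c t} with hOdef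
  have hO : ∀ t, t ∈ O ↔ IsOuterCut D c t := fun t => Iff.rfl
  have hO' : ∀ t, t ∈ O ↔ IsOuterCut D' c t := fun t => (hL.isOuterCut_iff t).symm
  have : Nonempty O := ⟨⟨c 0 - 1, Or.inr (Or.inl ⟨0, rfl⟩)⟩⟩
  have hzD := reducedZeta_eq_of_no_under hSD hO fun i t ht => by simp [hregD i t ht]
  rw [hzD, ← hL.outerMatrix_eq hO]
  -- A property of regular times need only be checked further at the four crossing times.
  have hall : ∀ (P : ℝ → Prop), (∀ t, D'.kind t = .regular → P t) → P (c₁ + e₁ * (1 / 2)) →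
      P (c₁ + e₁ * -(1 / 2)) → P (c₂ + e₂ * (1 / 2)) → P (c₂ + e₂ * -(1 / 2)) →
      ∀ i, ∀ t ∈ strand (c i), P t := by
    intro P h0 h1 h2 h3 h4 i t ht
    fin_cases i
    · by_cases ha : t = c₁ + e₁ * (1 / 2)
      · rwa [ha]
      · by_cases hb : t = c₁ + e₁ * -(1 / 2)
        · rwa [hb]
        · exact h0 t (hregD1 t ht ha hb)
    · by_cases ha : t = c₂ + e₂ * (1 / 2)
      · rwa [ha]
      · by_cases hb : t = c₂ + e₂ * -(1 / 2)
        · rwa [hb]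
        · exact h0 t (hregD2 t ht ha hb)
  have hord : ∀ i, ∀ s ∈ strand (c i), ∀ j, ∀ t ∈ strand (c j), i ≠ j → (s < t ↔ c i < c j) :=
    fun i s hs j t ht hij => hSD.lt_iff hij hs ht
  have hint1 := fun x (hx : x ∈ Set.Ioo (-1 : ℝ) 1) => mem_strand_interior (c := c₁) he1 hx
  have hint2 := fun x (hx : x ∈ Set.Ioo (-1 : ℝ) 1) => mem_strand_interior (c := c₂) he2 hx
  -- Both crossings have the same type on the first strand, so only three of the nine combinations
  -- survive.
  rcases hkr with ⟨k1, k2⟩ | ⟨k1, k2⟩ | ⟨k1, k2⟩ <;> rcases hkl with ⟨k3, k4⟩ | ⟨k3, k4⟩ | ⟨k3, k4⟩ <;>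
    (first | (cases k1.symm.trans k3; done) | skip)
  · have hw : D'.weightAt (c₂ + e₂ * (1 / 2)) * D'.weightAt (c₂ + e₂ * -(1 / 2)) = 1 := by
      refine weightAt_mul_weightAt k2 k4 ?_ ?_
      · rw [hp2 _ hr' hrr, hp2 _ hl' hll]
        rw [hord 0 _ (hm1 _ hr') 1 _ (hm2 _ hr') (by decide),
          hord 0 _ (hm1 _ hl') 1 _ (hm2 _ hl') (by decide)]
      · rw [hp2 _ hr' hrr, hp2 _ hl' hll, hsign, neg_neg]
    have hcov : ∀ i, ∀ t ∈ strand (c i), D'.kind t = .under →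
        t = c₂ + e₂ * (1 / 2) ∨ t = c₂ + e₂ * -(1 / 2) := by
      refine hall _ (fun t h h' => ?_) (fun h => ?_) (fun h => ?_) (fun _ => Or.inl rfl)
        fun _ => Or.inr rfl
      · rw [h] at h'; cases h'
      · rw [k1] at h; cases h
      · rw [← hkind1, k1] at h; cases h
    have hnv : ∀ i, ∀ t ∈ strand (c i), D'.kind t ≠ .virt :=
      hall _ (fun t h => by simp [h]) (by rw [k1]; simp) (by rw [← hkind1, k1]; simp) (by rw [k2]; simp)
        (by rw [k4]; simp)
    have hpr := hp2 _ hr' hrr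
    have hpl := hp2 _ hl' hll
    -- The direction of the lower strand decides which underpass comes first.
    rcases he2 with h2 | h2
    · exact reducedZeta_eq_of_two_under hSD' hO' (i := 1) (i' := 0) (by decide)
        (v₀ := c₂ + e₂ * -(1 / 2)) (v₁ := c₂ + e₂ * (1 / 2)) (hint2 _ hl).1 (by rw [h2]; linarith)
        (hint2 _ hr).2 (by rw [hpl]; exact ⟨(hint1 _ hl).1, (hint1 _ hl).2.le⟩)
        (by rw [hpr]; exact ⟨(hint1 _ hr).1, (hint1 _ hr).2.le⟩)
        (fun k t ht hk => (hcov k t ht hk).symm) hnv (by rw [mul_comm, hw])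
    · exact reducedZeta_eq_of_two_under hSD' hO' (i := 1) (i' := 0) (by decide)
        (v₀ := c₂ + e₂ * (1 / 2)) (v₁ := c₂ + e₂ * -(1 / 2)) (hint2 _ hr).1 (by rw [h2]; linarith)
        (hint2 _ hl).2 (by rw [hpr]; exact ⟨(hint1 _ hr).1, (hint1 _ hr).2.le⟩)
        (by rw [hpl]; exact ⟨(hint1 _ hl).1, (hint1 _ hl).2.le⟩)
        hcov hnv hw
  · have hw : D'.weightAt (c₁ + e₁ * (1 / 2)) * D'.weightAt (c₁ + e₁ * -(1 / 2)) = 1 := by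
      refine weightAt_mul_weightAt k1 (hkind1 ▸ k1) ?_ ?_
      · rw [hp1 _ hr' hrr, hp1 _ hl' hll]
        rw [hord 1 _ (hm2 _ hr') 0 _ (hm1 _ hr') (by decide),
          hord 1 _ (hm2 _ hl') 0 _ (hm1 _ hl') (by decide)]
      · rw [hp1 _ hr' hrr, hp1 _ hl' hll, hsign', neg_neg]
    have hcov : ∀ i, ∀ t ∈ strand (c i), D'.kind t = .under →
        t = c₁ + e₁ * (1 / 2) ∨ t = c₁ + e₁ * -(1 / 2) := by
      refine hall _ (fun t h h' => ?_) (fun _ => Or.inl rfl) (fun _ => Or.inr rfl) (fun h => ?_)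
        fun h => ?_
      · rw [h] at h'; cases h'
      · rw [k2] at h; cases h
      · rw [k4] at h; cases h
    have hnv : ∀ i, ∀ t ∈ strand (c i), D'.kind t ≠ .virt :=
      hall _ (fun t h => by simp [h]) (by rw [k1]; simp) (by rw [← hkind1, k1]; simp) (by rw [k2]; simp)
        (by rw [k4]; simp)
    have hpr := hp1 _ hr' hrr
    have hpl := hp1 _ hl' hll
    rcases he1 with h2 | h2
    · exact reducedZeta_eq_of_two_under hSD' hO' (i := 0) (i' := 1) (by decide)
        (v₀ := c₁ + e₁ * -(1 / 2)) (v₁ := c₁ + e₁ * (1 / 2)) (hint1 _ hl).1 (by rw [h2]; linarith)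
        (hint1 _ hr).2 (by rw [hpl]; exact ⟨(hint2 _ hl).1, (hint2 _ hl).2.le⟩)
        (by rw [hpr]; exact ⟨(hint2 _ hr).1, (hint2 _ hr).2.le⟩)
        (fun k t ht hk => (hcov k t ht hk).symm) hnv (by rw [mul_comm, hw])
    · exact reducedZeta_eq_of_two_under hSD' hO' (i := 0) (i' := 1) (by decide)
        (v₀ := c₁ + e₁ * (1 / 2)) (v₁ := c₁ + e₁ * -(1 / 2)) (hint1 _ hr).1 (by rw [h2]; linarith)
        (hint1 _ hl).2 (by rw [hpr]; exact ⟨(hint2 _ hr).1, (hint2 _ hr).2.le⟩)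
        (by rw [hpl]; exact ⟨(hint2 _ hl).1, (hint2 _ hl).2.le⟩)
        hcov hnv hw
  · exact reducedZeta_eq_of_no_under hSD' hO' (hall _ (fun t h => by simp [h]) (by rw [k1]; simp)
      (by rw [← hkind1, k1]; simp) (by rw [k2]; simp) (by rw [k4]; simp))

end MoveTwo

end LongDiagram

namespace LongDiagram

/-! ### The third move -/

section Triangle

/-- The rank of the slopes of the three strands of a triangle. -/
def slopeRank : Fin 3 → ℕ := ![2, 0, 1]

theorem slopeRank_injective : Function.Injective slopeRank := by decide

/-- The sign of the difference of the slopes of two strands. -/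
def slopeSign (i j : Fin 3) : ℤ := if slopeRank i < slopeRank j then 1 else -1

theorem slopeSign_swap {i j : Fin 3} (h : i ≠ j) : slopeSign j i = -slopeSign i j := by
  revert i j
  decide

open Classical in
/-- The direction of a strand as an integer. -/
def dirSign (e : ℝ) : ℤ := if e = 1 then 1 else -1

theorem dirSign_one : dirSign 1 = 1 := if_pos rfl

theorem dirSign_neg_one : dirSign (-1) = -1 := if_neg (by norm_num)

/-- Three strands in the square, which are graphs of functions `Y i` run in the directions `e i` and
meet at the points with the first coordinates `X i j`. -/
structure TrianglePicture (D : LongDiagram) (c e : Fin 3 → ℝ) (Y : Fin 3 → ℝ → ℝ)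
    (X : Fin 3 → Fin 3 → ℝ) : Prop where
  disjoint : ∀ i j, i ≠ j → 2 < |c i - c j|
  dir : ∀ i, e i = 1 ∨ e i = -1
  outside : ∀ t, (∀ i, t ∉ strand (c i)) → D.curve t ∉ square
  curve_eq : ∀ i, ∀ x ∈ Set.Icc (-1 : ℝ) 1, D.curve (c i + e i * x) = (x, Y i x)
  bound : ∀ i, ∀ x ∈ Set.Icc (-1 : ℝ) 1, |Y i x| ≤ 1
  symm : ∀ i j, X i j = X j i
  mem : ∀ i j, X i j ∈ Set.Ioo (-1 : ℝ) 1
  meet : ∀ i j, i ≠ j → ∀ x ∈ Set.Icc (-1 : ℝ) 1, Y i x = Y j x ↔ x = X i j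
  slope : ∃ Y' : Fin 3 → ℝ → ℝ, ∀ x ∈ Set.Ioo (-1 : ℝ) 1, (∀ i, HasDerivAt (Y i) (Y' i x) x) ∧
    ∀ i j, slopeRank i < slopeRank j → Y' i x < Y' j x

/-- The time at which the strand `i` meets the strand `j`. -/
def meetTime (c e : Fin 3 → ℝ) (X : Fin 3 → Fin 3 → ℝ) (i j : Fin 3) : ℝ := c i + e i * X i j

namespace TrianglePicture

variable {D D' : LongDiagram} {c e : Fin 3 → ℝ} {Y : Fin 3 → ℝ → ℝ} {X : Fin 3 → Fin 3 → ℝ}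

theorem meetTime_interior (h : TrianglePicture D c e Y X) (i j : Fin 3) :
    c i - 1 < meetTime c e X i j ∧ meetTime c e X i j < c i + 1 :=
  mem_strand_interior (h.dir i) (h.mem i j)

theorem meetTime_mem (h : TrianglePicture D c e Y X) (i j : Fin 3) :
    meetTime c e X i j ∈ strand (c i) :=
  mem_strand.2 ⟨(h.meetTime_interior i j).1.le, (h.meetTime_interior i j).2.le⟩

theorem inside (h : TrianglePicture D c e Y X) (i : Fin 3) (t : ℝ) (ht : t ∈ strand (c i)) :
    D.curve t ∈ square := by
  obtain ⟨x, hx, rfl⟩ := (mem_strand_iff_exists (h.dir i)).1 ht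
  rw [h.curve_eq i x hx]
  exact ⟨abs_le.2 hx, h.bound i x hx⟩

theorem exists_meetTime (h : TrianglePicture D c e Y X) {i : Fin 3} {t : ℝ} (ht : t ∈ strand (c i))
    (hk : D.kind t ≠ .regular) : ∃ j, i ≠ j ∧ t = meetTime c e X i j := by
  by_contra! hcon
  refine hk (kind_eq_regular (c := c) (h.inside i t ht) h.outside fun j s hs he => ?_)
  obtain ⟨x, hx, rfl⟩ := (mem_strand_iff_exists (h.dir i)).1 ht
  obtain ⟨y, hy, rfl⟩ := (mem_strand_iff_exists (h.dir j)).1 hs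
  rw [h.curve_eq i x hx, h.curve_eq j y hy] at he
  have e1 : y = x := (Prod.ext_iff.1 he).1
  subst e1
  by_cases hij : i = j
  · rw [hij]
  · have e2 : Y i y = Y j y := (Prod.ext_iff.1 he).2.symm
    exact absurd (by rw [(h.meet i j hij y hx).1 e2]; rfl) (hcon j hij)

theorem strandsInSquare (h : TrianglePicture D c e Y X) : StrandsInSquare D c where
  disjoint := h.disjoint
  inside := h.inside
  outside := h.outside
  left_regular i := by
    by_contra hk
    obtain ⟨j, -, hj⟩ := h.exists_meetTime (mem_strand.2 ⟨le_rfl, by linarith⟩) hk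
    exact (h.meetTime_interior i j).1.ne hj
  right_regular i := by
    by_contra hk
    obtain ⟨j, -, hj⟩ := h.exists_meetTime (mem_strand.2 ⟨by linarith, le_rfl⟩) hk
    exact (h.meetTime_interior i j).2.ne hj.symm

theorem curve_meetTime (h : TrianglePicture D c e Y X) {i j : Fin 3} (hij : i ≠ j) :
    D.curve (meetTime c e X i j) = D.curve (meetTime c e X j i) := by
  have hx := Set.Ioo_subset_Icc_self (h.mem i j)
  have hx' := Set.Ioo_subset_Icc_self (h.mem j i)
  rw [meetTime, meetTime, h.curve_eq i _ hx, h.curve_eq j _ hx', h.symm j i,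
    (h.meet i j hij _ hx).2 rfl]

theorem meetTime_ne (h : TrianglePicture D c e Y X) {i j : Fin 3} (hij : i ≠ j) :
    meetTime c e X i j ≠ meetTime c e X j i := fun h' =>
  hij (h.strandsInSquare.eq_of_mem (h.meetTime_mem i j) (h' ▸ h.meetTime_mem j i))

theorem partner_meetTime (h : TrianglePicture D c e Y X) {i j : Fin 3} (hij : i ≠ j) :
    D.partner (meetTime c e X i j) = meetTime c e X j i :=
  LongDiagram.partner_eq (h.meetTime_ne hij.symm) (h.curve_meetTime hij.symm)

/-- The tangent vectors are `(e i, e i * Y' i)`, so the area is `e i * e j` times the difference of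
the slopes. The sign does not depend on the position of the crossing. -/
theorem areaSign_meetTime (h : TrianglePicture D c e Y X) {i j : Fin 3} (hij : i ≠ j) :
    areaSign (deriv D.curve (meetTime c e X i j)) (deriv D.curve (meetTime c e X j i)) =
      dirSign (e i) * dirSign (e j) * slopeSign i j := by
  obtain ⟨Y', hY⟩ := h.slope
  have h1 := hY _ (h.mem i j)
  have h2 := h1.2
  rw [meetTime, meetTime, h.symm j i,
    deriv_strand (h.dir i) (h.curve_eq i) (h.mem i j) (h1.1 i),
    deriv_strand (h.dir j) (h.curve_eq j) (h.mem i j) (h1.1 j)]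
  have hr : slopeRank i ≠ slopeRank j := fun h => hij (slopeRank_injective h)
  unfold areaSign orientedArea slopeSign
  rcases lt_or_gt_of_ne hr with hlt | hlt
  · have h3 := h2 i j hlt
    rw [if_pos hlt]
    rcases h.dir i with hi | hi <;> rcases h.dir j with hj | hj <;>
      simp only [hi, hj, dirSign_one, dirSign_neg_one] <;>
      first | (rw [if_pos (by linarith)]; rfl) | (rw [if_neg (by linarith)]; rfl)
  · have h3 := h2 j i hlt
    rw [if_neg (not_lt.2 hlt.le)]
    rcases h.dir i with hi | hi <;> rcases h.dir j with hj | hj <;>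
      simp only [hi, hj, dirSign_one, dirSign_neg_one] <;>
      first | (rw [if_pos (by linarith)]; rfl) | (rw [if_neg (by linarith)]; rfl)

/-- The order in which a strand meets the other two is expressed by the same direction and slope
signs as the signs of the crossings, which makes the two comparable. -/
theorem meetTime_lt_iff (h : TrianglePicture D c e Y X)
    (hX : ∀ i j k, i ≠ j → j ≠ k → i ≠ k → (X k i < X k j ↔ slopeRank i < slopeRank j))
    {i j k : Fin 3} (hij : i ≠ j) (hjk : j ≠ k) (hik : i ≠ k) :
    meetTime c e X k i < meetTime c e X k j ↔ dirSign (e k) * slopeSign i j = 1 := by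
  have h1 := hX i j k hij hjk hik
  have h2 := hX j i k hij.symm hik hjk
  have hr : slopeRank i ≠ slopeRank j := fun h => hij (slopeRank_injective h)
  unfold meetTime slopeSign
  rcases h.dir k with hk | hk
  · rw [hk, dirSign_one, one_mul, one_mul, one_mul, add_lt_add_iff_left, h1]
    split_ifs with h3
    · simp [h3]
    · simp [h3]
  · rw [hk, dirSign_neg_one, neg_one_mul, neg_one_mul, neg_one_mul, add_lt_add_iff_left,
      neg_lt_neg_iff, h2]
    split_ifs with h3
    · simp [h3.le]
    · simp only [neg_neg, iff_true]
      omega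

end TrianglePicture

variable {D D' : LongDiagram} {c e : Fin 3 → ℝ} {Y Y₂ : Fin 3 → ℝ → ℝ} {X : Fin 3 → Fin 3 → ℝ}

/-- Two triangles with the same crossings, met by each strand in opposite orders. -/
structure OppositeTriangles (D D' : LongDiagram) (c e : Fin 3 → ℝ) (Y Y₂ : Fin 3 → ℝ → ℝ)
    (X : Fin 3 → Fin 3 → ℝ) : Prop where
  left : TrianglePicture D c e Y X
  right : TrianglePicture D' c e Y₂ (fun i j => -X i j)
  same : ∀ t, (∀ i, t ∉ strand (c i)) → D'.curve t = D.curve t ∧ D'.kind t = D.kind t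
  kind_eq : ∀ i, ∀ t ∈ strand (c i), D'.kind t = D.kind (2 * c i - t)
  order : ∀ i j k, i ≠ j → j ≠ k → i ≠ k → (X k i < X k j ↔ slopeRank i < slopeRank j)

namespace OppositeTriangles

/-- The half turn reflects abscissas, hence the times of each strand about its centre. -/
theorem meetTime_neg (i j : Fin 3) :
    meetTime c e (fun i j => -X i j) i j = 2 * c i - meetTime c e X i j := by
  unfold meetTime
  ring

theorem kind_meetTime (h : OppositeTriangles D D' c e Y Y₂ X) (i j : Fin 3) :
    D'.kind (meetTime c e (fun i j => -X i j) i j) = D.kind (meetTime c e X i j) := by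
  rw [h.kind_eq i _ (h.right.meetTime_mem i j), meetTime_neg]
  congr 1
  ring

theorem stepAt_eq (h : OppositeTriangles D D' c e Y Y₂ X) {i : Fin 3} {t : ℝ}
    (ht : t ∈ strand (c i)) : D'.stepAt t = D.stepAt (2 * c i - t) := by
  by_cases hk : D'.kind t = .virt
  · obtain ⟨j, hij, rfl⟩ := h.right.exists_meetTime ht (by rw [hk]; simp)
    have e1 : 2 * c i - meetTime c e (fun i j => -X i j) i j = meetTime c e X i j := by
      rw [meetTime_neg]
      ring
    have hk' : D.kind (meetTime c e X i j) = .virt := by rw [← h.kind_meetTime, hk]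
    rw [e1, stepAt, stepAt, if_pos hk, if_pos hk', h.right.partner_meetTime hij,
      h.left.partner_meetTime hij, h.right.areaSign_meetTime hij, h.left.areaSign_meetTime hij]
  · have hk' := hk
    rw [h.kind_eq i t ht] at hk'
    rw [stepAt_of_ne hk, stepAt_of_ne hk']

/-- The reflection of time about the centre of a strand permutes its steps and preserves their
values. -/
theorem localChange (h : OppositeTriangles D D' c e Y Y₂ X) : LocalChange D D' c where
  left := h.left.strandsInSquare
  right := h.right.strandsInSquare
  same := h.same
  sum_step i := by
    rw [← finsum_comp_equiv (Equiv.subLeft (2 * c i))]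
    congr 1
    funext x
    have hiff : (Equiv.subLeft (2 * c i)) x ∈ strand (c i) ↔ x ∈ strand (c i) := by
      rw [Equiv.subLeft_apply, mem_strand, mem_strand]
      constructor <;> rintro ⟨h1, h2⟩ <;> constructor <;> linarith
    by_cases hx : x ∈ strand (c i)
    · rw [Set.indicator_of_mem hx, Set.indicator_of_mem (hiff.2 hx),
        h.stepAt_eq (hiff.2 hx), Equiv.subLeft_apply, sub_sub_cancel]
    · rw [Set.indicator_of_notMem hx, Set.indicator_of_notMem fun h' => hx (hiff.1 h')]

/-- Type and sign of the crossing and the time order of the two strands survive the half turn. -/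
theorem weightAt_meetTime (h : OppositeTriangles D D' c e Y Y₂ X) {i j : Fin 3} (hij : i ≠ j) :
    D'.weightAt (meetTime c e (fun i j => -X i j) i j) = D.weightAt (meetTime c e X i j) := by
  unfold weightAt
  rw [h.kind_meetTime, h.left.partner_meetTime hij, h.right.partner_meetTime hij,
    h.right.areaSign_meetTime hij.symm, h.left.areaSign_meetTime hij.symm]
  have h1 := h.left.strandsInSquare.lt_iff hij.symm (h.left.meetTime_mem j i)
    (h.left.meetTime_mem i j)
  have h2 := h.right.strandsInSquare.lt_iff hij.symm (h.right.meetTime_mem j i)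
    (h.right.meetTime_mem i j)
  simp only [h1, h2]

theorem meetTime_lt_iff (h : OppositeTriangles D D' c e Y Y₂ X) {i j k : Fin 3} (hij : i ≠ j)
    (hjk : j ≠ k) (hik : i ≠ k) :
    meetTime c e (fun i j => -X i j) k i < meetTime c e (fun i j => -X i j) k j ↔
      ¬ meetTime c e X k i < meetTime c e X k j := by
  rw [meetTime_neg, meetTime_neg, sub_lt_sub_iff_left, h.left.meetTime_lt_iff h.order hij hjk hik,
    h.left.meetTime_lt_iff h.order hij.symm hik hjk, slopeSign_swap hij]
  unfold dirSign slopeSign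
  split_ifs <;> norm_num

end OppositeTriangles

end Triangle

end LongDiagram

namespace LongDiagram

/-! ### Identities in the coefficient ring -/

section Weights

theorem relation_p : (pPow 1 - 1) * (pPow 1 - qPow 1) = 0 := by
  unfold pPow qPow
  rw [← map_one toCoeffRing, ← map_sub, ← map_sub, ← map_mul]
  exact Ideal.Quotient.eq_zero_iff_mem.2 (Ideal.subset_span (by simp))

theorem relation_q : (qPow 1 - 1) * (pPow 1 - qPow 1) = 0 := by
  unfold pPow qPow
  rw [← map_one toCoeffRing, ← map_sub, ← map_sub, ← map_mul]
  exact Ideal.Quotient.eq_zero_iff_mem.2 (Ideal.subset_span (by simp))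

theorem pPow_mul_neg (s : ℤ) : pPow s * pPow (-s) = 1 := by
  rw [← pPow_add, add_neg_cancel, pPow_zero]

theorem qPow_mul_neg (s : ℤ) : qPow s * qPow (-s) = 1 := by
  rw [← qPow_add, add_neg_cancel, qPow_zero]

/-- For `t = p` or `t = q` and exponent `1` or `-1`, the element `1 - w` is a unit times `t - 1`,
which annihilates `p - q`. -/
theorem one_sub_mul_sub {w : CoeffRing} {s : ℤ} (hs : s = 1 ∨ s = -1)
    (hw : w = pPow s ∨ w = qPow s) : (1 - w) * (pPow 1 - qPow 1) = 0 := by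
  have hp := relation_p
  have hq := relation_q
  have hpp := pPow_mul_neg 1
  have hqq := qPow_mul_neg 1
  rcases hs with rfl | rfl <;> rcases hw with rfl | rfl
  · linear_combination -hp
  · linear_combination -hq
  · linear_combination pPow (-1) * hp - (pPow 1 - qPow 1) * hpp
  · linear_combination qPow (-1) * hq - (pPow 1 - qPow 1) * hqq

/-- For `s = -1` the difference of the inverses of `p` and `q` is a unit multiple of `p - q`. -/
theorem one_sub_mul_pPow_sub_qPow {w : CoeffRing} {s' : ℤ} (s : ℤ) (hs : s = 1 ∨ s = -1)
    (hs' : s' = 1 ∨ s' = -1) (hw : w = pPow s' ∨ w = qPow s') :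
    (1 - w) * (pPow s - qPow s) = 0 := by
  have h := one_sub_mul_sub hs' hw
  have hpp := pPow_mul_neg 1
  have hqq := qPow_mul_neg 1
  rcases hs with rfl | rfl
  · exact h
  · linear_combination (-(pPow (-1) * qPow (-1))) * h + (1 - w) * qPow (-1) * hpp -
      (1 - w) * pPow (-1) * hqq

/-- Two weights with the same exponent are equal or differ by `±(p ^ s - q ^ s)`. -/
theorem one_sub_mul_sub_eq_zero {w w₃ w' : CoeffRing} {s s' : ℤ} (hs : s = 1 ∨ s = -1)
    (hs' : s' = 1 ∨ s' = -1) (hw : w = pPow s ∨ w = qPow s) (hw₃ : w₃ = pPow s ∨ w₃ = qPow s)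
    (hw' : w' = pPow s' ∨ w' = qPow s') : (1 - w') * (w - w₃) = 0 := by
  have h := one_sub_mul_pPow_sub_qPow s hs hs' hw'
  rcases hw with rfl | rfl <;> rcases hw₃ with rfl | rfl
  · ring
  · exact h
  · linear_combination -h
  · ring

/-- With opposite exponents, `w * w₃` is `1`, or `1 - w * w₃` is a unit times `p ^ s - q ^ s`. -/
theorem one_sub_mul_one_sub_mul_eq_zero {w w₃ w' : CoeffRing} {s s' : ℤ} (hs : s = 1 ∨ s = -1)
    (hs' : s' = 1 ∨ s' = -1) (hw : w = pPow s ∨ w = qPow s)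
    (hw₃ : w₃ = pPow (-s) ∨ w₃ = qPow (-s)) (hw' : w' = pPow s' ∨ w' = qPow s') :
    (1 - w') * (1 - w * w₃) = 0 := by
  have h := one_sub_mul_pPow_sub_qPow s hs hs' hw'
  have hpp := pPow_mul_neg s
  have hqq := qPow_mul_neg s
  rcases hw with rfl | rfl <;> rcases hw₃ with rfl | rfl
  · linear_combination (-(1 - w')) * hpp
  · linear_combination (-qPow (-s)) * h - (1 - w') * hqq
  · linear_combination pPow (-s) * h - (1 - w') * hpp
  · linear_combination (-(1 - w')) * hqq

theorem weightAt_eq_pPow_or_qPow {D : LongDiagram} {t : ℝ} (h : D.kind t = .under) :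
    D.weightAt t = pPow (areaSign (deriv D.curve (D.partner t)) (deriv D.curve t)) ∨
      D.weightAt t = qPow (areaSign (deriv D.curve (D.partner t)) (deriv D.curve t)) := by
  rw [weightAt, if_pos h]
  split_ifs
  · exact Or.inl rfl
  · exact Or.inr rfl

end Weights

/-! ### Elimination with one or three underpasses in the square -/

section InnerCuts

variable {D D' : LongDiagram} {m : ℕ} {c : Fin m → ℝ} {O : Set ℝ} [Fintype O] [Nonempty O]

open Classical in
/-- A diagram with a single underpass in the square. -/
theorem reducedZeta_eq_of_one_under (hD : StrandsInSquare D c)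
    (hO : ∀ t, t ∈ O ↔ IsOuterCut D c t) {i i' : Fin m} (hii : i ≠ i') {v : ℝ}
    (hv1 : c i - 1 < v) (hv2 : v < c i + 1)
    (hp : c i' - 1 < D.partner v ∧ D.partner v ≤ c i' + 1)
    (hcover : ∀ k, ∀ t ∈ strand (c k), D.kind t = .under → t = v) :
    D.reducedZeta = (outerMatrix D c (O := O) fun k => if k = i then
      LaurentPolynomial.C (D.weightAt v) • Pi.single (entry hO i) 1 +
        D.overCoeff v • Pi.single (entry hO i') 1 else Pi.single (entry hO k) 1).det := by
  have hin : ∀ _ : Unit, ∃ i, c i - 1 < v ∧ v < c i + 1 := fun _ => ⟨i, hv1, hv2⟩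
  have huinj : Function.Injective (fun _ : Unit => v) := fun _ _ _ => rfl
  rw [reducedZeta_eq_det_outerMatrix (O := O) (u := fun _ : Unit => v) hD hO huinj hin
    (fun k t ht hk => ⟨(), (hcover k t ht hk).symm⟩)
    (fun _ => .inl (entry hO i)) (fun _ => .inl (entry hO i'))
    (fun k => if k = i then .inr () else .inl (entry hO k))
    (fun _ => cyclicPred_entry hD hO huinj hin (i := i) hv1 hv2.le fun _ _ => le_rfl)
    (fun _ => cyclicPred_entry hD hO huinj hin (i := i') hp.1 hp.2 fun _ h =>
      hp.2.trans (not_mem_of_lt hD hii.symm hv1 hv2 h))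
    (fun k => by
      by_cases hk : k = i
      · subst hk
        rw [if_pos rfl]
        exact cyclicPred_inner hD hO huinj hin (i := k) (j := ()) hv1 hv2 le_rfl
          fun j hj => absurd hj (lt_irrefl _)
      · rw [if_neg hk]
        exact cyclicPred_entry hD hO huinj hin (by linarith) le_rfl fun _ =>
          not_mem_of_lt hD hk hv1 hv2)
    (fun _ => LaurentPolynomial.C (D.weightAt v) • Pi.single (entry hO i) 1 +
        D.overCoeff v • Pi.single (entry hO i') 1)
    (fun _ => rfl)]
  refine Eq.trans (congrArg₂ (· * ·) ?_ ?_) (one_mul _)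
  · rw [Matrix.det_unique]
    simp
  · congr 2
    funext k
    by_cases hk : k = i
    · subst hk
      simp
    · simp [hk]

open Classical in
/-- A diagram with an underpass `v₀` on the strand `i` and two underpasses `v₁`, `v₂` on the strand
`i'` in the square. Here `z₁`, `z₂` are the cuts preceding the overpasses of the latter two, where
`inr ()` stands for `v₀`. -/
theorem reducedZeta_eq_of_three_under (hD : StrandsInSquare D c)
    (hO : ∀ t, t ∈ O ↔ IsOuterCut D c t) {i i' i'' : Fin m} (hii : i ≠ i') (hi'' : i'' ≠ i)
    (hi''' : i'' ≠ i') {v₀ v₁ v₂ : ℝ}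
    (h0 : c i - 1 < v₀) (h0' : v₀ < c i + 1)
    (h1 : c i' - 1 < v₁) (h12 : v₁ < v₂) (h2 : v₂ < c i' + 1)
    (hp : c i'' - 1 < D.partner v₀ ∧ D.partner v₀ ≤ c i'' + 1)
    (hcover : ∀ k, ∀ t ∈ strand (c k), D.kind t = .under → t = v₀ ∨ t = v₁ ∨ t = v₂)
    (z₁ z₂ : O ⊕ Unit)
    (hz₁ : cyclicPred (Sum.elim (Subtype.val : O → ℝ) ![v₀, v₁, v₂]) (D.partner v₁) =
      z₁.map id fun _ => 0)
    (hz₂ : cyclicPred (Sum.elim (Subtype.val : O → ℝ) ![v₀, v₁, v₂]) (D.partner v₂) =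
      z₂.map id fun _ => 0)
    (V₀ : O → LaurentPolynomial CoeffRing)
    (hV₀ : V₀ = LaurentPolynomial.C (D.weightAt v₀) • Pi.single (entry hO i) 1 +
        D.overCoeff v₀ • Pi.single (entry hO i'') 1) :
    D.reducedZeta = (outerMatrix D c (O := O) fun k =>
      if k = i then V₀
      else if k = i' then
        LaurentPolynomial.C (D.weightAt v₂) •
          (LaurentPolynomial.C (D.weightAt v₁) • Pi.single (entry hO i') 1 +
            D.overCoeff v₁ • z₁.elim (fun k => Pi.single k 1) (fun _ => V₀)) +
          D.overCoeff v₂ • z₂.elim (fun k => Pi.single k 1) (fun _ => V₀)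
      else Pi.single (entry hO k) 1).det := by
  set v : Fin 3 → ℝ := ![v₀, v₁, v₂] with hv
  have hin0 : ∀ k, k ≠ i → c k - 1 < v₀ → c k + 1 ≤ v₀ := fun k hk => not_mem_of_lt hD hk h0 h0'
  have hin1 : ∀ k, k ≠ i' → c k - 1 < v₁ → c k + 1 ≤ v₁ := fun k hk =>
    not_mem_of_lt hD hk h1 (h12.trans h2)
  have hin2 : ∀ k, k ≠ i' → c k - 1 < v₂ → c k + 1 ≤ v₂ := fun k hk =>
    not_mem_of_lt hD hk (h1.trans h12) h2
  have hin : ∀ j, ∃ i, c i - 1 < v j ∧ v j < c i + 1 := by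
    intro j
    fin_cases j
    · exact ⟨i, h0, h0'⟩
    · exact ⟨i', h1, h12.trans h2⟩
    · exact ⟨i', h1.trans h12, h2⟩
  have hne1 : v₀ ≠ v₁ := fun h => hii (hD.eq_of_mem (mem_strand.2 ⟨h0.le, h0'.le⟩)
    (h ▸ mem_strand.2 ⟨h1.le, (h12.trans h2).le⟩))
  have hne2 : v₀ ≠ v₂ := fun h => hii (hD.eq_of_mem (mem_strand.2 ⟨h0.le, h0'.le⟩)
    (h ▸ mem_strand.2 ⟨(h1.trans h12).le, h2.le⟩))
  have hne3 : v₁ ≠ v₂ := h12.ne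
  have huinj : Function.Injective v := by
    intro j j' h
    fin_cases j <;> fin_cases j' <;>
      first | rfl | exact absurd h hne1 | exact absurd h hne2 | exact absurd h hne3 |
        exact absurd h.symm hne1 | exact absurd h.symm hne2 | exact absurd h.symm hne3
  have hsub : ∀ {i : Fin m} {t : ℝ}, (c i - 1 < v₀ → t ≤ v₀) → (c i - 1 < v₁ → t ≤ v₁) →
      (c i - 1 < v₂ → t ≤ v₂) → ∀ j, c i - 1 < v j → t ≤ v j := by
    intro i t a0 a1 a2 j
    fin_cases j
    · exact a0
    · exact a1
    · exact a2
  have hsub' : ∀ {x : ℝ} {t : ℝ}, (x < v₀ → t ≤ v₀) → (x < v₁ → t ≤ v₁) →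
      (x < v₂ → t ≤ v₂) → ∀ j, x < v j → t ≤ v j := by
    intro i t a0 a1 a2 j
    fin_cases j
    · exact a0
    · exact a1
    · exact a2
  -- The cut `v₀` on the strand `i` lies wholly before or wholly after the strand `i'`, so it never
  -- separates times of the latter.
  have hv0i' : v₀ ≤ c i' - 1 ∨ c i' + 1 ≤ v₀ := hD.le_or_le hii (mem_strand.2 ⟨h0.le, h0'.le⟩)
  have hmono : ∀ {x t : ℝ}, c i' - 1 ≤ x → t ≤ c i' + 1 → x < v₀ → t ≤ v₀ := by
    intro x t hx ht h
    rcases hv0i' with h' | h' <;> linarith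
  rw [reducedZeta_eq_det_outerMatrix (O := O) (u := v) hD hO huinj hin
    (fun k t ht hk => by
      rcases hcover k t ht hk with h | h | h
      · exact ⟨0, h.symm⟩
      · exact ⟨1, h.symm⟩
      · exact ⟨2, h.symm⟩)
    ![.inl (entry hO i), .inl (entry hO i'), .inr 1]
    ![.inl (entry hO i''), z₁.map id fun _ => 0, z₂.map id fun _ => 0]
    (fun k => if k = i then .inr 0 else if k = i' then .inr 2 else .inl (entry hO k))
    (by
      intro j
      fin_cases j
      · exact cyclicPred_entry hD hO huinj hin (i := i) h0 h0'.le (hsub (fun _ => le_rfl)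
          (fun h => h0'.le.trans (hin1 i hii h)) fun h => h0'.le.trans (hin2 i hii h))
      · exact cyclicPred_entry hD hO huinj hin (i := i') h1 (h12.trans h2).le
          (hsub (hmono le_rfl (h12.trans h2).le) (fun _ => le_rfl) fun _ => h12.le)
      · exact cyclicPred_inner hD hO huinj hin (i := i') (j := 1) h1 h12 h2.le
          (hsub' (hmono h1.le h2.le) (fun h => absurd h (lt_irrefl _)) fun _ => le_rfl))
    (by
      intro j
      fin_cases j
      · exact cyclicPred_entry hD hO huinj hin (i := i'') hp.1 hp.2
          (hsub (fun h => hp.2.trans (hin0 i'' hi'' h)) (fun h => hp.2.trans (hin1 i'' hi''' h))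
            fun h => hp.2.trans (hin2 i'' hi''' h))
      · exact hz₁
      · exact hz₂)
    (fun k => by
      by_cases hk : k = i
      · subst hk
        rw [if_pos rfl]
        exact cyclicPred_inner hD hO huinj hin (i := k) (j := 0) h0 h0' le_rfl
          (hsub' (fun h => absurd h (lt_irrefl _)) (fun h => hin1 k hii (h0.trans h))
            fun h => hin2 k hii (h0.trans h))
      · by_cases hk' : k = i'
        · subst hk'
          rw [if_neg hk, if_pos rfl]
          exact cyclicPred_inner hD hO huinj hin (i := k) (j := 2) (h1.trans h12) h2 le_rfl
            (hsub' (hmono (h1.trans h12).le le_rfl) (fun h => absurd h12 h.not_gt)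
              fun h => absurd h (lt_irrefl _))
        · rw [if_neg hk, if_neg hk']
          exact cyclicPred_entry hD hO huinj hin (by linarith) le_rfl
            (hsub (hin0 k hk) (hin1 k hk') (hin2 k hk')))
    ![V₀, LaurentPolynomial.C (D.weightAt v₁) • Pi.single (entry hO i') 1 +
            D.overCoeff v₁ • z₁.elim (fun k => Pi.single k 1) (fun _ => V₀),
      LaurentPolynomial.C (D.weightAt v₂) •
          (LaurentPolynomial.C (D.weightAt v₁) • Pi.single (entry hO i') 1 +
            D.overCoeff v₁ • z₁.elim (fun k => Pi.single k 1) (fun _ => V₀)) +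
          D.overCoeff v₂ • z₂.elim (fun k => Pi.single k 1) (fun _ => V₀)]
    (by
      intro j
      fin_cases j
      · exact hV₀
      · rcases z₁ with z₁ | z₁ <;> rfl
      · rcases z₂ with z₂ | z₂ <;> rfl)]
  refine Eq.trans (congrArg₂ (· * ·) ?_ ?_) (one_mul _)
  -- In the order `v₀`, `v₁`, `v₂` each generator is expressed through earlier ones, so the inner
  -- block is unitriangular.
  · rw [Matrix.det_fin_three]
    rcases z₁ with z₁ | z₁ <;> rcases z₂ with z₂ | z₂ <;> simp
  · congr 2
    funext k
    by_cases hk : k = i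
    · subst hk
      simp
    · by_cases hk' : k = i'
      · subst hk'
        simp [hk]
      · simp [hk, hk']

end InnerCuts

end LongDiagram

namespace LongDiagram

/-! ### Triangles of classical crossings -/

section ThirdMove

theorem eq_or_eq_or_eq_of_ne {T M B : Fin 3} (hTM : T ≠ M) (hMB : M ≠ B) (hTB : T ≠ B)
    (k : Fin 3) : k = T ∨ k = M ∨ k = B := by
  revert T M B k
  decide

theorem dirSign_eq_or (e : ℝ) : dirSign e = 1 ∨ dirSign e = -1 := by
  unfold dirSign
  split_ifs
  · exact Or.inl rfl
  · exact Or.inr rfl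

theorem slopeSign_eq_or (i j : Fin 3) : slopeSign i j = 1 ∨ slopeSign i j = -1 := by
  unfold slopeSign
  split_ifs
  · exact Or.inl rfl
  · exact Or.inr rfl

/-- Here `x`, `y`, `z` stand for the entries of the lowest, middle and top strands; `w` and `w'` are
the weights of the lowest strand under the top and the middle one, `w₃` that of the middle under the
top. On the left the lowest strand meets the top one first, and the middle strand goes under before
it goes over; on the right both orders are reversed. -/
theorem triangle_rows_same {A O : Type*} [CommRing A] (x y z : O → A) {w w' w₃ a b : A}
    (h : (1 - w') * (w - w₃) = 0) :
    w' • (w • x + ((1 - w) * (a * b)) • z) +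
        ((1 - w') * a) • (w₃ • y + ((1 - w₃) * b) • z) =
      w • (w' • x + ((1 - w') * a) • y) + ((1 - w) * (a * b)) • z := by
  funext k
  simp only [Pi.add_apply, Pi.smul_apply, smul_eq_mul]
  linear_combination (a * b * z k - a * y k) * h

/-- The same with the other order on the middle strand: on the left it goes over first, on the right
it goes under first. -/
theorem triangle_rows_opposite {A O : Type*} [CommRing A] (x y z : O → A) {w w' w₃ a b : A}
    (h : (1 - w') * (1 - w * w₃) = 0) :
    w' • (w • x + ((1 - w) * (a * b)) • z) + ((1 - w') * a) • y =
      w • (w' • x + ((1 - w') * a) • (w₃ • y + ((1 - w₃) * b) • z)) +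
        ((1 - w) * (a * b)) • z := by
  funext k
  simp only [Pi.add_apply, Pi.smul_apply, smul_eq_mul]
  linear_combination (a * y k - a * b * z k) * h

variable {D D' : LongDiagram} {c e : Fin 3 → ℝ} {Y Y₂ : Fin 3 → ℝ → ℝ} {X : Fin 3 → Fin 3 → ℝ}
  {O : Set ℝ} [Fintype O] [Nonempty O]

open Classical in
/-- The ζ-polynomial of a diagram with a triangle of classical crossings: the strand `T` is above
`M`, and `M` is above `B`. -/
theorem TrianglePicture.reducedZeta_eq (h : TrianglePicture D c e Y X)
    (hO : ∀ t, t ∈ O ↔ IsOuterCut D c t) {T M B : Fin 3} (hTM : T ≠ M) (hMB : M ≠ B) (hTB : T ≠ B)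
    (kMT : D.kind (meetTime c e X M T) = .under) (kBT : D.kind (meetTime c e X B T) = .under)
    (kBM : D.kind (meetTime c e X B M) = .under) (hne : meetTime c e X B T ≠ meetTime c e X B M)
    (V P : O → LaurentPolynomial CoeffRing)
    (hV : V = LaurentPolynomial.C (D.weightAt (meetTime c e X M T)) • Pi.single (entry hO M) 1 +
        D.overCoeff (meetTime c e X M T) • Pi.single (entry hO T) 1)
    (hP : P = if meetTime c e X M T < meetTime c e X M B then V else Pi.single (entry hO M) 1) :
    D.reducedZeta = (outerMatrix D c (O := O) fun k =>
      if k = M then V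
      else if k = B then
        if meetTime c e X B T < meetTime c e X B M then
          LaurentPolynomial.C (D.weightAt (meetTime c e X B M)) •
            (LaurentPolynomial.C (D.weightAt (meetTime c e X B T)) • Pi.single (entry hO B) 1 +
              D.overCoeff (meetTime c e X B T) • Pi.single (entry hO T) 1) +
            D.overCoeff (meetTime c e X B M) • P
        else
          LaurentPolynomial.C (D.weightAt (meetTime c e X B T)) •
            (LaurentPolynomial.C (D.weightAt (meetTime c e X B M)) • Pi.single (entry hO B) 1 +
              D.overCoeff (meetTime c e X B M) • P) +
            D.overCoeff (meetTime c e X B T) • Pi.single (entry hO T) 1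
      else Pi.single (entry hO k) 1).det := by
  have hD := h.strandsInSquare
  have kTM : D.kind (meetTime c e X T M) = .over := by
    rw [← h.partner_meetTime hTM.symm]
    exact kind_partner_of_under kMT
  have kTB : D.kind (meetTime c e X T B) = .over := by
    rw [← h.partner_meetTime hTB.symm]
    exact kind_partner_of_under kBT
  have kMB : D.kind (meetTime c e X M B) = .over := by
    rw [← h.partner_meetTime hMB.symm]
    exact kind_partner_of_under kBM
  have hcover : ∀ k, ∀ t ∈ strand (c k), D.kind t = .under → t = meetTime c e X M T ∨
      t = meetTime c e X B T ∨ t = meetTime c e X B M := by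
    intro k t ht hk
    obtain ⟨j, hkj, rfl⟩ := h.exists_meetTime ht (by rw [hk]; simp)
    rcases eq_or_eq_or_eq_of_ne hTM hMB hTB k with rfl | rfl | rfl <;>
    rcases eq_or_eq_or_eq_of_ne hTM hMB hTB j with rfl | rfl | rfl <;>
      first | exact absurd rfl hkj | exact Or.inl rfl | exact Or.inr (Or.inl rfl) |
        exact Or.inr (Or.inr rfl) | simp_all
  obtain ⟨m1, m2⟩ := h.meetTime_interior M T
  obtain ⟨bt1, bt2⟩ := h.meetTime_interior B T
  obtain ⟨bm1, bm2⟩ := h.meetTime_interior B M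
  -- The arc of `M` passing over `B` starts at the underpass of `M` below `T` if that comes first,
  -- otherwise at the entry.
  set z : O ⊕ Unit := if meetTime c e X M T < meetTime c e X M B then .inr ()
    else .inl (entry hO M) with hz
  have hzP : P = z.elim (fun k => Pi.single k 1) fun _ => V := by
    rw [hP, hz]
    split_ifs <;> rfl
  -- The two underpasses of `B` are left arbitrary so as to serve in both orders.
  have key : ∀ v₁ v₂, c B - 1 < v₁ → v₁ < c B + 1 → c B - 1 < v₂ → v₂ < c B + 1 → v₁ ≠ v₂ →
      cyclicPred (Sum.elim (Subtype.val : O → ℝ) ![meetTime c e X M T, v₁, v₂])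
          (meetTime c e X T B) = .inl (entry hO T) ∧
        cyclicPred (Sum.elim (Subtype.val : O → ℝ) ![meetTime c e X M T, v₁, v₂])
          (meetTime c e X M B) = z.map id fun _ => 0 := by
    intro v₁ v₂ a1 a2 b1 b2 h12
    have hne1 : meetTime c e X M T ≠ v₁ := fun h' => hMB (hD.eq_of_mem
      (mem_strand.2 ⟨m1.le, m2.le⟩) (h' ▸ mem_strand.2 ⟨a1.le, a2.le⟩))
    have hne2 : meetTime c e X M T ≠ v₂ := fun h' => hMB (hD.eq_of_mem
      (mem_strand.2 ⟨m1.le, m2.le⟩) (h' ▸ mem_strand.2 ⟨b1.le, b2.le⟩))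
    have hin : ∀ j, ∃ i, c i - 1 < (![meetTime c e X M T, v₁, v₂] : Fin 3 → ℝ) j ∧
        (![meetTime c e X M T, v₁, v₂] : Fin 3 → ℝ) j < c i + 1 := by
      intro j
      fin_cases j
      · exact ⟨M, m1, m2⟩
      · exact ⟨B, a1, a2⟩
      · exact ⟨B, b1, b2⟩
    have hu : Function.Injective (![meetTime c e X M T, v₁, v₂] : Fin 3 → ℝ) := by
      intro j j' h
      fin_cases j <;> fin_cases j' <;>
        first | rfl | exact absurd h hne1 | exact absurd h hne2 | exact absurd h h12 |
          exact absurd h.symm hne1 | exact absurd h.symm hne2 | exact absurd h.symm h12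
    constructor
    · refine cyclicPred_entry hD hO hu hin (i := T) (h.meetTime_interior T B).1
        (h.meetTime_interior T B).2.le fun j => ?_
      have ht := (h.meetTime_interior T B).2.le
      fin_cases j
      · exact fun h' => ht.trans (not_mem_of_lt hD hTM m1 m2 h')
      · exact fun h' => ht.trans (not_mem_of_lt hD hTB a1 a2 h')
      · exact fun h' => ht.trans (not_mem_of_lt hD hTB b1 b2 h')
    · have ht := (h.meetTime_interior M B).2.le
      by_cases hlt : meetTime c e X M T < meetTime c e X M B
      · rw [hz, if_pos hlt]
        refine cyclicPred_inner hD hO hu hin (i := M) (j := 0) m1 hlt ht fun j => ?_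
        fin_cases j
        · exact fun h' => absurd h' (lt_irrefl _)
        · exact fun h' => ht.trans (not_mem_of_lt hD hMB a1 a2 (m1.trans h'))
        · exact fun h' => ht.trans (not_mem_of_lt hD hMB b1 b2 (m1.trans h'))
      · rw [hz, if_neg hlt]
        refine cyclicPred_entry hD hO hu hin (i := M) (h.meetTime_interior M B).1 ht fun j => ?_
        fin_cases j
        · exact fun _ => not_lt.1 hlt
        · exact fun h' => ht.trans (not_mem_of_lt hD hMB a1 a2 h')
        · exact fun h' => ht.trans (not_mem_of_lt hD hMB b1 b2 h')
  have hp : c T - 1 < D.partner (meetTime c e X M T) ∧ D.partner (meetTime c e X M T) ≤ c T + 1 := by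
    rw [h.partner_meetTime hTM.symm]
    exact ⟨(h.meetTime_interior T M).1, (h.meetTime_interior T M).2.le⟩
  by_cases hlt : meetTime c e X B T < meetTime c e X B M
  · obtain ⟨k1, k2⟩ := key _ _ bt1 bt2 bm1 bm2 hne
    rw [reducedZeta_eq_of_three_under hD hO hMB hTM hTB m1 m2 bt1 hlt bm2 hp hcover
      (.inl (entry hO T)) z (by rw [h.partner_meetTime hTB.symm, k1]; rfl)
      (by rw [h.partner_meetTime hMB.symm, k2]) V hV]
    simp only [if_pos hlt, hzP, Sum.elim_inl]
  · obtain ⟨k1, k2⟩ := key _ _ bm1 bm2 bt1 bt2 hne.symm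
    rw [reducedZeta_eq_of_three_under hD hO hMB hTM hTB m1 m2 bm1
      (lt_of_le_of_ne (not_lt.1 hlt) hne.symm) bt2 hp
      (fun k t ht hk => (hcover k t ht hk).imp id Or.symm)
      z (.inl (entry hO T)) (by rw [h.partner_meetTime hMB.symm, k2])
      (by rw [h.partner_meetTime hTB.symm, k1]; rfl) V hV]
    simp only [if_neg hlt, hzP, Sum.elim_inl]

end ThirdMove
end LongDiagram

namespace LongDiagram

/-! ### Comparison of opposite triangles -/

section ThirdMove

variable {D D' : LongDiagram} {c e : Fin 3 → ℝ} {Y Y₂ : Fin 3 → ℝ → ℝ} {X : Fin 3 → Fin 3 → ℝ}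

namespace TrianglePicture

theorem kind_meetTime_eq_virt_iff (h : TrianglePicture D c e Y X) {i j : Fin 3} (hij : i ≠ j) :
    D.kind (meetTime c e X i j) = .virt ↔ D.kind (meetTime c e X j i) = .virt := by
  rcases D.kind_pair _ _ (h.meetTime_ne hij) (h.curve_meetTime hij) with
    ⟨h1, h2⟩ | ⟨h1, h2⟩ | ⟨h1, h2⟩ <;> simp [h1, h2]

theorem kind_meetTime_ne_regular (h : TrianglePicture D c e Y X) {i j : Fin 3} (hij : i ≠ j) :
    D.kind (meetTime c e X i j) ≠ .regular := by
  rcases D.kind_pair _ _ (h.meetTime_ne hij) (h.curve_meetTime hij) with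
    ⟨h1, -⟩ | ⟨h1, -⟩ | ⟨h1, -⟩ <;> simp [h1]

theorem stepAt_meetTime (h : TrianglePicture D c e Y X) {i j : Fin 3} (hij : i ≠ j)
    (hv : D.kind (meetTime c e X i j) = .virt) :
    D.stepAt (meetTime c e X i j) = dirSign (e i) * dirSign (e j) * slopeSign i j := by
  rw [stepAt, if_pos hv, h.partner_meetTime hij, h.areaSign_meetTime hij]

/-- The level at a classical crossing of the strands `u` and `o` with virtual crossings on the
strand `i`. -/
theorem level_meetTime (h : TrianglePicture D c e Y X) {i u o : Fin 3} (hui : u ≠ i) (huo : u ≠ o)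
    (hio : i ≠ o) :
    D.level (meetTime c e X u o) = D.level (c u - 1) +
      if meetTime c e X u i < meetTime c e X u o then D.stepAt (meetTime c e X u i) else 0 := by
  obtain ⟨h1, h2⟩ := h.meetTime_interior u o
  rw [level_eq_add D h1.le, finsum_eq_single _ (meetTime c e X u i)]
  · congr 1
    by_cases hlt : meetTime c e X u i < meetTime c e X u o
    · rw [if_pos hlt, Set.indicator_of_mem (Set.mem_Ico.2 ⟨(h.meetTime_interior u i).1.le, hlt⟩)]
    · rw [if_neg hlt, Set.indicator_of_notMem fun h' => hlt h'.2]
  -- A nonzero step occurs only at a crossing; the crossing with `o` is the excluded right end of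
  -- the interval, so only the one with `i` is left.
  · intro t ht
    by_contra hne
    obtain ⟨ht1, ht2⟩ := Set.mem_of_indicator_ne_zero hne
    rw [Set.indicator_of_mem (Set.mem_Ico.2 ⟨ht1, ht2⟩)] at hne
    have hk : D.kind t ≠ .regular := fun hk => hne (stepAt_of_ne (by rw [hk]; simp))
    obtain ⟨j, huj, rfl⟩ := h.exists_meetTime
      (mem_strand.2 ⟨ht1, (ht2.trans h2).le⟩) hk
    rcases eq_or_eq_or_eq_of_ne hui hio huo j with rfl | rfl | rfl
    · exact huj rfl
    · exact ht rfl
    · exact lt_irrefl _ ht2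

end TrianglePicture

namespace OppositeTriangles

theorem meetTime_ne (h : OppositeTriangles D D' c e Y Y₂ X) {i j k : Fin 3} (hij : i ≠ j)
    (hjk : j ≠ k) (hik : i ≠ k) : meetTime c e X k i ≠ meetTime c e X k j := by
  have h1 := h.left.meetTime_lt_iff h.order hij hjk hik
  have h2 := h.left.meetTime_lt_iff h.order hij.symm hik hjk
  rw [slopeSign_swap hij] at h2
  rcases dirSign_eq_or (e k) with hd | hd <;> rcases slopeSign_eq_or i j with hs | hs <;>
    rw [hd, hs] at h1 h2 <;>
    first | exact (h1.2 (by decide)).ne | exact (h2.2 (by decide)).ne'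

theorem meetTime_ne' (h : OppositeTriangles D D' c e Y Y₂ X) {i j k : Fin 3} (hij : i ≠ j)
    (hjk : j ≠ k) (hik : i ≠ k) :
    meetTime c e (fun i j => -X i j) k i ≠ meetTime c e (fun i j => -X i j) k j := by
  rw [meetTime_neg, meetTime_neg]
  exact fun h' => h.meetTime_ne hij hjk hik (by linarith)

/-- Only the exit row of the lowest strand `B` changes. The two orders, on `B` and on `M`, agree
exactly if `T` crosses `B` and `M` with equal signs; this selects the identity for the weights that
is needed. -/
theorem reducedZeta_eq_of_classical (h : OppositeTriangles D D' c e Y Y₂ X)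
    {T M B : Fin 3} (hTM : T ≠ M) (hMB : M ≠ B) (hTB : T ≠ B)
    (kMT : D.kind (meetTime c e X M T) = .under) (kBT : D.kind (meetTime c e X B T) = .under)
    (kBM : D.kind (meetTime c e X B M) = .under) : D'.reducedZeta = D.reducedZeta := by
  classical
  have hL := h.localChange
  set O : Set ℝ := {t | IsOuterCut D c t} with hOdef
  have hO : ∀ t, t ∈ O ↔ IsOuterCut D c t := fun t => Iff.rfl
  have hO' : ∀ t, t ∈ O ↔ IsOuterCut D' c t := fun t => (hL.isOuterCut_iff t).symm
  have hne : Nonempty O := ⟨entry hO 0⟩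
  have hno : ∀ i, ∀ t ∈ strand (c i), D.kind t ≠ .virt := by
    intro i t ht hv
    obtain ⟨j, hij, rfl⟩ := h.left.exists_meetTime ht (by rw [hv]; simp)
    have hv' := (h.left.kind_meetTime_eq_virt_iff hij).1 hv
    rcases eq_or_eq_or_eq_of_ne hTM hMB hTB i with rfl | rfl | rfl <;>
    rcases eq_or_eq_or_eq_of_ne hTM hMB hTB j with rfl | rfl | rfl <;> simp_all
  have hno' : ∀ i, ∀ t ∈ strand (c i), D'.kind t ≠ .virt := by
    intro i t ht hv
    obtain ⟨j, hij, rfl⟩ := h.right.exists_meetTime ht (by rw [hv]; simp)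
    rw [h.kind_meetTime] at hv
    exact hno i _ (h.left.meetTime_mem i j) hv
  have hK : ∀ i j, i ≠ j → D.overCoeff (meetTime c e X i j) =
      LaurentPolynomial.C (1 - D.weightAt (meetTime c e X i j)) *
        LaurentPolynomial.T (D.level (c j - 1) - D.level (c i - 1)) := fun i j hij =>
    overCoeff_eq_of_no_virt hno (h.left.meetTime_mem i j)
      (by rw [h.left.partner_meetTime hij]; exact h.left.meetTime_mem j i)
  have hK' : ∀ i j, i ≠ j → D'.overCoeff (meetTime c e (fun i j => -X i j) i j) =
      LaurentPolynomial.C (1 - D.weightAt (meetTime c e X i j)) *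
        LaurentPolynomial.T (D.level (c j - 1) - D.level (c i - 1)) := fun i j hij => by
    rw [overCoeff_eq_of_no_virt hno' (h.right.meetTime_mem i j)
      (by rw [h.right.partner_meetTime hij]; exact h.right.meetTime_mem j i),
      h.weightAt_meetTime hij, hL.level_left_eq, hL.level_left_eq]
  rw [h.left.reducedZeta_eq hO hTM hMB hTB kMT kBT kBM (h.meetTime_ne hTM hMB hTB) _ _ rfl rfl,
    h.right.reducedZeta_eq hO' hTM hMB hTB (by rw [h.kind_meetTime, kMT])
      (by rw [h.kind_meetTime, kBT]) (by rw [h.kind_meetTime, kBM])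
      (h.meetTime_ne' hTM hMB hTB) _ _ rfl rfl, ← hL.outerMatrix_eq hO]
  have hb := h.meetTime_lt_iff hTM hMB hTB
  have hm := h.meetTime_lt_iff hTB hMB.symm hTM
  have hb₂ := h.left.meetTime_lt_iff h.order hTM hMB hTB
  have hm₂ := h.left.meetTime_lt_iff h.order hTB hMB.symm hTM
  simp only [hb, hm, hK _ _ hTM.symm, hK _ _ hTB.symm, hK _ _ hMB.symm, hK' _ _ hTM.symm,
    hK' _ _ hTB.symm, hK' _ _ hMB.symm, h.weightAt_meetTime hTM.symm, h.weightAt_meetTime hTB.symm,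
    h.weightAt_meetTime hMB.symm]
  have w1 := weightAt_eq_pPow_or_qPow kBT
  have w2 := weightAt_eq_pPow_or_qPow kBM
  have w3 := weightAt_eq_pPow_or_qPow kMT
  rw [h.left.partner_meetTime hTB.symm, h.left.areaSign_meetTime hTB] at w1
  rw [h.left.partner_meetTime hMB.symm, h.left.areaSign_meetTime hMB] at w2
  rw [h.left.partner_meetTime hTM.symm, h.left.areaSign_meetTime hTM] at w3
  have hsgn : ∀ i j, dirSign (e i) * dirSign (e j) * slopeSign i j = 1 ∨
      dirSign (e i) * dirSign (e j) * slopeSign i j = -1 := by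
    intro i j
    rcases dirSign_eq_or (e i) with hd | hd <;> rcases dirSign_eq_or (e j) with hd' | hd' <;>
      rcases slopeSign_eq_or i j with hs | hs <;> rw [hd, hd', hs] <;> decide
  -- The power of `s` from `B` to `T` factors through `M`; this gives the product `a * b` in
  -- `triangle_rows_same`.
  have hT : D.level (c T - 1) - D.level (c B - 1) = (D.level (c M - 1) - D.level (c B - 1)) +
      (D.level (c T - 1) - D.level (c M - 1)) := by ring
  rw [hT, LaurentPolynomial.T_add]
  congr 2
  funext k
  by_cases hkM : k = M
  · rw [if_pos hkM, if_pos hkM]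
    rfl
  rw [if_neg hkM, if_neg hkM]
  by_cases hkB : k = B
  swap
  · rw [if_neg hkB, if_neg hkB]
    rfl
  rw [if_pos hkB, if_pos hkB]
  have hiff : (meetTime c e X B T < meetTime c e X B M ↔ meetTime c e X M T < meetTime c e X M B) ↔
      dirSign (e T) * dirSign (e B) * slopeSign T B =
        dirSign (e T) * dirSign (e M) * slopeSign T M := by
    rw [hb₂, hm₂]
    rcases dirSign_eq_or (e T) with d1 | d1 <;> rcases dirSign_eq_or (e B) with d2 | d2 <;>
    rcases dirSign_eq_or (e M) with d3 | d3 <;> rcases slopeSign_eq_or T B with s1 | s1 <;>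
    rcases slopeSign_eq_or T M with s2 | s2 <;> rw [d1, d2, d3, s1, s2] <;> decide
  have hrel : (meetTime c e X B T < meetTime c e X B M ↔
      meetTime c e X M T < meetTime c e X M B) →
      (1 - D.weightAt (meetTime c e X B M)) *
        (D.weightAt (meetTime c e X B T) - D.weightAt (meetTime c e X M T)) = 0 := by
    intro h'
    rw [← hiff.1 h'] at w3
    exact one_sub_mul_sub_eq_zero (hsgn T B) (hsgn M B) w1 w3 w2
  have hrel' : ¬ (meetTime c e X B T < meetTime c e X B M ↔
      meetTime c e X M T < meetTime c e X M B) →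
      (1 - D.weightAt (meetTime c e X B M)) *
        (1 - D.weightAt (meetTime c e X B T) * D.weightAt (meetTime c e X M T)) = 0 := by
    intro h'
    have h'' : dirSign (e T) * dirSign (e M) * slopeSign T M =
        -(dirSign (e T) * dirSign (e B) * slopeSign T B) := by
      have := mt hiff.2 h'
      rcases hsgn T B with a | a <;> rcases hsgn T M with b | b <;> rw [a, b] at this ⊢ <;>
        first | rfl | exact absurd rfl this
    rw [h''] at w3
    exact one_sub_mul_one_sub_mul_eq_zero (hsgn T B) (hsgn M B) w1 w3 w2
  have hC : ∀ {x : CoeffRing}, x = 0 → (LaurentPolynomial.C x : LaurentPolynomial CoeffRing) = 0 :=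
    fun hx => by rw [hx, map_zero]
  by_cases b1 : meetTime c e X B T < meetTime c e X B M <;>
  by_cases m1 : meetTime c e X M T < meetTime c e X M B
  · have hr := hC (hrel (by simp [b1, m1]))
    simp only [map_mul, map_sub, map_one] at hr
    simp only [b1, m1, not_true_eq_false, if_true, if_false, map_sub, map_one]
    exact (triangle_rows_same _ _ _ hr).symm
  · have hr := hC (hrel' (by simp [b1, m1]))
    simp only [map_mul, map_sub, map_one] at hr
    simp only [b1, m1, not_true_eq_false, not_false_eq_true, if_true, if_false, map_sub, map_one]
    exact (triangle_rows_opposite _ _ _ hr).symm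
  · have hr := hC (hrel' (by simp [b1, m1]))
    simp only [map_mul, map_sub, map_one] at hr
    simp only [b1, m1, not_true_eq_false, not_false_eq_true, if_true, if_false, map_sub, map_one]
    exact triangle_rows_opposite _ _ _ hr
  · have hr := hC (hrel (by simp [b1, m1]))
    simp only [map_mul, map_sub, map_one] at hr
    simp only [b1, m1, not_false_eq_true, if_true, if_false, map_sub, map_one]
    exact triangle_rows_same _ _ _ hr

/-- The move brings the crossing to the other side of the virtual strand `i`. Its level on either
strand changes by `1` with a sign that depends only on the side of `i`, so the difference of levels
is preserved. -/
theorem overCoeff_eq (h : OppositeTriangles D D' c e Y Y₂ X) {i u o : Fin 3} (hui : u ≠ i)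
    (huo : u ≠ o) (hio : i ≠ o) (hv : ∀ j, i ≠ j → D.kind (meetTime c e X i j) = .virt) :
    D'.overCoeff (meetTime c e (fun i j => -X i j) u o) =
      D.overCoeff (meetTime c e X u o) := by
  have hL := h.localChange
  have v1 : ∀ j, i ≠ j → D.kind (meetTime c e X j i) = .virt := fun j hj =>
    (h.left.kind_meetTime_eq_virt_iff hj).1 (hv j hj)
  have v2 : ∀ j, i ≠ j → D'.kind (meetTime c e (fun i j => -X i j) j i) = .virt := fun j hj => by
    rw [h.kind_meetTime, v1 j hj]
  rw [overCoeff, overCoeff, h.weightAt_meetTime huo, h.left.partner_meetTime huo,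
    h.right.partner_meetTime huo, h.left.level_meetTime hui huo hio,
    h.left.level_meetTime hio.symm huo.symm hui.symm, h.right.level_meetTime hui huo hio,
    h.right.level_meetTime hio.symm huo.symm hui.symm, hL.level_left_eq, hL.level_left_eq,
    h.left.stepAt_meetTime hui (v1 u hui.symm), h.left.stepAt_meetTime hio.symm (v1 o hio),
    h.right.stepAt_meetTime hui (v2 u hui.symm), h.right.stepAt_meetTime hio.symm (v2 o hio)]
  congr 2
  simp only [h.meetTime_lt_iff hio huo.symm hui.symm, h.meetTime_lt_iff hui.symm huo hio,
    h.left.meetTime_lt_iff h.order hio huo.symm hui.symm,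
    h.left.meetTime_lt_iff h.order hui.symm huo hio, slopeSign_swap hui.symm, slopeSign_swap hio]
  rcases dirSign_eq_or (e i) with d1 | d1 <;> rcases dirSign_eq_or (e u) with d2 | d2 <;>
  rcases dirSign_eq_or (e o) with d3 | d3 <;> rcases slopeSign_eq_or i u with s1 | s1 <;>
  rcases slopeSign_eq_or i o with s2 | s2 <;> rw [d1, d2, d3, s1, s2] <;> norm_num <;> ring

/-- The crossing of `u` under `o` is the only classical one in the square, and both its coefficients
are preserved. -/
theorem reducedZeta_eq_of_under (h : OppositeTriangles D D' c e Y Y₂ X) {i u o : Fin 3}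
    (hui : u ≠ i) (huo : u ≠ o) (hio : i ≠ o)
    (hv : ∀ j, i ≠ j → D.kind (meetTime c e X i j) = .virt)
    (hk : D.kind (meetTime c e X u o) = .under) : D'.reducedZeta = D.reducedZeta := by
  classical
  have hL := h.localChange
  set O : Set ℝ := {t | IsOuterCut D c t} with hOdef
  have hO : ∀ t, t ∈ O ↔ IsOuterCut D c t := fun t => Iff.rfl
  have hO' : ∀ t, t ∈ O ↔ IsOuterCut D' c t := fun t => (hL.isOuterCut_iff t).symm
  have hne : Nonempty O := ⟨entry hO 0⟩
  have hkind : ∀ k j, k ≠ j → D.kind (meetTime c e X k j) = .under → k = u ∧ j = o := by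
    intro k j hkj hk'
    have ho : D.kind (meetTime c e X o u) = .over := by
      rw [← h.left.partner_meetTime huo]
      exact kind_partner_of_under hk
    have v1 : ∀ j, i ≠ j → D.kind (meetTime c e X j i) = .virt := fun j hj =>
      (h.left.kind_meetTime_eq_virt_iff hj).1 (hv j hj)
    have a1 := hv u hui.symm
    have a2 := hv o hio
    have a3 := v1 u hui.symm
    have a4 := v1 o hio
    rcases eq_or_eq_or_eq_of_ne hui hio huo k with rfl | rfl | rfl <;>
    rcases eq_or_eq_or_eq_of_ne hui hio huo j with rfl | rfl | rfl <;> simp_all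
  rw [reducedZeta_eq_of_one_under h.left.strandsInSquare hO huo
      (h.left.meetTime_interior u o).1 (h.left.meetTime_interior u o).2
      (by rw [h.left.partner_meetTime huo]
          exact ⟨(h.left.meetTime_interior o u).1, (h.left.meetTime_interior o u).2.le⟩)
      (fun k t ht hk' => by
        obtain ⟨j, hkj, rfl⟩ := h.left.exists_meetTime ht (by rw [hk']; simp)
        obtain ⟨rfl, rfl⟩ := hkind k j hkj hk'
        rfl),
    reducedZeta_eq_of_one_under h.right.strandsInSquare hO' huo
      (h.right.meetTime_interior u o).1 (h.right.meetTime_interior u o).2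
      (by rw [h.right.partner_meetTime huo]
          exact ⟨(h.right.meetTime_interior o u).1, (h.right.meetTime_interior o u).2.le⟩)
      (fun k t ht hk' => by
        obtain ⟨j, hkj, rfl⟩ := h.right.exists_meetTime ht (by rw [hk']; simp)
        rw [h.kind_meetTime] at hk'
        obtain ⟨rfl, rfl⟩ := hkind k j hkj hk'
        rfl),
    ← hL.outerMatrix_eq hO, h.overCoeff_eq hui huo hio hv, h.weightAt_meetTime huo]
  rfl

theorem reducedZeta_eq_of_virt (h : OppositeTriangles D D' c e Y Y₂ X) {i : Fin 3}
    (hv : ∀ j, i ≠ j → D.kind (meetTime c e X i j) = .virt) : D'.reducedZeta = D.reducedZeta := by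
  classical
  have hL := h.localChange
  by_cases hex : ∃ k, ∃ t ∈ strand (c k), D.kind t = .under
  · obtain ⟨u, t, ht, hk⟩ := hex
    obtain ⟨o, huo, rfl⟩ := h.left.exists_meetTime ht (by rw [hk]; simp)
    have hui : u ≠ i := by
      rintro rfl
      rw [hv o huo] at hk
      cases hk
    have hio : i ≠ o := by
      rintro rfl
      rw [(h.left.kind_meetTime_eq_virt_iff hui.symm).1 (hv u hui.symm)] at hk
      cases hk
    exact h.reducedZeta_eq_of_under hui huo hio hv hk
  · push Not at hex
    set O : Set ℝ := {t | IsOuterCut D c t} with hOdef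
    have hO : ∀ t, t ∈ O ↔ IsOuterCut D c t := fun t => Iff.rfl
    have hO' : ∀ t, t ∈ O ↔ IsOuterCut D' c t := fun t => (hL.isOuterCut_iff t).symm
    have hne : Nonempty O := ⟨entry hO 0⟩
    rw [reducedZeta_eq_of_no_under h.left.strandsInSquare hO hex,
      reducedZeta_eq_of_no_under h.right.strandsInSquare hO' fun k t ht hk => by
        rw [h.kind_eq k t ht] at hk
        refine hex k _ ?_ hk
        rw [mem_strand] at ht ⊢
        constructor <;> linarith [ht.1, ht.2], ← hL.outerMatrix_eq hO]
    rfl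

end OppositeTriangles

end ThirdMove
end LongDiagram

namespace LongDiagram

/-! ### The third move and the conclusion -/

section ThirdMove

variable {D D' : LongDiagram}

/-- The half turn of a triangle. -/
theorem TrianglePicture.rotate {c e : Fin 3 → ℝ} {Y : Fin 3 → ℝ → ℝ} {X : Fin 3 → Fin 3 → ℝ}
    (h : TrianglePicture D c e Y X)
    (hout : ∀ t, (∀ i, t ∉ strand (c i)) → D'.curve t ∉ square)
    (hcurve : ∀ i, ∀ x ∈ Set.Icc (-1 : ℝ) 1, D'.curve (c i + e i * x) = (x, -(Y i (-x)))) :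
    TrianglePicture D' c e (fun i x => -(Y i (-x))) (fun i j => -X i j) where
  disjoint := h.disjoint
  dir := h.dir
  outside := hout
  curve_eq := hcurve
  bound i x hx := by
    rw [abs_neg]
    exact h.bound i _ ⟨by linarith [hx.2], by linarith [hx.1]⟩
  symm i j := by rw [h.symm]
  mem i j := ⟨by linarith [(h.mem i j).2], by linarith [(h.mem i j).1]⟩
  meet i j hij x hx := by
    rw [neg_inj, h.meet i j hij (-x) ⟨by linarith [hx.2], by linarith [hx.1]⟩, neg_eq_iff_eq_neg]
  slope := by
    obtain ⟨Y', hY⟩ := h.slope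
    refine ⟨fun i x => Y' i (-x), fun x hx => ?_⟩
    obtain ⟨h1, h2⟩ := hY (-x) ⟨by linarith [hx.2], by linarith [hx.1]⟩
    refine ⟨fun i => ?_, h2⟩
    have h3 := ((h1 i).comp x (hasDerivAt_neg x)).neg
    rw [mul_neg_one, neg_neg] at h3
    exact h3

/-- As `|g'| < 1`, the function `g x - x` is strictly decreasing and `g x + x` strictly increasing.
Each has a unique zero in the interval, positive and negative respectively because `g 0 > 0`. -/
theorem exists_trianglePicture {c e : Fin 3 → ℝ} {g : ℝ → ℝ}
    (hdisj : ∀ i j, i ≠ j → 2 < |c i - c j|) (hdir : ∀ i, e i = 1 ∨ e i = -1)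
    (hg : ContDiff ℝ ∞ g) (hg1 : g (-1) = 0) (hg2 : g 1 = 0) (hg0 : 0 < g 0)
    (hg' : ∀ x ∈ Set.Icc (-1 : ℝ) 1, |deriv g x| < 1)
    (hout : ∀ t, (∀ i, t ∉ strand (c i)) → D.curve t ∉ square)
    (hcurve : ∀ i, ∀ x ∈ Set.Icc (-1 : ℝ) 1, D.curve (c i + e i * x) =
      (x, (![fun x => x, fun x => -x, g] : Fin 3 → ℝ → ℝ) i x)) :
    ∃ X : Fin 3 → Fin 3 → ℝ,
      TrianglePicture D c e ![fun x => x, fun x => -x, g] X ∧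
      ∀ i j k, i ≠ j → j ≠ k → i ≠ k → (X k i < X k j ↔ slopeRank i < slopeRank j) := by
  have hd : ∀ x, HasDerivAt g (deriv g x) x := fun x =>
    (hg.differentiable (by simp) x).hasDerivAt
  have hcont := hg.continuous
  have hanti : StrictAntiOn (fun x => g x - x) (Set.Icc (-1) 1) := by
    refine strictAntiOn_of_deriv_neg (convex_Icc _ _) (hcont.sub continuous_id).continuousOn
      fun x hx => ?_
    rw [interior_Icc] at hx
    rw [show deriv (fun x => g x - x) x = _ from ((hd x).sub (hasDerivAt_id x)).deriv]
    linarith [(abs_lt.1 (hg' x (Set.Ioo_subset_Icc_self hx))).2]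
  have hmono : StrictMonoOn (fun x => g x + x) (Set.Icc (-1) 1) := by
    refine strictMonoOn_of_deriv_pos (convex_Icc _ _) (hcont.add continuous_id).continuousOn
      fun x hx => ?_
    rw [interior_Icc] at hx
    rw [show deriv (fun x => g x + x) x = _ from ((hd x).add (hasDerivAt_id x)).deriv]
    linarith [(abs_lt.1 (hg' x (Set.Ioo_subset_Icc_self hx))).1]
  obtain ⟨α, ⟨hα1, hα2⟩, hα⟩ : ∃ α ∈ Set.Ioo (0 : ℝ) 1, g α - α = 0 :=
    intermediate_value_Ioo' (by norm_num : (0 : ℝ) ≤ 1)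
      (hcont.sub continuous_id).continuousOn ⟨by simp [hg2], by simpa using hg0⟩
  obtain ⟨β, ⟨hβ1, hβ2⟩, hβ⟩ : ∃ β ∈ Set.Ioo (-1 : ℝ) 0, g β + β = 0 :=
    intermediate_value_Ioo (by norm_num : (-1 : ℝ) ≤ 0)
      (hcont.add continuous_id).continuousOn ⟨by simp [hg1], by simpa using hg0⟩
  -- By monotonicity both `g x - x` and `g x + x` lie between their end values `1` and `-1`; so does
  -- their mean `g x`.
  have hbound : ∀ x ∈ Set.Icc (-1 : ℝ) 1, |g x| ≤ 1 := by
    intro x hx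
    have e1 : (-1 : ℝ) ∈ Set.Icc (-1 : ℝ) 1 := ⟨le_rfl, by norm_num⟩
    have e2 : (1 : ℝ) ∈ Set.Icc (-1 : ℝ) 1 := ⟨by norm_num, le_rfl⟩
    have h1 := hanti.antitoneOn e1 hx hx.1
    have h2 := hanti.antitoneOn hx e2 hx.2
    have h3 := hmono.monotoneOn e1 hx hx.1
    have h4 := hmono.monotoneOn hx e2 hx.2
    simp only [hg1, hg2] at h1 h2 h3 h4
    exact abs_le.2 ⟨by linarith, by linarith⟩
  have hα3 : ∀ x ∈ Set.Icc (-1 : ℝ) 1, g x = x ↔ x = α := by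
    intro x hx
    rw [← sub_eq_zero, ← hα]
    exact hanti.injOn.eq_iff hx ⟨by linarith, hα2.le⟩
  have hβ3 : ∀ x ∈ Set.Icc (-1 : ℝ) 1, g x = -x ↔ x = β := by
    intro x hx
    rw [← add_eq_zero_iff_eq_neg, ← hβ]
    exact hmono.injOn.eq_iff hx ⟨hβ1.le, by linarith⟩
  -- The diagonal entries are dummies, which must only lie inside the interval.
  refine ⟨![![0, 0, α], ![0, 0, β], ![α, β, 0]], ⟨hdisj, hdir, hout, hcurve, ?_, ?_, ?_, ?_, ?_⟩, ?_⟩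
  · intro i x hx
    fin_cases i
    · exact abs_le.2 hx
    · exact (abs_neg x).trans_le (abs_le.2 hx)
    · exact hbound x hx
  · intro i j
    fin_cases i <;> fin_cases j <;> rfl
  · intro i j
    fin_cases i <;> fin_cases j <;> constructor <;> simp <;> linarith
  · intro i j hij x hx
    fin_cases i <;> fin_cases j
    · exact absurd rfl hij
    · exact self_eq_neg
    · exact eq_comm.trans (hα3 x hx)
    · exact eq_comm.trans self_eq_neg
    · exact absurd rfl hij
    · exact eq_comm.trans (hβ3 x hx)
    · exact hα3 x hx
    · exact hβ3 x hx
    · exact absurd rfl hij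
  · refine ⟨![fun _ => 1, fun _ => -1, deriv g], fun x hx => ⟨fun i => ?_, fun i j hij => ?_⟩⟩
    · fin_cases i
      · exact hasDerivAt_id x
      · exact hasDerivAt_neg x
      · exact hd x
    · have h' := abs_lt.1 (hg' x (Set.Ioo_subset_Icc_self hx))
      fin_cases i <;> fin_cases j <;>
        first | exact absurd hij (by decide) | exact h'.1 | exact h'.2 | simp
  · intro i j k hij hjk hik
    fin_cases i <;> fin_cases j <;> fin_cases k <;>
      first | exact absurd rfl hij | exact absurd rfl hjk | exact absurd rfl hik |
        (simp [slopeRank]; linarith)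

theorem reducedZeta_moveThree (h : MoveThree D D') : D'.reducedZeta = D.reducedZeta := by
  obtain ⟨c, e, g, hdisj, hdir, hg, hg1, hg2, hg0, hg', hsame, htypes, hpic⟩ := h
  have hmem : ∀ t, (∀ i, t ∉ strand (c i)) → t ∉ ⋃ i, strand (c i) := fun t ht h => by
    obtain ⟨i, hi⟩ := Set.mem_iUnion.1 h
    exact ht i hi
  have hout : ∀ t, (∀ i, t ∉ strand (c i)) → D.curve t ∉ square := fun t ht =>
    (hsame t (hmem t ht)).1
  obtain ⟨X, hX, horder⟩ := exists_trianglePicture hdisj hdir hg hg1 hg2 hg0 hg' hout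
    fun i x hx => (hpic i x hx).1
  have hopp : OppositeTriangles D D' c e _ _ X :=
    { left := hX
      right := hX.rotate (fun t ht => by
        rw [(hsame t (hmem t ht)).2.1]
        exact hout t ht) fun i x hx => (hpic i x hx).2.1
      same := fun t ht => (hsame t (hmem t ht)).2
      kind_eq := fun i t ht => by
        obtain ⟨x, hx, rfl⟩ := (mem_strand_iff_exists (hdir i)).1 ht
        rw [(hpic i x hx).2.2]
        congr 1
        ring
      order := horder }
  rcases htypes with ⟨height, hh⟩ | ⟨i, hi⟩
  · have hne : ∀ {a b : Fin 3}, a ≠ b → height.symm a ≠ height.symm b := fun hab h' =>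
      hab (height.symm.injective h')
    have hunder : ∀ a b : Fin 3, b < a → D.kind (meetTime c e X (height.symm b) (height.symm a)) =
        .under := fun a b hab =>
      (hh (height.symm a) (height.symm b) (by simpa using hab) _ (hX.meetTime_mem _ _) _
        (hX.meetTime_mem _ _) (hX.curve_meetTime (hne hab.ne'))).2
    -- Heights `2`, `1`, `0` are the top, middle and lowest strands.
    exact hopp.reducedZeta_eq_of_classical (T := height.symm 2) (M := height.symm 1)
      (B := height.symm 0) (hne (by decide)) (hne (by decide)) (hne (by decide))
      (hunder 2 1 (by decide)) (hunder 2 0 (by decide)) (hunder 1 0 (by decide))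
  · exact hopp.reducedZeta_eq_of_virt fun j hij =>
      (hi _ (hX.meetTime_mem i j)).resolve_left (hX.kind_meetTime_ne_regular hij)

/-- Powers of `q` are invertible and multiply along a chain, so equality up to such a factor is an
equivalence relation and only the moves need checking. -/
theorem exists_reducedZeta_of_equivalent (h : Equivalent D D') :
    ∃ r : ℤ, D'.reducedZeta = LaurentPolynomial.C (qPow r) * D.reducedZeta := by
  have hone : ∀ {E E' : LongDiagram}, E'.reducedZeta = E.reducedZeta →
      ∃ r : ℤ, E'.reducedZeta = LaurentPolynomial.C (qPow r) * E.reducedZeta := fun h =>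
    ⟨0, by rw [h, qPow_zero, map_one, one_mul]⟩
  induction h with
  | rel E E' h =>
    rcases h with h | h | h | h
    · exact hone (reducedZeta_isotopic h)
    · exact exists_reducedZeta_moveOne h
    · exact hone (reducedZeta_moveTwo h)
    · exact hone (reducedZeta_moveThree h)
  | refl E => exact hone rfl
  | symm E E' _ ih =>
    obtain ⟨r, hr⟩ := ih
    refine ⟨-r, ?_⟩
    rw [hr, ← mul_assoc, ← map_mul, ← qPow_add, neg_add_cancel, qPow_zero, map_one, one_mul]
  | trans E E' E'' _ _ ih ih' =>
    obtain ⟨r, hr⟩ := ih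
    obtain ⟨r', hr'⟩ := ih'
    refine ⟨r' + r, ?_⟩
    rw [hr', hr, ← mul_assoc, ← map_mul, ← qPow_add]

end ThirdMove
end LongDiagram

end

theorem theorem1 (D D' : LongDiagram) (hD : 1 ≤ Fintype.card D.Crossing)
    (hD' : 1 ≤ Fintype.card D'.Crossing) (h : LongDiagram.Equivalent D D') :
    ∃ r : ℤ, D'.zeta = LaurentPolynomial.C (qPow r) * D.zeta := by
  obtain ⟨r, hr⟩ := LongDiagram.exists_reducedZeta_of_equivalent h
  exact ⟨r, by
    rw [LongDiagram.zeta_eq_reducedZeta hD', LongDiagram.zeta_eq_reducedZeta hD, hr]⟩
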